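/- Fix a countably infinite alphabet of variables. Words are nonempty finite strings of variables; an identity is a pair of words ${\bf u}\approx{\bf v}$, and it is trivial if ${\bf u}={\bf v}$. A monoid $S$ satisfies ${\bf u}\approx{\bf v}$ if both sides take the same value under every assignment of elements of $S$ to the variables. A word ${\bf u}$ is an isoterm for $S$ if $S$ satisfies no nontrivial identity ${\bf u}\approx{\bf v}$. Let $occ_{\bf u}(x)$ be the number of occurrences of $x$ in ${\bf u}$; $x$ is linear in ${\bf u}$ if $occ_{\bf u}(x)=1$ and non-linear if $occ_{\bf u}(x)>1$; $\mathrm{lin}({\bf u})$ is the set of linear variables of ${\bf u}$. For a set $X$ of variables, ${\bf u}(X)$ is obtained from ${\bf u}$ by deleting all occurrences of variables not in $X$. A word is almost-linear if it has at most one non-linear variable; an identity is almost-linear if both its sides are. An identity ${\bf u}\approx{\bf v}$ is block-balanced if ${\bf u}(\{x\}\cup \mathrm{lin}({\bf u}))={\bf v}(\{x\}\cup \mathrm{lin}({\bf u}))$ for every variable $x$. A pair of distinct variables $\{x,y\}$ is b-unstable in a word ${\bf u}$ with respect to $S$ if $S$ satisfies a block-balanced identity ${\bf u}\approx{\bf v}$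 with ${\bf u}(\{x,y\})\neq{\bf v}(\{x,y\})$. Theorem. Let $S$ be a monoid that satisfies $$\sigma_1:\ xyt_1xt_2y\approx yxt_1xt_2y\qquad\text{and}\qquad \sigma_2:\ xt_1yt_2xy\approx xt_1yt_2yx,$$ and for which the word $xy$ is an isoterm, where $x,y,t_1,t_2$ are distinct variables. Suppose that: (i) for all $m,n>1$, if $x^my^n$ is not an isoterm for $S$, then for some $0<d<m$ and $0<c<n$, $S$ satisfies $x^{d}t_1x^{m-d}y^{n-c}t_2y^c\approx x^{d}t_1y^{n-c}x^{m-d}t_2y^c$; (ii) for all distinct variables $x,y$, every $k$ and every word ${\bf A}$ not containing $y$ such that ${\bf A}x$ is almost-linear and $occ_{\bf A}(x)>0$: if $\{x,y\}$ is b-unstable in ${\bf A}xy^k$ with respect to $S$, then for some $0<c<k$, $S$ satisfies ${\bf A}xy^cty^{k-c}\approx{\bf A}yxy^{c-1}ty^{k-c}$, where $t$ is a variable different from $x,y$ and not occurring in ${\bf A}$; (iii) for all distinct variables $x,y$, every $k$ and every word ${\bf B}$ not containing $x$ such that $y{\bf B}$ is almost-linear and $occ_{\bf B}(y)>0$: if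 $\{x,y\}$ is b-unstable in $x^ky{\bf B}$ with respect to $S$, then for some $0<p<k$, $S$ satisfies $x^{k-p}tx^py{\bf B}\approx x^{k-p}tx^{p-1}yx{\bf B}$, where $t$ is a variable different from $x,y$ and not occurring in ${\bf B}$. Then $S$ is finitely based by some almost-linear identities and some block-balanced identities with two non-linear variables: there is a finite set of identities satisfied by $S$, each of which is either almost-linear or block-balanced with exactly two non-linear variables, from which every identity of $S$ can be derived (by substitution of words for variables, multiplication by words on the left and right, and reflexivity, symmetry and transitivity). -/

import Mathlib

namespace WordId

/-- Words over the countably infinite alphabet `ℕ`. The empty word `1` is allowed here as an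
auxiliary word (a deletion may produce it), but the two sides of an identity are nonempty. -/
abbrev Word := FreeMonoid ℕ

/-- The one-letter word `x`. -/
abbrev ltr (x : ℕ) : Word := FreeMonoid.of x

/-- An identity `u ≈ v` is the ordered pair `(u, v)`. -/
abbrev Identity := Word × Word

/-- The number of occurrences of the variable `x` in `u`. -/
def occ (u : Word) (x : ℕ) : ℕ := (FreeMonoid.toList u).count x

/-- The variables that occur exactly once in `u`. -/
def lin (u : Word) : Set ℕ := {x | occ u x = 1}

/-- The variables that occur more than once in `u`. -/
def non (u : Word) : Set ℕ := {x | 1 < occ u x}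

open Classical in
/-- The word `u(X)`: delete all occurrences of all variables that are not in `X`. -/
noncomputable def restr (u : Word) (X : Set ℕ) : Word :=
  FreeMonoid.ofList ((FreeMonoid.toList u).filter (fun z => decide (z ∈ X)))

/-- A word is almost-linear if it contains at most one non-linear variable. -/
def AlmostLinear (u : Word) : Prop := (non u).Subsingleton

/-- `S ⊨ u ≈ v`. -/
def Sat (S : Type*) [Monoid S] (u v : Word) : Prop :=
  ∀ φ : ℕ → S, FreeMonoid.lift φ u = FreeMonoid.lift φ v

/-- The equational theory of `S`: all identities between nonempty words holding in `S`. -/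
def EqTheory (S : Type*) [Monoid S] : Set Identity :=
  {e | e.1 ≠ 1 ∧ e.2 ≠ 1 ∧ Sat S e.1 e.2}

/-- The nonempty word `u` is an isoterm for `S` if every identity `u ≈ v` of `S` is trivial. -/
def IsIsoterm (S : Type*) [Monoid S] (u : Word) : Prop :=
  u ≠ 1 ∧ ∀ v : Word, (u, v) ∈ EqTheory S → u = v

/-- Both sides of the identity are almost-linear. -/
def AlmostLinearId (e : Identity) : Prop := AlmostLinear e.1 ∧ AlmostLinear e.2

/-- `u ≈ v` is block-balanced if `u(x, lin u) = v(x, lin u)` for every variable `x`. -/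
def BlockBalanced (e : Identity) : Prop :=
  ∀ x : ℕ, restr e.1 ({x} ∪ lin e.1) = restr e.2 ({x} ∪ lin e.1)

/-- The identity involves exactly two non-linear variables. -/
def TwoNonlinear (e : Identity) : Prop := (non e.1 ∪ non e.2).ncard = 2

/-- The pair `{x, y}` is b-unstable in `u` with respect to `S`. -/
def BUnstable (S : Type*) [Monoid S] (x y : ℕ) (u : Word) : Prop :=
  ∃ v : Word, (u, v) ∈ EqTheory S ∧ BlockBalanced (u, v) ∧ restr u {x, y} ≠ restr v {x, y}

/-- `Derives B u v`: the identity `u ≈ v` can be derived from the set `B` of identities in the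
equational logic of semigroups (variables are replaced by nonempty words). -/
inductive Derives (B : Set Identity) : Word → Word → Prop
  | refl (u : Word) : Derives B u u
  | symm {u v : Word} : Derives B u v → Derives B v u
  | trans {u v w : Word} : Derives B u v → Derives B v w → Derives B u w
  | step {a b : Word} (h : (a, b) ∈ B) (θ : ℕ → Word) (hθ : ∀ z, θ z ≠ 1) (p q : Word) :
      Derives B (p * FreeMonoid.lift θ a * q) (p * FreeMonoid.lift θ b * q)

/-- `S` is finitely based by some identities that have the property `P`: finitely many
identities of `S`, all with property `P`, from which every identity of `S` can be derived. -/
def FinitelyBasedBy (S : Type*) [Monoid S] (P : Identity → Prop) : Prop :=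
  ∃ B : Set Identity, B.Finite ∧ B ⊆ EqTheory S ∧ (∀ e ∈ B, P e) ∧
    ∀ e ∈ EqTheory S, Derives B e.1 e.2

/-- `S ⊨ σ₁`, where `σ₁` is `x y t₁ x t₂ y ≈ y x t₁ x t₂ y`. -/
def SatSigma1 (S : Type*) [Monoid S] : Prop :=
  ∀ x y t₁ t₂ : ℕ, [x, y, t₁, t₂].Nodup →
    Sat S (ltr x * ltr y * ltr t₁ * ltr x * ltr t₂ * ltr y)
      (ltr y * ltr x * ltr t₁ * ltr x * ltr t₂ * ltr y)

/-- `S ⊨ σ₂`, where `σ₂` is `x t₁ y t₂ x y ≈ x t₁ y t₂ y x`. -/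
def SatSigma2 (S : Type*) [Monoid S] : Prop :=
  ∀ x y t₁ t₂ : ℕ, [x, y, t₁, t₂].Nodup →
    Sat S (ltr x * ltr t₁ * ltr y * ltr t₂ * ltr x * ltr y)
      (ltr x * ltr t₁ * ltr y * ltr t₂ * ltr y * ltr x)

end WordId

namespace WordId

/-! Let `M` be the free monoid modulo derivability from a suitable finite set of identities of `S`;
it is enough that every identity of `S` holds in `M`. `Setup` lists what is used about `M`: it
satisfies σ₁ and σ₂, every almost-linear identity of `S` of the form `Rel`, and every identity of
`S` of the form `Sw`, which interchanges an adjacent last `x` and first `y`.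

Modulo σ₁ and σ₂, two adjacent occurrences of non-linear letters commute unless one is the last
occurrence of its letter and the other the first of its own. Since `xy` is an isoterm, both sides of
an identity `u ≈ v` of `S` have the same linear letters in the same order, and these cut the words
into blocks. The identity is then derived in two stages.

Stage one, `exists_blockBalanced`, treats the non-linear letters `y` of `u` one by one. The
occurrences of `y` in each block are gathered into a power (`exists_spread`), and an almost-linear
identity then replaces the exponents by those in `v` (`exists_adjust`). Gathering is obstructed only
if all of `y` lies in one block. In that case, if all words `y^m t²` and `t² y^m` are isoterms, the
identity cannot move `y` relative to the linear letters; otherwise (i) supplies an interchange that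
removes the obstruction.

Stage two, `satL_of_bbl`, sorts the resulting block-balanced identity by adjacent swaps. Only swaps
of a last `x` with a first `y` need more than σ₁ and σ₂. `swap_critical` takes the interchange from
(i), (ii), (iii) or the identity itself, according to whether `x` occurs in an earlier block and `y`
in a later one.

Finiteness comes from Higman's lemma on sequences of exponents: `exists_rel_basis` reduces sequences
to normal forms by finitely many rules, and `exists_sw_basis` uses that interchanges are inherited
by larger exponents (`Sw.mono`). The finite set is finally closed under deletion of letters, because
derivations substitute nonempty words only. -/

variable {S M : Type*} [Monoid S] [Monoid M]

/-! ### Identities between lists of letters: deletion and duality. -/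

/-- Satisfaction of an identity whose sides are given as lists of letters. -/
def SatL (M : Type*) [Monoid M] (u v : List ℕ) : Prop :=
  ∀ φ : ℕ → M, (u.map φ).prod = (v.map φ).prod

theorem sat_iff_satL {u v : Word} :
    Sat M u v ↔ SatL M (FreeMonoid.toList u) (FreeMonoid.toList v) := by
  simp [Sat, SatL, FreeMonoid.lift_apply]

theorem SatL.refl (u : List ℕ) : SatL M u u := fun _ => rfl

theorem SatL.symm {u v : List ℕ} (h : SatL M u v) : SatL M v u := fun φ => (h φ).symm

theorem SatL.trans {u v w : List ℕ} (h : SatL M u v) (h' : SatL M v w) : SatL M u w :=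
  fun φ => (h φ).trans (h' φ)

theorem SatL.append {u v u' v' : List ℕ} (h : SatL M u v) (h' : SatL M u' v') :
    SatL M (u ++ u') (v ++ v') := fun φ => by
  simp [h φ, h' φ]

theorem SatL.append_left (p : List ℕ) {u v : List ℕ} (h : SatL M u v) :
    SatL M (p ++ u) (p ++ v) := (SatL.refl p).append h

theorem SatL.append_right (q : List ℕ) {u v : List ℕ} (h : SatL M u v) :
    SatL M (u ++ q) (v ++ q) := h.append (SatL.refl q)

/-- In a monoid, deleting letters amounts to assigning 1 to them. -/
theorem SatL.filter {u v : List ℕ} (h : SatL M u v) (f : ℕ → Bool) :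
    SatL M (u.filter f) (v.filter f) := by
  have key : ∀ (φ : ℕ → M) (w : List ℕ),
      ((w.filter f).map φ).prod = (w.map (fun z => if f z then φ z else 1)).prod := by
    intro φ w
    induction w with
    | nil => rfl
    | cons z w ih => by_cases hz : f z <;> simp [hz, ih]
  intro φ
  rw [key, key, h]

theorem map_op_prod (φ : ℕ → M) (u : List ℕ) :
    (u.map (fun z => MulOpposite.op (φ z))).prod = MulOpposite.op ((u.reverse.map φ).prod) := by
  induction u with
  | nil => rfl
  | cons z u ih => simp [ih]

/-- Reading words backwards means passing to the opposite monoid. With `Sig.op`, this yields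
left-hand versions of right-hand statements without a second proof. -/
theorem SatL.of_reverse_op {u v : List ℕ} (h : SatL Mᵐᵒᵖ u.reverse v.reverse) :
    SatL M u v := by
  intro φ
  have := h (fun z => MulOpposite.op (φ z))
  rw [map_op_prod, map_op_prod] at this
  simpa using MulOpposite.op_injective this

/-! ### Commutation of adjacent letters by σ₁ and σ₂. -/

/-- The elementwise form of `σ₁` and `σ₂`. -/
def Sig (M : Type*) [Monoid M] : Prop :=
  (∀ x y s t : M, x * y * s * x * t * y = y * x * s * x * t * y) ∧
    (∀ x y s t : M, x * s * y * t * x * y = x * s * y * t * y * x)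

/-- σ₁ and σ₂ are mirror images of each other. -/
theorem Sig.op (h : Sig M) : Sig Mᵐᵒᵖ := by
  constructor
  · intro x y s t
    apply MulOpposite.unop_injective
    have := h.2 y.unop x.unop t.unop s.unop
    simpa [mul_assoc] using this
  · intro x y s t
    apply MulOpposite.unop_injective
    have := h.1 y.unop x.unop t.unop s.unop
    simpa [mul_assoc] using this

/-- This is σ₁, with its two letters named according to which of `a`, `b` is met first in `q`. -/
theorem Sig.swap_of_mem_right (h : Sig M) (p : List ℕ) {q : List ℕ} {a b : ℕ} (ha : a ∈ q)
    (hb : b ∈ q) : SatL M (p ++ a :: b :: q) (p ++ b :: a :: q) := by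
  intro φ
  by_cases hab : a = b
  · rw [hab]
  obtain ⟨q₁, q₂, rfl⟩ := List.append_of_mem ha
  simp only [List.mem_append, List.mem_cons] at hb
  rcases hb with hb | hb | hb
  · obtain ⟨q₃, q₄, rfl⟩ := List.append_of_mem hb
    have := h.1 (φ b) (φ a) (q₃.map φ).prod (q₄.map φ).prod
    have := congrArg (fun z => (p.map φ).prod * z * (q₂.map φ).prod) this
    simpa [mul_assoc] using this.symm
  · exact absurd hb.symm hab
  · obtain ⟨q₃, q₄, rfl⟩ := List.append_of_mem hb
    have := h.1 (φ a) (φ b) (q₁.map φ).prod (q₃.map φ).prod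
    have := congrArg (fun z => (p.map φ).prod * z * (q₄.map φ).prod) this
    simpa [mul_assoc] using this

theorem Sig.swap_of_mem_left (h : Sig M) {p : List ℕ} (q : List ℕ) {a b : ℕ} (ha : a ∈ p)
    (hb : b ∈ p) : SatL M (p ++ a :: b :: q) (p ++ b :: a :: q) := by
  have := h.op.swap_of_mem_right q.reverse (q := p.reverse) (a := b) (b := a)
    (by simpa using hb) (by simpa using ha)
  apply SatL.of_reverse_op
  simpa using this

/-- An occurrence of `x` which is neither the first nor the last one commutes with every factor
all of whose letters are non-linear. -/
theorem Sig.move (h : Sig M) {x : ℕ} {q : List ℕ} (hq : x ∈ q) (c : List ℕ) :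
    ∀ p : List ℕ, x ∈ p → (∀ z ∈ c, 1 < (p ++ c ++ q).count z) →
      SatL M (p ++ x :: c ++ q) (p ++ c ++ x :: q) := by
  induction c with
  | nil => intro p _ _; simpa using SatL.refl _
  | cons z c ih =>
    intro p hp hc
    have ih' := ih (p ++ [z]) (by simp [hp]) (fun w hw => by
      have := hc w (by simp [hw]); simpa using this)
    refine SatL.trans ?_ (by simpa using ih')
    have hz := hc z (by simp)
    -- A non-linear `z` occurs either earlier or later, and `x` does both; so σ₂ or σ₁ applies.
    by_cases hzp : z ∈ p
    · simpa using h.swap_of_mem_left (c ++ q) hp hzp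
    · have : z ∈ c ++ q := by
        by_contra hn
        have h1 : p.count z = 0 := List.count_eq_zero.2 hzp
        have h2 : (c ++ q).count z = 0 := List.count_eq_zero.2 hn
        simp only [List.append_assoc, List.count_append, List.cons_append,
          List.count_cons_self] at hz h2
        omega
      simpa using h.swap_of_mem_right p (q := c ++ q) (by simp [hq]) this

theorem Sig.move_replicate (h : Sig M) {x : ℕ} {q : List ℕ} (hq : x ∈ q) (c : List ℕ) (k : ℕ)
    {p : List ℕ} (hp : x ∈ p) (hc : ∀ z ∈ c, z ≠ x → 1 < (p ++ c ++ q).count z) :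
    SatL M (p ++ List.replicate k x ++ c ++ q) (p ++ c ++ List.replicate k x ++ q) := by
  induction k generalizing p with
  | zero => simpa using SatL.refl _
  | succ k ih =>
    have hx : ∀ p' : List ℕ, x ∈ p' → 1 < (p' ++ c ++ q).count x := by
      intro p' hp'
      have := List.count_pos_iff.2 hp'
      have := List.count_pos_iff.2 hq
      simp only [List.count_append]; omega
    have h1 := ih (p := p ++ [x]) (by simp) (fun z hz hzx => by
      have := hc z hz hzx
      simp only [List.count_append] at this ⊢; omega)
    have h2 := h.move (x := x) (q := List.replicate k x ++ q) (by simp [hq]) c p hp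
      (fun z hz => by
        by_cases hzx : z = x
        · subst hzx
          have := hx p hp
          simp only [List.count_append] at this ⊢; omega
        · have := hc z hz hzx
          simp only [List.count_append] at this ⊢; omega)
    have e1 : p ++ List.replicate (k+1) x ++ c ++ q = p ++ [x] ++ List.replicate k x ++ c ++ q := by
      simp [List.replicate_succ]
    rw [e1]
    refine h1.trans ?_
    simpa [List.replicate_succ] using h2

/-! ### Powers of one letter between separators. -/

/-- `m ^ a₀ * s₀ * m ^ a₁ * s₁ * ⋯`. -/
def weave (m : M) : List ℕ → List M → M
  | a :: l, s :: r => m ^ a * s * weave m l r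
  | _, _ => 1

/-- The mirror image `⋯ * s₁ * m ^ a₁ * s₀ * m ^ a₀` of `weave`. -/
def weave' (m : M) : List ℕ → List M → M
  | a :: l, s :: r => weave' m l r * s * m ^ a
  | _, _ => 1

/-- The word `y ^ a₀ s₀ y ^ a₁ s₁ ⋯`. -/
def weaveL (y : ℕ) : List ℕ → List (List ℕ) → List ℕ
  | a :: l, s :: r => List.replicate a y ++ s ++ weaveL y l r
  | _, _ => []

theorem prod_map_weaveL (φ : ℕ → M) (y : ℕ) (E : List ℕ) (s : List (List ℕ)) :
    ((weaveL y E s).map φ).prod = weave (φ y) E (s.map (fun w => (w.map φ).prod)) := by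
  induction E generalizing s with
  | nil => simp [weaveL, weave]
  | cons a E ih => cases s <;> simp [weaveL, weave, ih, mul_assoc]

theorem prod_map_reverse_weaveL (φ : ℕ → M) (y : ℕ) (E : List ℕ) (s : List (List ℕ)) :
    ((weaveL y E s).reverse.map φ).prod
      = weave' (φ y) E (s.map (fun w => (w.reverse.map φ).prod)) := by
  induction E generalizing s with
  | nil => simp [weaveL, weave']
  | cons a E ih =>
    cases s
    · simp [weaveL, weave']
    · have := ih ‹_›
      simp only [List.map_reverse] at this
      simp [weaveL, weave', this, mul_assoc]

/-- Add one to the head of a list. -/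
def bump : List ℕ → List ℕ
  | a :: l => (a + 1) :: l
  | [] => [1]

/-- The exponents of `y` in the blocks of a word, cut at the letters from `T`. -/
def exps (y : ℕ) (T : Finset ℕ) : List ℕ → List ℕ
  | [] => [0]
  | z :: Q => if z ∈ T then 0 :: exps y T Q else if z = y then bump (exps y T Q) else exps y T Q

theorem exps_ne_nil (y : ℕ) (T : Finset ℕ) (Q : List ℕ) : exps y T Q ≠ [] := by
  induction Q with
  | nil => simp [exps]
  | cons z Q ih =>
    unfold exps
    split_ifs
    · simp
    · cases h : exps y T Q <;> simp [bump]
    · exact ih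

theorem sum_exps {y : ℕ} {T : Finset ℕ} (hy : y ∉ T) (Q : List ℕ) :
    (exps y T Q).sum = Q.count y := by
  induction Q with
  | nil => simp [exps]
  | cons z Q ih =>
    unfold exps
    split_ifs with h1 h2
    · have : z ≠ y := fun h => hy (h ▸ h1)
      simp [ih, this]
    · subst h2
      have := exps_ne_nil z T Q
      cases h : exps z T Q with
      | nil => exact absurd h this
      | cons a l => rw [h] at ih; simp [bump] at ih ⊢; omega
    · simp [ih, h2]

theorem length_exps {y : ℕ} {T : Finset ℕ} (hy : y ∉ T) (Q : List ℕ) :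
    (exps y T Q).length = (Q.filter (· ∈ T)).length + 1 := by
  induction Q with
  | nil => simp [exps]
  | cons z Q ih =>
    unfold exps
    split_ifs with h1 h2
    · simp [ih, h1]
    · subst h2
      cases h : exps z T Q with
      | nil => exact absurd h (exps_ne_nil z T Q)
      | cons a l => rw [h] at ih; simpa [bump, h1] using ih
    · simpa [h1] using ih

theorem weave_bump (m : M) {E : List ℕ} (hE : E ≠ []) {s : List M} (hs : s ≠ []) :
    weave m (bump E) s = m * weave m E s := by
  cases E with
  | nil => exact absurd rfl hE
  | cons a E => cases s with
    | nil => exact absurd rfl hs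
    | cons t s => simp [bump, weave, pow_succ', mul_assoc]

theorem weaveL_bump (y : ℕ) {E : List ℕ} (hE : E ≠ []) {s : List (List ℕ)} (hs : s ≠ []) :
    weaveL y (bump E) s = y :: weaveL y E s := by
  cases E with
  | nil => exact absurd rfl hE
  | cons a E => cases s with
    | nil => exact absurd rfl hs
    | cons t s => simp [bump, weaveL, List.replicate_succ]

theorem length_bump {E : List ℕ} (hE : E ≠ []) : (bump E).length = E.length := by
  cases E with
  | nil => exact absurd rfl hE
  | cons a E => rfl

/-- Evaluating at an assignment that ignores all letters except `y` and those of `T`. -/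
theorem prod_map_eq_weave {y : ℕ} {T : Finset ℕ} (hy : y ∉ T) (φ : ℕ → M)
    (hφ : ∀ z, z ∉ T → z ≠ y → φ z = 1) (Q : List ℕ) :
    (Q.map φ).prod = weave (φ y) (exps y T Q) ((Q.filter (· ∈ T)).map φ ++ [1]) := by
  induction Q with
  | nil => simp [exps, weave]
  | cons z Q ih =>
    unfold exps
    split_ifs with h1 h2
    · simp [h1, weave, ih]
    · subst h2
      rw [weave_bump _ (exps_ne_nil _ _ _) (by simp)]
      simp [h1, ih]
    · simp [h1, hφ z h1 h2, ih]

theorem filter_eq_weaveL {y : ℕ} {T : Finset ℕ} (hy : y ∉ T) (Q : List ℕ) :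
    Q.filter (fun z => z = y ∨ z ∈ T)
      = weaveL y (exps y T Q) ((Q.filter (· ∈ T)).map (fun t => [t]) ++ [[]]) := by
  induction Q with
  | nil => simp [exps, weaveL]
  | cons z Q ih =>
    unfold exps
    split_ifs with h1 h2
    · simp [h1, weaveL, ← ih]
    · subst h2
      rw [weaveL_bump _ (exps_ne_nil _ _ _) (by simp)]
      simp [h1, ← ih]
    · simp [h1, h2, ← ih]

theorem exps_filter {y : ℕ} {T : Finset ℕ} (f : ℕ → Bool) (hf : ∀ z, z = y ∨ z ∈ T → f z = true)
    (Q : List ℕ) : exps y T (Q.filter f) = exps y T Q := by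
  induction Q with
  | nil => rfl
  | cons z Q ih =>
    by_cases hz : f z
    · simp [hz, exps, ih]
    · have h1 : z ∉ T := fun h => hz (hf z (.inr h))
      have h2 : z ≠ y := fun h => hz (hf z (.inl h))
      simp [hz, exps, ih, h1, h2]

theorem count_filter_ne {y z : ℕ} (hz : z ≠ y) (l : List ℕ) :
    (l.filter (· ≠ y)).count z = l.count z := by
  rw [List.count_filter]; simpa using hz

theorem filter_ne_weaveL {y : ℕ} {E : List ℕ} {s : List (List ℕ)} (hs : y ∉ s.flatten)
    (hl : s.length = E.length) : (weaveL y E s).filter (· ≠ y) = s.flatten := by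
  induction E generalizing s with
  | nil => simp at hl; simp [weaveL, hl]
  | cons a E ih =>
    cases s with
    | nil => simp at hl
    | cons t s =>
      simp only [List.flatten_cons, List.mem_append, not_or] at hs
      simp only [List.length_cons, Nat.add_right_cancel_iff] at hl
      have h1 : t.filter (· ≠ y) = t := by
        rw [List.filter_eq_self]
        intro z hz
        simp only [decide_eq_true_eq]
        rintro rfl; exact hs.1 hz
      simp only [weaveL, List.filter_append, ih hs.2 hl, h1, List.flatten_cons]
      simp

theorem count_weaveL_of_ne {y z : ℕ} (hz : z ≠ y) {E : List ℕ} {s : List (List ℕ)}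
    (hs : y ∉ s.flatten) (hl : s.length = E.length) :
    (weaveL y E s).count z = s.flatten.count z := by
  rw [← filter_ne_weaveL hs hl, count_filter_ne hz]

theorem mem_weaveL {y : ℕ} {E : List ℕ} {s : List (List ℕ)} (hl : s.length = E.length)
    (hE : 0 < E.sum) : y ∈ weaveL y E s := by
  induction E generalizing s with
  | nil => simp at hE
  | cons a E ih =>
    cases s with
    | nil => simp at hl
    | cons t s =>
      simp only [List.length_cons, Nat.add_right_cancel_iff] at hl
      simp only [weaveL, List.mem_append]
      rcases Nat.eq_zero_or_pos a with rfl | ha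
      · exact .inr (ih hl (by simpa using hE))
      · exact .inl (.inl (by simp; omega))

theorem weaveL_of_sum_eq_zero {y : ℕ} {E : List ℕ} {s : List (List ℕ)} (hl : s.length = E.length)
    (hE : E.sum = 0) : weaveL y E s = s.flatten := by
  induction E generalizing s with
  | nil => simp at hl; simp [weaveL, hl]
  | cons a E ih =>
    cases s with
    | nil => simp at hl
    | cons t s =>
      simp only [List.length_cons, Nat.add_right_cancel_iff] at hl
      simp only [List.sum_cons, Nat.add_eq_zero_iff] at hE
      simp [weaveL, ih hl hE.2, hE.1]

/-! ### Gathering the occurrences of a letter in its blocks. -/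

/-- After a prefix containing `y`, no `y` of `Q` is a first occurrence. As long as another `y`
follows, `Sig.move` carries it right to the next `y` of its block, or to the separator closing the
block. Only the very last `y` has to stay in place. -/
theorem gather_tail (hM : Sig M) {T : Finset ℕ} {y : ℕ} (hy : y ∉ T) (Q : List ℕ) :
    ∃ (s₀ : List ℕ) (s : List (List ℕ)), s.length = (exps y T Q).length ∧
      s₀ ++ s.flatten = Q.filter (· ≠ y) ∧ (∀ z ∈ s₀, z ∉ T) ∧
      s.map (List.filter (· ∈ T)) = (Q.filter (· ∈ T)).map (fun t => [t]) ++ [[]] ∧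
      ∀ p, y ∈ p → (∀ z ∈ Q, z ∉ T → 1 < (p ++ Q).count z) →
        SatL M (p ++ Q) (p ++ s₀ ++ weaveL y (exps y T Q) s) := by
  induction Q with
  | nil => exact ⟨[], [[]], by simp [exps], by simp, by simp, by simp, fun p _ _ => by
      simpa [exps, weaveL] using SatL.refl _⟩
  | cons z Q ih =>
    obtain ⟨s₀, s, hl, hf, h0, hT, hs⟩ := ih
    have step : ∀ p, y ∈ p ++ [z] → (∀ w ∈ z :: Q, w ∉ T → 1 < (p ++ z :: Q).count w) →
        SatL M (p ++ z :: Q) (p ++ z :: (s₀ ++ weaveL y (exps y T Q) s)) := by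
      intro p hp hc
      have := hs (p ++ [z]) hp (fun w hw hwT => by
        simpa using hc w (by simp [hw]) hwT)
      simpa using this
    have hys : y ∉ s₀ ++ s.flatten := by rw [hf]; simp
    have hsne : s ≠ [] := by
      rintro rfl
      exact exps_ne_nil y T Q (List.length_eq_zero_iff.1 hl.symm)
    by_cases h1 : z ∈ T
    · have hzy : z ≠ y := fun h => hy (h ▸ h1)
      refine ⟨[], (z :: s₀) :: s, by simp [exps, h1, hl], by simp [hf, hzy], by simp, ?_, ?_⟩
      · have : s₀.filter (· ∈ T) = [] := by simpa using h0
        simp [h1, hT, this]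
      · intro p hp hc
        have := step p (by simp [hp]) hc
        simpa [exps, h1, weaveL] using this
    by_cases h2 : z = y
    · subst h2
      have hE : exps z T (z :: Q) = bump (exps z T Q) := by simp [exps, h1]
      rw [hE]
      -- If a further `y` follows, the current one crosses `s₀` and joins the first power. Otherwise
      -- it is the last `y`, and `s₀` is absorbed into the separator to its right.
      by_cases hQ : z ∈ Q
      · refine ⟨s₀, s, by rw [length_bump (exps_ne_nil _ _ _), hl], by simp [hf], h0,
          by simp [hT, h1], ?_⟩
        intro p hp hc
        refine (step p (by simp) hc).trans ?_
        rw [weaveL_bump _ (exps_ne_nil _ _ _) hsne]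
        have := hM.move (x := z) (q := weaveL z (exps z T Q) s)
          (mem_weaveL hl (by rw [sum_exps h1]; exact List.count_pos_iff.2 hQ)) s₀ p hp ?_
        · simpa using this
        · intro w hw
          have hwz : w ≠ z := by rintro rfl; exact hys (by simp [hw])
          have hwQ : w ∈ Q := by
            have : w ∈ Q.filter (· ≠ z) := by rw [← hf]; simp [hw]
            exact (List.mem_filter.1 this).1
          have e : s₀.count w + s.flatten.count w = Q.count w := by
            rw [← List.count_append, hf, count_filter_ne hwz]
          have := hc w (by simp [hwQ]) (h0 w hw)
          have e2 := count_weaveL_of_ne hwz (E := exps z T Q)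
            (fun h => hys (List.mem_append_right _ h)) hl
          simp only [List.count_append, List.count_cons] at this ⊢
          rw [if_neg (by simpa using hwz.symm)] at this
          omega
      · have hsum : (exps z T Q).sum = 0 := by
          rw [sum_exps h1]; exact List.count_eq_zero.2 hQ
        cases hEE : exps z T Q with
        | nil => exact absurd hEE (exps_ne_nil _ _ _)
        | cons a r =>
          cases hss : s with
          | nil => exact absurd hss hsne
          | cons t s' =>
            rw [hEE] at hsum
            have ha : a = 0 := by simp at hsum; exact hsum.1
            subst ha; subst hss
            refine ⟨[], (s₀ ++ t) :: s', ?_, ?_, by simp, ?_, ?_⟩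
            · rw [hEE] at hl; simpa [bump] using hl
            · simpa using hf
            · have : s₀.filter (· ∈ T) = [] := by simpa using h0
              simpa [h1, this] using hT
            · intro p hp hc
              refine (step p (by simp) hc).trans ?_
              rw [hEE]
              simpa [bump, weaveL] using SatL.refl _
    · refine ⟨z :: s₀, s, by simp [exps, h1, h2, hl], by simp [hf, h2], ?_, by simp [h1, hT], ?_⟩
      · simpa [h1] using h0
      · intro p hp hc
        have := step p (by simp [hp]) hc
        simpa [exps, h1, h2] using this

/-- After any prefix containing `y`, the word `Q` can be rewritten as `y ^ β₀ s₀ y ^ β₁ s₁ ⋯`. -/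
def FitR (M : Type*) [Monoid M] (T : Finset ℕ) (y : ℕ) (β : List ℕ) (Q : List ℕ) : Prop :=
  ∃ s : List (List ℕ), s.length = β.length ∧
    (weaveL y β s).filter (· ≠ y) = Q.filter (· ≠ y) ∧
    ∀ p, y ∈ p → (∀ z ∈ Q, z ∉ T → 1 < (p ++ Q).count z) →
      SatL M (p ++ Q) (p ++ weaveL y β s)

theorem fitR_mem {T : Finset ℕ} {y : ℕ} {Q : List ℕ} (hQ : y ∈ Q) : FitR M T y [0, 1] Q := by
  obtain ⟨Q₁, Q₂, rfl⟩ := List.append_of_mem hQ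
  refine ⟨[Q₁, Q₂], rfl, by simp [weaveL], fun p _ _ => ?_⟩
  simpa [weaveL] using SatL.refl _

/-- All but `c` of the letters in the power can cross `g` to the left: since `c` is positive, none
of those moved is the last `y`. -/
theorem fitR_block (hM : Sig M) {T : Finset ℕ} {y : ℕ} {g q : List ℕ} {b c : ℕ}
    (hg : ∀ z ∈ g, z ∉ T) (hc : 0 < c) (hcb : c ≤ b) :
    FitR M T y [b - c, c] (g ++ List.replicate b y ++ q) := by
  refine ⟨[g, q], rfl, by simp [weaveL], fun p hp hn => ?_⟩
  have := hM.move_replicate (x := y) (q := List.replicate c y ++ q)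
    (by simp; omega) g (b - c) hp (fun z hz hzy => by
      have := hn z (by simp [hz]) (hg z hz)
      simp only [List.count_append, List.count_replicate] at this ⊢
      rw [if_neg (by simpa using Ne.symm hzy)] at this ⊢
      omega)
  have e : List.replicate b y = List.replicate (b - c) y ++ List.replicate c y := by
    rw [List.replicate_append_replicate]; congr 1; omega
  rw [e]
  simpa [weaveL, -List.replicate_append_replicate] using this.symm

theorem fitR_congr {T : Finset ℕ} {y : ℕ} {β Q : List ℕ} (hQ : ∃ Q' : List ℕ, (∀ z ∈ Q', z ∈ Q) ∧
      (∀ z, Q'.count z = Q.count z) ∧ Q'.filter (· ≠ y) = Q.filter (· ≠ y) ∧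
      FitR M T y β Q' ∧ ∀ p, y ∈ p → (∀ z ∈ Q, z ∉ T → 1 < (p ++ Q).count z) →
      SatL M (p ++ Q) (p ++ Q')) : FitR M T y β Q := by
  obtain ⟨Q', hmem, hcount, hf, ⟨s, hl, hfs, hs⟩, h⟩ := hQ
  refine ⟨s, hl, hfs.trans hf, fun p hp hc => (h p hp hc).trans (hs p hp fun z hz hzT => ?_)⟩
  have := hc z (hmem z hz) hzT
  simp only [List.count_append, hcount] at this ⊢
  exact this

/-- A `y` in a later block ensures that no `y` of the first block is the last one, so the whole
first power moves to the front. -/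
theorem fitR_multi (hM : Sig M) {T : Finset ℕ} {y : ℕ} (hy : y ∉ T) {Q : List ℕ}
    (hQ : 0 < (exps y T Q).tail.sum) : FitR M T y (exps y T Q) Q := by
  obtain ⟨s₀, s, hl, hf, h0, hT, hs⟩ := gather_tail hM hy Q
  cases hE : exps y T Q with
  | nil => exact absurd hE (exps_ne_nil _ _ _)
  | cons a r =>
    rw [hE] at hl hs hQ
    cases s with
    | nil => simp at hl
    | cons t s =>
      simp only [List.length_cons, Nat.add_right_cancel_iff] at hl
      have hys : y ∉ s₀ ++ (t :: s).flatten := by rw [hf]; simp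
      refine ⟨(s₀ ++ t) :: s, by simp [hl], ?_, fun p hp hc => (hs p hp hc).trans ?_⟩
      · rw [filter_ne_weaveL (by simpa using hys) (by simp [hl]), ← hf]; simp
      · have := hM.move_replicate (x := y) (q := t ++ weaveL y r s)
          (by simp [mem_weaveL hl (by simpa using hQ)]) s₀ a hp (fun z hz hzy => by
            have hzQ : z ∈ Q := by
              have : z ∈ Q.filter (· ≠ y) := by rw [← hf]; simp [hz]
              exact (List.mem_filter.1 this).1
            have := hc z hzQ (h0 z hz)
            have e : (s₀ ++ (t :: s).flatten).count z = Q.count z := by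
              rw [hf, count_filter_ne hzy]
            have e2 := count_weaveL_of_ne hzy (E := r) (s := s)
              (fun h => hys (by simp at h ⊢; exact .inr (.inr h))) hl
            simp only [List.count_append, List.flatten_cons] at this e ⊢
            omega)
        simpa [weaveL] using this.symm

/-- When `y` stays in one block, its last occurrence is immobile but any number of the others can
come to the front. The freedom in `c` is used to match the exponents that (i), (ii) and (iii)
produce. -/
theorem fitR_single (hM : Sig M) {T : Finset ℕ} {y : ℕ} (hy : y ∉ T) {Q : List ℕ}
    (hQ : (exps y T Q).tail.sum = 0) {c : ℕ} (hc : 0 < c) (hcQ : c ≤ Q.count y) :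
    FitR M T y [Q.count y - c, c] Q := by
  obtain ⟨s₀, s, hl, hf, h0, hT, hs⟩ := gather_tail hM hy Q
  have hsum := sum_exps hy Q
  cases hE : exps y T Q with
  | nil => exact absurd hE (exps_ne_nil _ _ _)
  | cons a r =>
    rw [hE] at hl hs hQ hsum
    cases s with
    | nil => simp at hl
    | cons t s =>
      simp only [List.length_cons, Nat.add_right_cancel_iff] at hl
      simp only [List.sum_cons, List.tail_cons] at hsum hQ
      have ha : a = Q.count y := by omega
      have hys : y ∉ s₀ ++ (t :: s).flatten := by rw [hf]; simp
      have hyf : ∀ w : List ℕ, w <:+: s₀ ++ (t :: s).flatten → w.filter (· ≠ y) = w := by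
        intro w hw
        rw [List.filter_eq_self]
        intro z hz
        simp only [decide_eq_true_eq]
        rintro rfl; exact hys (hw.mem hz)
      have hff : (s₀ ++ List.replicate (Q.count y) y ++ (t :: s).flatten).filter (· ≠ y)
          = Q.filter (· ≠ y) := by
        rw [← hf, List.filter_append, List.filter_append,
          hyf s₀ (List.prefix_append _ _).isInfix,
          hyf _ (List.suffix_append _ _).isInfix]
        simp
      have hcount : ∀ z, (s₀ ++ List.replicate (Q.count y) y ++ (t :: s).flatten).count z
          = Q.count z := by
        intro z
        by_cases hzy : z = y
        · subst hzy
          have h1 : s₀.count z = 0 := List.count_eq_zero.2 fun h => hys (by simp [h])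
          have h2 : (t :: s).flatten.count z = 0 :=
            List.count_eq_zero.2 fun h => hys (List.mem_append_right _ h)
          simp only [List.count_append, List.count_replicate_self, h1, h2]; omega
        · rw [← count_filter_ne hzy, hff, count_filter_ne hzy]
      refine fitR_congr ⟨s₀ ++ List.replicate (Q.count y) y ++ (t :: s).flatten, ?_, hcount, hff,
        fitR_block hM h0 hc hcQ, fun p hp hc => ?_⟩
      · intro z hz
        rw [← List.count_pos_iff, hcount] at hz
        exact List.count_pos_iff.1 hz
      · have := hs p hp hc
        rw [ha] at this
        simpa [weaveL, weaveL_of_sum_eq_zero hl hQ] using this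

/-! ### Interchanging a last `x` and a first `y`. -/

/-- With exponents `α` and `β`, the last `x` and the first `y` may be interchanged. -/
def Sw (M : Type*) [Monoid M] (α β : List ℕ) : Prop :=
  ∀ (x y : M) (s s' : List M), s.length = α.length → s'.length = β.length →
    weave' x α s * x * y * weave y β s' = weave' x α s * y * x * weave y β s'

theorem weave'_eq (m : M) (E : List ℕ) (s : List M) :
    weave' m E s = (weave (MulOpposite.op m) E (s.map MulOpposite.op)).unop := by
  induction E generalizing s with
  | nil => simp [weave, weave']
  | cons a E ih => cases s <;> simp [weave, weave', ih, mul_assoc]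

/-- The two sides of the pair are rewritten into the shape on which `Sw` acts, the left one through
the opposite monoid. After the interchange the rewriting is undone. -/
theorem swap_of_fit {T : Finset ℕ} {x y : ℕ} {α β P Q : List ℕ} (hSw : Sw M α β)
    (hL : FitR Mᵐᵒᵖ T x α P.reverse) (hR : FitR M T y β Q) (hyP : y ∉ P)
    (hc : ∀ z ∈ P ++ Q, z ∉ T → 1 < (P ++ x :: y :: Q).count z) :
    SatL M (P ++ x :: y :: Q) (P ++ y :: x :: Q) := by
  obtain ⟨s, hsl, hsf, hs⟩ := hL
  obtain ⟨r, hrl, hrf, hr⟩ := hR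
  -- The rewriting must work before and after the swap, so it is stated for both orders of the pair.
  -- The `y` of the pair serves as the earlier occurrence for the right side, and its `x` as the
  -- later one for the left side.
  have right : ∀ a b : ℕ, y ∈ [a, b] → (∀ z, [a, b].count z = [x, y].count z) →
      SatL M (P ++ a :: b :: Q) ((weaveL x α s).reverse ++ a :: b :: weaveL y β r) ∨ x ∉ [a, b] := by
    intro a b hab hcount
    by_cases hxab : x ∈ [a, b]
    swap
    · exact .inr hxab
    left

    have e : ∀ (l l' : List ℕ) (z : ℕ), (l ++ a :: b :: l').count z
        = (l ++ x :: y :: l').count z := by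
      intro l l' z
      have := hcount z
      simp only [List.count_append, List.count_cons, List.count_nil] at this ⊢
      omega
    have h1 := hr (P ++ [a, b]) (by simp at hab ⊢; tauto) (fun z hz hzT => by
      have := hc z (by simp [hz]) hzT
      rw [← e] at this
      simpa using this)
    have h2 := hs (a :: b :: weaveL y β r).reverse (by simp at hxab ⊢; tauto) (fun z hz hzT => by
      have hz' : z ∈ P := by simpa using hz
      have hzy : z ≠ y := by rintro rfl; exact hyP hz'
      have h3 := hc z (by simp [hz']) hzT
      have e2 : (weaveL y β r).count z = Q.count z := by
        rw [← count_filter_ne hzy, hrf, count_filter_ne hzy]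
      rw [← List.reverse_append, List.count_reverse, e]
      simp only [List.count_append, List.count_cons] at h3 ⊢
      omega)
    have h2' : SatL M (P ++ a :: b :: weaveL y β r)
        ((weaveL x α s).reverse ++ a :: b :: weaveL y β r) := by
      apply SatL.of_reverse_op
      simpa using h2
    refine SatL.trans ?_ h2'
    simpa using h1
  have h1 := (right x y (by simp) (fun _ => rfl)).resolve_right (by simp)
  have h2 := (right y x (by simp) (fun z => by
    simp only [List.count_cons, List.count_nil]; omega)).resolve_right (by simp)
  refine h1.trans (SatL.trans ?_ h2.symm)
  intro φ
  have := hSw (φ x) (φ y) (s.map fun w => (w.reverse.map φ).prod)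
    (r.map fun w => (w.map φ).prod) (by simp [hsl]) (by simp [hrl])
  rw [← prod_map_weaveL, ← prod_map_reverse_weaveL] at this
  simpa [mul_assoc] using this

/-! ### Almost-linear consequences and isoterms. -/

theorem SatL.subst {u v : List ℕ} (h : SatL M u v) (θ : ℕ → List ℕ) :
    SatL M (u.flatMap θ) (v.flatMap θ) := by
  have key : ∀ (φ : ℕ → M) (w : List ℕ),
      ((w.flatMap θ).map φ).prod = (w.map (fun z => ((θ z).map φ).prod)).prod := by
    intro φ w
    induction w with
    | nil => rfl
    | cons z w ih => simp [ih]
  intro φ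
  rw [key, key, h]

/-- The exponent sequences `a` and `b` give an identity `x ^ a₀ t₀ x ^ a₁ t₁ ⋯ ≈ x ^ b₀ t₀ ⋯`. -/
def Rel (M : Type*) [Monoid M] (a b : List ℕ) : Prop :=
  ∀ (m : M) (s : List M), s.length = a.length → weave m a s = weave m b s

theorem exists_map_eq {ι : Type*} [DecidableEq ι] {ts : List ι} (h : ts.Nodup) {s : List M}
    (hs : s.length = ts.length) : ∃ f : ι → M, ts.map f = s := by
  induction ts generalizing s with
  | nil => exact ⟨fun _ => 1, (List.length_eq_zero_iff.1 (by simpa using hs)).symm⟩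
  | cons t ts ih =>
    cases s with
    | nil => simp at hs
    | cons a s =>
      obtain ⟨hn, h⟩ := List.nodup_cons.1 h
      obtain ⟨f, hf⟩ := ih h (s := s) (by simpa using hs)
      refine ⟨Function.update f t a, ?_⟩
      rw [List.map_cons, Function.update_self, ← hf]
      congr 1
      apply List.map_congr_left
      intro z hz
      rw [Function.update_of_ne]
      rintro rfl; exact hn hz

/-- The final separator is a free right factor, so identities need only be known with 1 there. -/
theorem weave_append_one (m : M) {E : List ℕ} {s : List M} (h : E.length = s.length + 1) (c : M) :
    weave m E (s ++ [c]) = weave m E (s ++ [1]) * c := by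
  induction s generalizing E with
  | nil =>
    match E, h with
    | [a], _ => simp [weave]
  | cons t s ih =>
    match E, h with
    | a :: E, h => simp [weave, ih (E := E) (by simpa using h), mul_assoc]

/-- Delete all letters but `y` and those of `T`. The separators that remain are distinct letters, so
they take arbitrary values independently. -/
theorem rel_exps {T : Finset ℕ} {y : ℕ} (hy : y ∉ T) {u v : List ℕ} (h : SatL M u v)
    (hT : u.filter (· ∈ T) = v.filter (· ∈ T)) (hn : (u.filter (· ∈ T)).Nodup) :
    Rel M (exps y T u) (exps y T v) := by
  intro m s hs
  rw [length_exps hy] at hs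
  have hs0 : s ≠ [] := by intro e; rw [e] at hs; simp at hs
  obtain ⟨s, c, rfl⟩ : ∃ s' c, s = s' ++ [c] := ⟨s.dropLast, s.getLast hs0, (List.dropLast_append_getLast hs0).symm⟩
  have hs' : s.length = (u.filter (· ∈ T)).length := by simpa using hs
  obtain ⟨f, hf⟩ := exists_map_eq hn hs'
  let φ : ℕ → M := fun z => if z = y then m else if z ∈ T then f z else 1
  have hφ : ∀ z, z ∉ T → z ≠ y → φ z = 1 := fun z h1 h2 => by simp [φ, h1, h2]
  have hmap : (u.filter (· ∈ T)).map φ = s := by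
    rw [← hf]
    apply List.map_congr_left
    intro z hz
    have hz : z ∈ T := by simpa using (List.mem_filter.1 hz).2
    have hzy : z ≠ y := fun e => hy (e ▸ hz)
    simp [φ, hz, hzy]
  have hφy : φ y = m := by simp [φ]
  have h1 := prod_map_eq_weave hy φ hφ u
  have h2 := prod_map_eq_weave hy φ hφ v
  rw [← hT] at h2
  rw [hmap, hφy] at h1 h2
  rw [weave_append_one m (by rw [length_exps hy, hs']),
    weave_append_one m (E := exps y T v) (by rw [length_exps hy, ← hT, hs']), ← h1, ← h2, h]

/-- The word is an isoterm, in terms of lists. -/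
def IsoL (M : Type*) [Monoid M] (u : List ℕ) : Prop := ∀ v, SatL M u v → v = u

/-- Projecting onto the two initial letters shows that these coincide; strip them and induct. -/
theorem eq_of_filter_pair {l₁ l₂ : List ℕ}
    (h : ∀ a ∈ l₁ ++ l₂, ∀ b ∈ l₁ ++ l₂,
      l₁.filter (fun z => z = a ∨ z = b) = l₂.filter (fun z => z = a ∨ z = b)) : l₁ = l₂ := by
  induction l₁ generalizing l₂ with
  | nil =>
    cases l₂ with
    | nil => rfl
    | cons c r => simpa using h c (by simp) c (by simp)
  | cons a r₁ ih =>
    cases l₂ with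
    | nil => simpa using h a (by simp) a (by simp)
    | cons c r₂ =>
      have hac : a = c := by
        have := h a (by simp) c (by simp)
        simp at this
        exact this.1
      subst hac
      rw [ih]
      intro b hb b' hb'
      have := h b (by simp at hb ⊢; tauto) b' (by simp at hb' ⊢; tauto)
      by_cases hh : a = b ∨ a = b'
      · rw [List.filter_cons_of_pos (by simpa using hh),
          List.filter_cons_of_pos (by simpa using hh)] at this
        exact List.tail_eq_of_cons_eq this
      · rwa [List.filter_cons_of_neg (by simpa using hh),
          List.filter_cons_of_neg (by simpa using hh)] at this

/-- Hypothesis (i) needs exponents above 1, so a linear `t` is doubled before an isoterm is invoked;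
injectivity allows the doubling to be undone. -/
theorem flatMap_double_injective (t : ℕ) {l₁ l₂ : List ℕ}
    (h : l₁.flatMap (fun z => if z = t then [t, t] else [z])
      = l₂.flatMap (fun z => if z = t then [t, t] else [z])) : l₁ = l₂ := by
  induction l₁ generalizing l₂ with
  | nil =>
    cases l₂ with
    | nil => rfl
    | cons c r =>
      simp only [List.flatMap_nil, List.flatMap_cons] at h
      split_ifs at h <;> simp at h
  | cons a r₁ ih =>
    cases l₂ with
    | nil =>
      simp only [List.flatMap_nil, List.flatMap_cons] at h
      split_ifs at h <;> simp at h
    | cons c r₂ =>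
      simp only [List.flatMap_cons] at h
      split_ifs at h with h1 h2 h2
      · rw [h1, h2, ih (by simpa using h)]
      · simp at h; exact absurd h.1.symm h2
      · simp at h; exact absurd h.1 h1
      · simp at h; rw [h.1, ih h.2]

theorem filter_eq_replicate {y : ℕ} {l : List ℕ} (f : ℕ → Bool)
    (hf : ∀ z ∈ l, f z = true ↔ z = y) : l.filter f = List.replicate (l.count y) y := by
  rw [← List.filter_beq]
  apply List.filter_congr
  intro z hz
  have := hf z hz
  by_cases h : z = y
  · simp [h] at this ⊢; simpa [h] using this
  · have h1 : f z = false := by simpa [h] using this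
    simp [h1, h]

theorem count_le_sum_tail_exps {T : Finset ℕ} {y t : ℕ} (hy : y ∉ T) (ht : t ∈ T)
    (Q₁ Q₂ : List ℕ) : Q₂.count y ≤ (exps y T (Q₁ ++ t :: Q₂)).tail.sum := by
  induction Q₁ with
  | nil => simp [exps, ht, sum_exps hy]
  | cons z Q₁ ih =>
    rw [List.cons_append]
    unfold exps
    split_ifs with h1 h2
    · simp only [List.tail_cons]
      rw [sum_exps hy, List.count_append, List.count_cons]; omega
    · cases h : exps y T (Q₁ ++ t :: Q₂) with
      | nil => exact absurd h (exps_ne_nil _ _ _)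
      | cons a r => rw [h] at ih; simpa [bump] using ih
    · exact ih

/-- If `y` lies in a single block of `u` then `u ≈ v` can only move it when `y ^ m t ^ 2` or
`t ^ 2 y ^ m` fails to be an isoterm. -/
theorem filter_eq_of_isoterm {T : Finset ℕ} {y : ℕ} (hy : y ∉ T) {c Q v : List ℕ} (hyc : y ∉ c)
    (hQ : (exps y T Q).tail.sum = 0) (hT : (c ++ y :: Q).filter (· ∈ T) = v.filter (· ∈ T))
    (hn : ((c ++ y :: Q).filter (· ∈ T)).Nodup) (h : SatL M (c ++ y :: Q) v)
    (hA : ∀ t ≠ y, IsoL M (List.replicate (Q.count y + 1) y ++ [t, t]))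
    (hB : ∀ t ≠ y, IsoL M ([t, t] ++ List.replicate (Q.count y + 1) y)) :
    (c ++ y :: Q).filter (fun z => z = y ∨ z ∈ T) = v.filter (fun z => z = y ∨ z ∈ T) := by
  set u := c ++ y :: Q with hu
  set m := Q.count y + 1 with hm
  have hcy : c.count y = 0 := List.count_eq_zero.2 hyc
  have hum : u.count y = m := by simp [hu, hcy, hm]
  -- Multiplying `y^m ≈ y^k` by the square of another letter and using the isoterm gives `k = m`.
  have hyy : u.filter (fun z => z = y) = v.filter (fun z => z = y) := by
    have h1 := h.filter (fun z => z = y)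
    have e : ∀ w : List ℕ, w.filter (fun z => z = y) = List.replicate (w.count y) y :=
      fun w => filter_eq_replicate _ (by simp)
    rw [e, e] at h1 ⊢
    rw [hum] at h1 ⊢
    have := hA (y + 1) (by omega) _ (h1.append_right [y + 1, y + 1])
    have := congrArg List.length this
    simp at this
    rw [this]
  -- If `t` occurs in `u`, then `u` projects to `y^m t` or `t y^m`, because all of `y` lies in one
  -- block; substituting `t²` for `t` gives one of the assumed isoterms.
  have hpair : ∀ t ∈ T, u.filter (fun z => z = y ∨ z = t) = v.filter (fun z => z = y ∨ z = t) := by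
    intro t ht
    have hty : t ≠ y := fun e => hy (e ▸ ht)
    have h1 := (h.filter (fun z => z = y ∨ z = t)).subst (fun z => if z = t then [t, t] else [z])
    have hrep : ∀ k, (List.replicate k y).flatMap (fun z => if z = t then [t, t] else [z])
        = List.replicate k y := by
      intro k
      induction k with
      | zero => rfl
      | succ k ih => simp [List.replicate_succ, ih, Ne.symm hty]
    by_cases htu : t ∈ u
    · have hcount : u.count t = 1 := by
        have := List.count_eq_one_of_mem hn (a := t) (by simp [htu, ht])
        rwa [List.count_filter (by simpa using ht)] at this
      have hct : c.count t + Q.count t = 1 := by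
        simpa [hu, List.count_cons, Ne.symm hty] using hcount
      by_cases htc : t ∈ c
      · have hc1 : c.count t = 1 := by
          have := List.count_pos_iff.2 htc; omega
        have htQ : t ∉ Q := by rw [← List.count_eq_zero]; omega
        have e : u.filter (fun z => z = y ∨ z = t) = [t] ++ List.replicate m y := by
          rw [hu, List.filter_append, List.filter_cons_of_pos (by simp),
            filter_eq_replicate (y := t) (l := c), filter_eq_replicate (y := y) (l := Q), hc1, hm,
            List.replicate_succ]
          · rfl
          · intro z hz
            have : z ≠ t := by rintro rfl; exact htQ hz
            simp [this]
          · intro z hz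
            have : z ≠ y := by rintro rfl; exact hyc hz
            simp [this]
        apply flatMap_double_injective t
        symm
        rw [e] at h1 ⊢
        rw [List.flatMap_append, hrep] at h1 ⊢
        have e2 : [t].flatMap (fun z => if z = t then [t, t] else [z]) = [t, t] := by simp
        rw [e2] at h1 ⊢
        exact hB t hty _ h1
      · have htQ : t ∈ Q := by simp [hu, hty] at htu; tauto
        obtain ⟨Q₁, Q₂, rfl⟩ := List.append_of_mem htQ
        have hQ2 : Q₂.count y = 0 := by
          have := count_le_sum_tail_exps hy ht Q₁ Q₂; omega
        have hc0 : c.count t = 0 := List.count_eq_zero.2 htc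
        have hcQ : Q₁.count t = 0 ∧ Q₂.count t = 0 := by
          rw [List.count_append, List.count_cons_self] at hct; omega
        have e : u.filter (fun z => z = y ∨ z = t) = List.replicate m y ++ [t] := by
          have e1 : c.filter (fun z => z = y ∨ z = t) = [] := by
            rw [List.filter_eq_nil_iff]; intro z hz
            simp only [decide_eq_true_eq]; rintro (rfl | rfl)
            · exact hyc hz
            · exact htc hz
          have e2 : Q₂.filter (fun z => z = y ∨ z = t) = [] := by
            rw [List.filter_eq_nil_iff]; intro z hz
            simp only [decide_eq_true_eq]; rintro (rfl | rfl)
            · exact List.count_eq_zero.1 hQ2 hz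
            · exact List.count_eq_zero.1 hcQ.2 hz
          have e3 : Q₁.filter (fun z => z = y ∨ z = t) = List.replicate (Q₁.count y) y :=
            filter_eq_replicate _ (fun z hz => by
              have : z ≠ t := by rintro rfl; exact List.count_eq_zero.1 hcQ.1 hz
              simp [this])
          rw [hu, List.filter_append, e1, List.filter_cons_of_pos (by simp), List.filter_append,
            e3, List.filter_cons_of_pos (by simp), e2, hm]
          simp [hQ2, List.replicate_succ, hty]
        apply flatMap_double_injective t
        symm
        rw [e] at h1 ⊢
        rw [List.flatMap_append, hrep] at h1 ⊢
        have e2 : [t].flatMap (fun z => if z = t then [t, t] else [z]) = [t, t] := by simp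
        rw [e2] at h1 ⊢
        exact hA t hty _ h1
    · have htv : t ∉ v := by
        intro hv
        have : t ∈ v.filter (· ∈ T) := by simp [hv, ht]
        rw [← hT] at this
        exact htu (List.mem_filter.1 this).1
      have e : ∀ w : List ℕ, t ∉ w → w.filter (fun z => z = y ∨ z = t) = w.filter (fun z => z = y) := by
        intro w hw
        apply List.filter_congr
        intro z hz
        have : z ≠ t := by rintro rfl; exact hw hz
        simp [this]
      rw [e u htu, e v htv, hyy]
  apply eq_of_filter_pair
  have memT : ∀ a ∈ u.filter (fun z => z = y ∨ z ∈ T) ++ v.filter (fun z => z = y ∨ z ∈ T),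
      a = y ∨ a ∈ T := by
    intro a ha; simp at ha; tauto
  have ff : ∀ a b, (a = y ∨ a ∈ T) → (b = y ∨ b ∈ T) → ∀ w : List ℕ,
      (w.filter (fun z => z = y ∨ z ∈ T)).filter (fun z => z = a ∨ z = b)
        = w.filter (fun z => z = a ∨ z = b) := by
    intro a b ha hb w
    rw [List.filter_filter]
    apply List.filter_congr
    intro z _
    rw [← Bool.decide_and, decide_eq_decide]
    constructor
    · rintro ⟨h, _⟩; exact h
    · rintro (rfl | rfl)
      · exact ⟨.inl rfl, ha⟩
      · exact ⟨.inr rfl, hb⟩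
  intro a ha b hb
  have ha := memT a ha
  have hb := memT b hb
  rw [ff a b ha hb, ff a b ha hb]
  rcases ha with ha | ha <;> rcases hb with hb | hb
  · rw [ha, hb]; simpa using hyy
  · rw [ha]; exact hpair b hb
  · rw [hb]; simpa only [or_comm] using hpair a ha
  · have gg : ∀ w : List ℕ, w.filter (fun z => z = a ∨ z = b)
        = (w.filter (· ∈ T)).filter (fun z => z = a ∨ z = b) := by
      intro w
      rw [List.filter_filter]
      apply List.filter_congr
      intro z _
      rw [← Bool.decide_and, decide_eq_decide]
      constructor
      · rintro (rfl | rfl)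
        · exact ⟨.inl rfl, ha⟩
        · exact ⟨.inr rfl, hb⟩
      · rintro ⟨h, _⟩; exact h
    rw [gg u, gg v, hT]

/-! ### The standing assumptions on `S` and `M`. -/

/-- The set of linear letters of `u`. -/
def linF (u : List ℕ) : Finset ℕ := u.toFinset.filter (fun z => u.count z = 1)

theorem mem_linF {u : List ℕ} {z : ℕ} : z ∈ linF u ↔ u.count z = 1 := by
  simp only [linF, Finset.mem_filter, List.mem_toFinset, and_iff_right_iff_imp]
  intro h
  exact List.count_pos_iff.1 (by omega)

/-- Block-balanced identities, in terms of lists. -/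
def BBL (u v : List ℕ) : Prop :=
  ∀ x, u.filter (fun z => z = x ∨ z ∈ linF u) = v.filter (fun z => z = x ∨ z ∈ linF u)

/-- `M` satisfies the relevant identities of `S`, and `S` satisfies the hypotheses of the main
theorem in terms of exponent sequences. -/
structure Setup (S M : Type*) [Monoid S] [Monoid M] : Prop where
  sigS : Sig S
  sigM : Sig M
  sat : ∀ u v, SatL M u v → SatL S u v
  rel : ∀ a b : List ℕ, a.length = b.length → Rel S a b → Rel M a b
  sw : ∀ α β : List ℕ, 0 < α.sum → 0 < β.sum → Sw S α β → Sw M α β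
  iso : ∀ x y : ℕ, x ≠ y → IsoL S [x, y]
  one : ∀ m n : ℕ, 1 < m → 1 < n → ∀ x y : ℕ, x ≠ y →
    ¬ IsoL S (List.replicate m x ++ List.replicate n y) →
    ∃ d c, 0 < d ∧ d < m ∧ 0 < c ∧ c < n ∧ Sw S [m - d - 1, d] [n - c - 1, c]
  two : ∀ (x y : ℕ) (T : Finset ℕ) (A : List ℕ) (k : ℕ), x ≠ y → x ∉ T →
    (∀ z ∈ A, z = x ∨ z ∈ T) → (A.filter (· ∈ T)).Nodup → x ∈ A → y ∉ A →
    (∃ v, SatL S (A ++ x :: List.replicate k y) v ∧ BBL (A ++ x :: List.replicate k y) v ∧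
      (A ++ x :: List.replicate k y).filter (fun z => z = x ∨ z = y)
        ≠ v.filter (fun z => z = x ∨ z = y)) →
    ∃ c, 0 < c ∧ c < k ∧ Sw S (exps x T A.reverse) [c - 1, k - c]
  three : ∀ (x y : ℕ) (T : Finset ℕ) (B : List ℕ) (k : ℕ), x ≠ y → y ∉ T →
    (∀ z ∈ B, z = y ∨ z ∈ T) → (B.filter (· ∈ T)).Nodup → y ∈ B → x ∉ B →
    (∃ v, SatL S (List.replicate k x ++ y :: B) v ∧ BBL (List.replicate k x ++ y :: B) v ∧
      (List.replicate k x ++ y :: B).filter (fun z => z = x ∨ z = y)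
        ≠ v.filter (fun z => z = x ∨ z = y)) →
    ∃ p, 0 < p ∧ p < k ∧ Sw S [p - 1, k - p] (exps y T B)

/-! ### A letter confined to a single block. -/

/-- The last `y` crosses `g` from right to left. A letter `z` that occurred before is crossed by σ₂.
Otherwise this is the first `z`, and one later `z` is enough for the interchange `hSw`; this
accounts for the exponents `[0, 1]`. -/
theorem last_passes (hM : Sig M) {T : Finset ℕ} {y b d : ℕ} {c : List ℕ}
    (hd : 0 < d) (hdb : d ≤ b) (hSw : Sw M [b - d, d] [0, 1]) (g : List ℕ) :
    ∀ r : List ℕ, (∀ z ∈ g, z ∉ T ∧ z ≠ y) →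
      (∀ z ∈ c ++ g ++ r, z ∉ T →
        1 < (c ++ List.replicate b y ++ g ++ y :: r).count z) →
      SatL M (c ++ List.replicate b y ++ g ++ y :: r) (c ++ List.replicate b y ++ y :: g ++ r) := by
  induction g using List.reverseRecOn with
  | nil => intro r _ _; simpa using SatL.refl _
  | append_singleton g z ih =>
    intro r hg hc
    obtain ⟨hzT, hzy⟩ := hg z (by simp)
    have hb : 0 < b := by omega
    have e : c ++ List.replicate b y ++ (g ++ [z]) ++ y :: r
        = (c ++ List.replicate b y ++ g) ++ z :: y :: r := by simp
    have hperm : ∀ w, (c ++ List.replicate b y ++ g ++ y :: z :: r).count w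
        = (c ++ List.replicate b y ++ (g ++ [z]) ++ y :: r).count w := by
      intro w
      simp only [List.count_append, List.count_cons, List.count_nil]; omega
    have h1 := ih (z :: r) (fun w hw => hg w (by simp [hw])) (fun w hw hwT => by
      rw [hperm]
      exact hc w (by simp at hw ⊢; tauto) hwT)
    have h2 : SatL M ((c ++ List.replicate b y ++ g) ++ y :: z :: r)
        (c ++ List.replicate b y ++ y :: (g ++ [z]) ++ r) := by simpa using h1
    refine SatL.trans ?_ h2
    rw [e]
    by_cases hzP : z ∈ c ++ List.replicate b y ++ g
    · refine hM.swap_of_mem_left r hzP ?_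
      simp; omega
    · have hzr : z ∈ r := by
        have := hc z (by simp) hzT
        rw [e, List.count_append, List.count_eq_zero.2 hzP, List.count_cons_self,
          List.count_cons_of_ne (Ne.symm hzy)] at this
        exact List.count_pos_iff.1 (by omega)
      refine (swap_of_fit (T := T) hSw ?_ (fitR_mem hzr) hzP ?_).symm
      · have := fitR_block hM.op (T := T) (y := y) (g := g.reverse) (q := c.reverse) (b := b)
          (c := d) (fun w hw => (hg w (by simp at hw; simp [hw])).1) hd hdb
        simpa using this
      · intro w hw hwT
        by_cases hwy : w = y
        · subst hwy
          simp only [List.count_append, List.count_cons_self, List.count_replicate_self]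
          omega
        have := hc w (by simp [hwy] at hw ⊢; tauto) hwT
        rw [← hperm] at this
        exact this

/-- The mirror image of `last_passes`: the first `y` moves right to its power, and `hSw` is needed
only when it crosses the last occurrence of a letter. -/
theorem first_passes (hM : Sig M) {T : Finset ℕ} {y b d : ℕ} {r : List ℕ}
    (hd : 0 < d) (hdb : d ≤ b) (hSw : Sw M [0, 1] [b - d, d]) (g : List ℕ) :
    ∀ c : List ℕ, y ∉ c → (∀ z ∈ g, z ∉ T ∧ z ≠ y) →
      (∀ z ∈ c ++ g ++ r, z ∉ T →
        1 < (c ++ y :: g ++ List.replicate b y ++ r).count z) →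
      SatL M (c ++ y :: g ++ List.replicate b y ++ r)
        (c ++ g ++ y :: List.replicate b y ++ r) := by
  induction g with
  | nil => intro c _ _ _; simpa using SatL.refl _
  | cons z g ih =>
    intro c hyc hg hc
    obtain ⟨hzT, hzy⟩ := hg z (by simp)
    have hperm : ∀ w, (c ++ [z] ++ y :: g ++ List.replicate b y ++ r).count w
        = (c ++ y :: (z :: g) ++ List.replicate b y ++ r).count w := by
      intro w
      simp only [List.count_append, List.count_cons, List.count_nil]; omega
    have h1 := ih (c ++ [z]) (by simp [hyc, Ne.symm hzy]) (fun w hw => hg w (by simp [hw]))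
      (fun w hw hwT => by
        rw [hperm]
        exact hc w (by simp at hw ⊢; tauto) hwT)
    refine SatL.trans ?_ (by simpa using h1)
    have e : c ++ y :: z :: g ++ List.replicate b y ++ r
        = c ++ y :: z :: (g ++ List.replicate b y ++ r) := by simp
    have e' : c ++ z :: y :: (g ++ List.replicate b y ++ r)
        = c ++ [z] ++ y :: g ++ List.replicate b y ++ r := by simp
    have hyr : y ∈ g ++ List.replicate b y ++ r := by simp; omega
    have goal : SatL M (c ++ y :: z :: (g ++ List.replicate b y ++ r))
        (c ++ z :: y :: (g ++ List.replicate b y ++ r)) := by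
      by_cases hzQ : z ∈ g ++ List.replicate b y ++ r
      · exact hM.swap_of_mem_right c hyr hzQ
      · have hzc : z ∈ c := by
          have := hc z (by simp) hzT
          rw [e, List.count_append, List.count_cons_of_ne (Ne.symm hzy), List.count_cons_self,
            List.count_eq_zero.2 hzQ] at this
          exact List.count_pos_iff.1 (by omega)
        refine (swap_of_fit (T := T) hSw (fitR_mem (by simpa using hzc))
          (fitR_block hM (fun w hw => (hg w (by simp [hw])).1) hd hdb) hyc ?_).symm
        intro w hw hwT
        by_cases hwy : w = y
        · subst hwy
          have := List.count_pos_iff.2 hyr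
          simp only [List.count_append, List.count_cons, beq_self_eq_true, if_true] at this ⊢
          omega
        have := hc w (by simp [hwy] at hw ⊢; tauto) hwT
        rw [← hperm] at this
        rw [e']
        exact this
    simpa using goal

/-- The word `s₀ y ^ E₀ s₁ y ^ E₁ s₂ ⋯`, where `E = exps y T Q`, is a rearrangement of `Q` with
the same order of the letters other than `y`. -/
structure IsSpread (T : Finset ℕ) (y : ℕ) (Q s₀ : List ℕ) (s : List (List ℕ)) : Prop where
  length_eq : s.length = (exps y T Q).length
  flatten_eq : s₀ ++ s.flatten = Q.filter (· ≠ y)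
  not_mem : ∀ z ∈ s₀, z ∉ T
  map_eq : s.map (List.filter (· ∈ T)) = (Q.filter (· ∈ T)).map (fun t => [t]) ++ [[]]

theorem IsSpread.prepend {T : Finset ℕ} {y : ℕ} {Q s₀ : List ℕ} {s : List (List ℕ)}
    (h : IsSpread T y Q s₀ s) (c : List ℕ) (hc : y ∉ c) :
    ∃ r₀ r, IsSpread T y (c ++ Q) r₀ r ∧
      c ++ s₀ ++ weaveL y (exps y T Q) s = r₀ ++ weaveL y (exps y T (c ++ Q)) r := by
  induction c with
  | nil => exact ⟨s₀, s, h, by simp⟩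
  | cons z c ih =>
    simp only [List.mem_cons, not_or] at hc
    obtain ⟨r₀, r, hr, e⟩ := ih hc.2
    have hzy : z ≠ y := Ne.symm hc.1
    by_cases hz : z ∈ T
    · refine ⟨[], (z :: r₀) :: r, ⟨?_, ?_, by simp, ?_⟩, ?_⟩
      · simp [exps, hz, hr.length_eq]
      · simpa [hzy] using hr.flatten_eq
      · have : r₀.filter (· ∈ T) = [] := by simpa using hr.not_mem
        have h2 := hr.map_eq
        simp only [List.filter_append] at h2
        simp [hz, this, h2]
      · simpa [exps, hz, weaveL] using e
    · refine ⟨z :: r₀, r, ⟨?_, ?_, ?_, ?_⟩, ?_⟩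
      · simp [exps, hz, hzy, hr.length_eq]
      · simpa [hzy] using hr.flatten_eq
      · simpa [hz] using hr.not_mem
      · simpa [hz] using hr.map_eq
      · simpa [exps, hz, hzy, weaveL] using e

/-- After `gather_tail`, only the first `y` stands apart from the power of its block. If `y` recurs
in a later block, that power moves left to it. If not, the power contains the last `y`, and an extra
interchange is required; (i) provides one unless the isoterms of `filter_eq_of_isoterm` contradict
`hne`. -/
theorem exists_spread (H : Setup S M) {T : Finset ℕ} {y : ℕ} (hy : y ∉ T) {c Q v : List ℕ}
    (hyc : y ∉ c) (hQ : y ∈ Q) (hnl : ∀ z ∈ c ++ y :: Q, z ∉ T → 1 < (c ++ y :: Q).count z)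
    (hT : (c ++ y :: Q).filter (· ∈ T) = v.filter (· ∈ T))
    (hn : ((c ++ y :: Q).filter (· ∈ T)).Nodup) (h : SatL S (c ++ y :: Q) v)
    (hne : (c ++ y :: Q).filter (fun z => z = y ∨ z ∈ T) ≠ v.filter (fun z => z = y ∨ z ∈ T)) :
    ∃ s₀ s, IsSpread T y (c ++ y :: Q) s₀ s ∧
      SatL M (c ++ y :: Q) (s₀ ++ weaveL y (exps y T (c ++ y :: Q)) s) := by
  obtain ⟨s₀, s, hl, hf, h0, hTs, hs⟩ := gather_tail H.sigM hy Q
  have hs := hs (c ++ [y]) (by simp) (fun z hz hzT => by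
    simpa using hnl z (by simp [hz]) hzT)
  have hsum := sum_exps hy Q
  cases hE : exps y T Q with
  | nil => exact absurd hE (exps_ne_nil _ _ _)
  | cons b r =>
  rw [hE] at hl hs hsum
  cases s with
  | nil => simp at hl
  | cons t s =>
  simp only [List.length_cons, Nat.add_right_cancel_iff] at hl
  have hyE : exps y T (y :: Q) = (b + 1) :: r := by simp [exps, hy, hE, bump]
  have hys : y ∉ s₀ ++ (t :: s).flatten := by rw [hf]; simp
  have hsQ : ∀ z ∈ s₀ ++ (t :: s).flatten, z ∈ Q ∧ z ≠ y := by
    intro z hz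
    rw [hf] at hz
    simpa using hz
  have hWcount : ∀ z, z ≠ y → s₀.count z + (t ++ weaveL y r s).count z = Q.count z := by
    intro z hzy
    have e : (s₀ ++ (t :: s).flatten).count z = Q.count z := by rw [hf, count_filter_ne hzy]
    have e2 := count_weaveL_of_ne hzy (E := r) (s := s)
      (fun h => hys (by simp at h ⊢; exact .inr (.inr h))) hl
    simp only [List.count_append, List.flatten_cons] at e ⊢
    omega
  -- There are two ways to finish: `join` brings the power to the first `y`, and `pass` brings the
  -- first `y` to the power.
  have join : SatL M (c ++ y :: s₀ ++ List.replicate b y ++ (t ++ weaveL y r s))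
        (c ++ List.replicate b y ++ y :: s₀ ++ (t ++ weaveL y r s)) →
      ∃ s₀ s, IsSpread T y (c ++ y :: Q) s₀ s ∧
        SatL M (c ++ y :: Q) (s₀ ++ weaveL y (exps y T (c ++ y :: Q)) s) := by
    intro hj
    have hsp : IsSpread T y (y :: Q) [] ((s₀ ++ t) :: s) :=
      ⟨by simp [hyE, hl], by simpa using hf, by simp, by
        have : s₀.filter (· ∈ T) = [] := by simpa using h0
        simpa [hy, this] using hTs⟩
    obtain ⟨r₀, r', hr, e⟩ := hsp.prepend c hyc
    refine ⟨r₀, r', hr, ?_⟩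
    rw [← e, hyE]
    have h1 : SatL M (c ++ y :: Q) (c ++ y :: s₀ ++ List.replicate b y ++ (t ++ weaveL y r s)) := by
      simpa [weaveL] using hs
    refine (h1.trans hj).trans ?_
    have : List.replicate (b + 1) y = List.replicate b y ++ [y] := by
      rw [List.replicate_succ']
    simpa [weaveL, this] using SatL.refl _
  have pass : SatL M (c ++ y :: s₀ ++ List.replicate b y ++ (t ++ weaveL y r s))
        (c ++ s₀ ++ y :: List.replicate b y ++ (t ++ weaveL y r s)) →
      ∃ s₀ s, IsSpread T y (c ++ y :: Q) s₀ s ∧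
        SatL M (c ++ y :: Q) (s₀ ++ weaveL y (exps y T (c ++ y :: Q)) s) := by
    intro hj
    have hsp : IsSpread T y (y :: Q) s₀ (t :: s) :=
      ⟨by simp [hyE, hl], by simpa using hf, h0, by simpa [hy] using hTs⟩
    obtain ⟨r₀, r', hr, e⟩ := hsp.prepend c hyc
    refine ⟨r₀, r', hr, ?_⟩
    rw [← e, hyE]
    have h1 : SatL M (c ++ y :: Q) (c ++ y :: s₀ ++ List.replicate b y ++ (t ++ weaveL y r s)) := by
      simpa [weaveL] using hs
    refine (h1.trans hj).trans ?_
    simpa [weaveL, List.replicate_succ] using SatL.refl _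
  have movable : ∀ (k : ℕ) (q : List ℕ), y ∈ q → (∀ z, z ≠ y →
        q.count z = (t ++ weaveL y r s).count z) →
      SatL M (c ++ y :: s₀ ++ List.replicate k y ++ q)
        (c ++ List.replicate k y ++ y :: s₀ ++ q) := by
    intro k q hq hqc
    have := H.sigM.move_replicate hq s₀ k (p := c ++ [y]) (by simp) (fun z hz hzy => by
      have h1 := hnl z (by simp [(hsQ z (by simp [hz])).1]) (h0 z hz)
      have h2 := hWcount z hzy
      rw [← hqc z hzy] at h2
      simp only [List.count_append, List.count_cons] at h1 ⊢
      simp [Ne.symm hzy] at h1 ⊢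
      omega)
    have e : List.replicate k y ++ [y] = [y] ++ List.replicate k y := by
      rw [← List.replicate_succ', List.replicate_succ]; rfl
    have e' : c ++ List.replicate k y ++ y :: s₀ ++ q
        = c ++ [y] ++ List.replicate k y ++ s₀ ++ q := by
      have := congrArg (fun l => c ++ l ++ s₀ ++ q) e
      simpa using this
    rw [e']
    simpa using this.symm
  rcases Nat.eq_zero_or_pos r.sum with hr | hr
  swap
  · exact join (movable b _ (List.mem_append_right _ (mem_weaveL hl hr)) (fun _ _ => rfl))
  simp only [List.sum_cons, hr, add_zero] at hsum
  have hb : 0 < b := by rw [hsum]; exact List.count_pos_iff.2 hQ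
  have hnl' : ∀ z ∈ c ++ s₀ ++ (t ++ weaveL y r s), z ∉ T → 1 < (c ++ y :: Q).count z := by
    intro z hz hzT
    refine hnl z ?_ hzT
    by_cases hzy : z = y
    · simp [hzy]
    have := hWcount z hzy
    simp only [List.append_assoc, List.mem_append, List.mem_cons] at hz ⊢
    rcases hz with hz | hz | hz
    · exact .inl hz
    · have := List.count_pos_iff.2 hz
      exact .inr (.inr (List.count_pos_iff.1 (by omega)))
    · have := List.count_pos_iff.2 (List.mem_append.2 hz)
      exact .inr (.inr (List.count_pos_iff.1 (by omega)))
  have hcnt : ∀ z, (c ++ y :: s₀ ++ List.replicate b y ++ (t ++ weaveL y r s)).count z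
      = (c ++ y :: Q).count z := by
    intro z
    by_cases hzy : z = y
    · subst hzy
      have h1 : s₀.count z = 0 := List.count_eq_zero.2 (fun h => hys (by simp [h]))
      have h2 : (t ++ weaveL z r s).count z = 0 := by
        rw [weaveL_of_sum_eq_zero hl hr]
        exact List.count_eq_zero.2 (fun h => hys (List.mem_append_right _ (by simpa using h)))
      rw [List.count_append, h2]
      simp only [List.count_append, List.count_cons_self, List.count_replicate_self, h1, hsum]
      omega
    · have := hWcount z hzy
      rw [List.count_append]
      simp only [List.count_append (l₁ := c ++ y :: s₀), List.count_append (l₁ := c),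
        List.count_cons, List.count_replicate]
      simp [Ne.symm hzy]
      simp at this
      omega
  have hs0 : ∀ z ∈ s₀, z ∉ T ∧ z ≠ y := fun z hz => ⟨h0 z hz, (hsQ z (by simp [hz])).2⟩
  have hlast : ∀ d, 0 < d → d ≤ b → Sw M [b - d, d] [0, 1] →
      SatL M (c ++ y :: s₀ ++ List.replicate b y ++ (t ++ weaveL y r s))
        (c ++ List.replicate b y ++ y :: s₀ ++ (t ++ weaveL y r s)) := by
    intro d hd hdb hSw
    obtain ⟨b', rfl⟩ : ∃ b', b = b' + 1 := ⟨b - 1, by omega⟩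
    -- All but the last `y` of the power move by σ₁ and σ₂; only the last one needs `hSw`.
    have h1 := movable b' (y :: (t ++ weaveL y r s)) (by simp) (fun z hz => by
      rw [List.count_cons_of_ne (Ne.symm hz)])
    have h2 := last_passes H.sigM (T := T) (c := c) hd hdb hSw s₀ (t ++ weaveL y r s) hs0
      (fun z hz hzT => by
        have e : (c ++ List.replicate (b' + 1) y ++ s₀ ++ y :: (t ++ weaveL y r s)).count z
            = (c ++ y :: s₀ ++ List.replicate (b' + 1) y ++ (t ++ weaveL y r s)).count z := by
          simp only [List.count_append, List.count_cons, List.count_replicate]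
          omega
        rw [e, hcnt]
        exact hnl' z hz hzT)
    have e1 : c ++ y :: s₀ ++ List.replicate (b' + 1) y ++ (t ++ weaveL y r s)
        = c ++ y :: s₀ ++ List.replicate b' y ++ y :: (t ++ weaveL y r s) := by
      simp [List.replicate_succ']
    have e2 : c ++ List.replicate (b' + 1) y ++ s₀ ++ y :: (t ++ weaveL y r s)
        = c ++ List.replicate b' y ++ y :: s₀ ++ y :: (t ++ weaveL y r s) := by
      simp [List.replicate_succ']
    rw [e2] at h2
    rw [e1]
    exact h1.trans h2
  have hfirst : ∀ d, 0 < d → d ≤ b → Sw M [0, 1] [b - d, d] →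
      SatL M (c ++ y :: s₀ ++ List.replicate b y ++ (t ++ weaveL y r s))
        (c ++ s₀ ++ y :: List.replicate b y ++ (t ++ weaveL y r s)) :=
    fun d hd hdb hSw => first_passes H.sigM (T := T) hd hdb hSw s₀ c hyc hs0
      (fun z hz hzT => by rw [hcnt]; exact hnl' z hz hzT)
  by_cases hA : ∀ t ≠ y, IsoL S (List.replicate (Q.count y + 1) y ++ [t, t])
  · by_cases hB : ∀ t ≠ y, IsoL S ([t, t] ++ List.replicate (Q.count y + 1) y)
    · exact absurd (filter_eq_of_isoterm hy hyc (by rw [hE]; simpa using hr) hT hn h hA hB) hne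
    · push Not at hB
      obtain ⟨z, hzy, hB⟩ := hB
      -- With exponent 2 for `z` the only possible split is `1 + 1`. This gives `[0, 1]`, which fits
      -- every letter having one more occurrence on that side.
      obtain ⟨d, e, hd, hd2, he, he2, hsw⟩ := H.one 2 (Q.count y + 1) (by omega) (by omega) z y hzy
        (by simpa [List.replicate_succ] using hB)
      obtain rfl : d = 1 := by omega
      refine pass (hfirst e he (by omega) (H.sw _ _ (by simp) (by simp; omega) ?_))
      rw [hsum]
      convert hsw using 2
      omega
  · push Not at hA
    obtain ⟨z, hzy, hA⟩ := hA
    obtain ⟨d, e, hd, hd2, he, he2, hsw⟩ := H.one (Q.count y + 1) 2 (by omega) (by omega) y z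
      (Ne.symm hzy) (by simpa [List.replicate_succ] using hA)
    obtain rfl : e = 1 := by omega
    refine join (hlast d hd (by omega) (H.sw _ _ (by simp; omega) (by simp) ?_))
    rw [hsum]
    convert hsw using 2
    omega

theorem filter_weaveL (f : ℕ → Bool) {y : ℕ} (hf : f y = true) (E : List ℕ) (s : List (List ℕ)) :
    (weaveL y E s).filter f = weaveL y E (s.map (List.filter f)) := by
  induction E generalizing s with
  | nil => simp [weaveL]
  | cons a E ih => cases s <;> simp [weaveL, ih, hf]

/-! ### Making an identity block-balanced. -/

/-- One letter `y` of `u` can be rearranged so as to have the same blocks as in `v`. -/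
theorem exists_adjust (H : Setup S M) {T : Finset ℕ} {y : ℕ} (hy : y ∉ T) {u v : List ℕ}
    (hyu : 1 < u.count y) (hnl : ∀ z ∈ u, z ∉ T → 1 < u.count z)
    (hT : u.filter (· ∈ T) = v.filter (· ∈ T)) (hn : (u.filter (· ∈ T)).Nodup)
    (h : SatL S u v) :
    ∃ u', SatL M u u' ∧
      u'.filter (fun z => z = y ∨ z ∈ T) = v.filter (fun z => z = y ∨ z ∈ T) ∧
      ∀ x ≠ y, u'.filter (fun z => z = x ∨ z ∈ T) = u.filter (fun z => z = x ∨ z ∈ T) := by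
  by_cases hne : u.filter (fun z => z = y ∨ z ∈ T) = v.filter (fun z => z = y ∨ z ∈ T)
  · exact ⟨u, SatL.refl _, hne, fun _ _ => rfl⟩
  obtain ⟨c, Q, e, hyc⟩ := List.eq_append_cons_of_mem (List.count_pos_iff.1 (by omega : 0 < u.count y))
  subst e
  have hQ : y ∈ Q := by
    rw [List.count_append, List.count_eq_zero.2 hyc, List.count_cons_self] at hyu
    exact List.count_pos_iff.1 (by omega)
  obtain ⟨s₀, s, hsp, hs⟩ := exists_spread H hy hyc hQ hnl hT hn h hne
  have hlen : (exps y T (c ++ y :: Q)).length = (exps y T v).length := by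
    rw [length_exps hy, length_exps hy, hT]
  have hys : y ∉ s₀ ++ s.flatten := by rw [hsp.flatten_eq]; simp
  refine ⟨s₀ ++ weaveL y (exps y T v) s, hs.trans ?_, ?_, ?_⟩
  -- In spread form the word is a substitution instance of an almost-linear word, with everything
  -- other than `y` sitting in the separators. Hence the exponents change and nothing else moves.
  · have hrel := H.rel _ _ hlen (rel_exps hy h hT hn)
    apply SatL.append_left
    intro φ
    rw [prod_map_weaveL, prod_map_weaveL]
    exact hrel _ _ (by simp [hsp.length_eq])
  · rw [List.filter_append, filter_weaveL _ (by simp), filter_eq_weaveL hy v]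
    have h1 : s₀.filter (fun z => z = y ∨ z ∈ T) = [] := by
      rw [List.filter_eq_nil_iff]
      intro z hz
      have : z ≠ y := by rintro rfl; exact hys (by simp [hz])
      simp [this, hsp.not_mem z hz]
    have h2 : s.map (List.filter (fun z => z = y ∨ z ∈ T)) = s.map (List.filter (· ∈ T)) := by
      apply List.map_congr_left
      intro w hw
      apply List.filter_congr
      intro z hz
      have : z ≠ y := by
        rintro rfl
        exact hys (List.mem_append_right _ (List.mem_flatten.2 ⟨w, hw, hz⟩))
      simp [this]
    rw [h1, h2, hsp.map_eq, hT]
    rfl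
  · intro x hx
    have ff : ∀ w : List ℕ, w.filter (fun z => z = x ∨ z ∈ T)
        = (w.filter (· ≠ y)).filter (fun z => z = x ∨ z ∈ T) := by
      intro w
      rw [List.filter_filter]
      apply List.filter_congr
      intro z _
      rw [← Bool.decide_and, decide_eq_decide]
      refine ⟨fun hz => ⟨hz, fun e => ?_⟩, And.left⟩
      subst e
      rcases hz with hz | hz
      · exact hx hz.symm
      · exact hy hz
    rw [ff, ff (c ++ y :: Q), ← hsp.flatten_eq, List.filter_append (p := (· ≠ y)),
      filter_ne_weaveL (fun h => hys (List.mem_append_right _ h))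
        (by rw [hsp.length_eq, hlen])]
    congr 2
    rw [List.filter_eq_self]
    intro z hz
    simp only [decide_eq_true_eq]
    rintro rfl
    exact hys (by simp [hz])

/-- A letter `z` of `w` would give `z^n ≈ 1` with `n > 0`, and multiplying by a two-letter isoterm
that starts with `z` is a contradiction. -/
theorem nil_of_satL (iso : ∀ x y : ℕ, x ≠ y → IsoL S [x, y]) {w : List ℕ} (h : SatL S w []) :
    w = [] := by
  by_contra hw
  obtain ⟨z, hz⟩ := List.exists_mem_of_ne_nil w hw
  have h1 := h.filter (fun a => a = z)
  rw [filter_eq_replicate (y := z) _ (by simp)] at h1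
  have h2 := (h1.append_right [z, z + 1]).symm
  have := congrArg List.length (iso z (z + 1) (by omega) _ (by simpa using h2))
  simp at this
  exact List.count_eq_zero.1 this hz

theorem count_eq_one_of_satL (iso : ∀ x y : ℕ, x ≠ y → IsoL S [x, y]) {u v : List ℕ} {z : ℕ}
    (h : SatL S u v) (hz : u.count z = 1) : v.count z = 1 := by
  have h1 := h.filter (fun a => a = z)
  rw [filter_eq_replicate (y := z) _ (by simp), filter_eq_replicate (y := z) _ (by simp), hz] at h1
  have := congrArg List.length (iso z (z + 1) (by omega) _ (by simpa using h1.append_right [z + 1]))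
  simpa using this

theorem count_eq_zero_of_satL (iso : ∀ x y : ℕ, x ≠ y → IsoL S [x, y]) {u v : List ℕ} {z : ℕ}
    (h : SatL S u v) (hz : u.count z = 0) : v.count z = 0 := by
  have h1 := h.filter (fun a => a = z)
  rw [filter_eq_replicate (y := z) _ (by simp), filter_eq_replicate (y := z) _ (by simp), hz] at h1
  simpa using congrArg List.length (nil_of_satL iso h1.symm)

theorem linF_eq_of_satL (iso : ∀ x y : ℕ, x ≠ y → IsoL S [x, y]) {u v : List ℕ}
    (h : SatL S u v) : linF u = linF v := by
  ext z
  rw [mem_linF, mem_linF]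
  exact ⟨count_eq_one_of_satL iso h, count_eq_one_of_satL iso h.symm⟩

theorem nodup_filter_linF (u : List ℕ) : (u.filter (· ∈ linF u)).Nodup := by
  rw [List.nodup_iff_count_le_one]
  intro a
  by_cases ha : a ∈ linF u
  · rw [List.count_filter (by simpa using ha)]
    exact (mem_linF.1 ha).le
  · rw [List.count_eq_zero.2 (by simp [ha])]
    omega

theorem pair_perm {a b : ℕ} (hab : a ≠ b) {l : List ℕ} (ha : l.count a = 1) (hb : l.count b = 1)
    (hl : ∀ z ∈ l, z = a ∨ z = b) : l = [a, b] ∨ l = [b, a] := by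
  rw [← List.perm_pair]
  rw [List.perm_iff_count]
  intro z
  by_cases h1 : z = a
  · subst h1; simp [ha, Ne.symm hab]
  by_cases h2 : z = b
  · subst h2; simp [hb, hab]
  rw [List.count_eq_zero.2 (fun h => (hl z h).elim h1 h2)]
  simp [Ne.symm h1, Ne.symm h2]

/-- Two distinct linear letters project to a two-letter isoterm, so their order is fixed; pairwise
order determines the word. -/
theorem filter_linF_eq (iso : ∀ x y : ℕ, x ≠ y → IsoL S [x, y]) {u v : List ℕ}
    (h : SatL S u v) : u.filter (· ∈ linF u) = v.filter (· ∈ linF u) := by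
  have hlin := linF_eq_of_satL iso h
  apply eq_of_filter_pair
  have memT : ∀ a ∈ u.filter (· ∈ linF u) ++ v.filter (· ∈ linF u), a ∈ linF u := by
    intro a ha; simp at ha; tauto
  intro a ha b hb
  replace ha := memT a ha
  replace hb := memT b hb
  have ff : ∀ w : List ℕ, (w.filter (· ∈ linF u)).filter (fun z => z = a ∨ z = b)
      = w.filter (fun z => z = a ∨ z = b) := by
    intro w
    rw [List.filter_filter]
    apply List.filter_congr
    intro z _
    rw [← Bool.decide_and, decide_eq_decide]
    refine ⟨And.left, ?_⟩
    rintro (rfl | rfl)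
    · exact ⟨.inl rfl, ha⟩
    · exact ⟨.inr rfl, hb⟩
  rw [ff, ff]
  have h1 := h.filter (fun z => z = a ∨ z = b)
  have ha' : v.count a = 1 := by rw [← mem_linF, ← hlin]; exact ha
  have hb' : v.count b = 1 := by rw [← mem_linF, ← hlin]; exact hb
  rw [mem_linF] at ha hb
  by_cases hab : a = b
  · subst hab
    simp only [or_self]
    rw [filter_eq_replicate (y := a) _ (by simp), filter_eq_replicate (y := a) _ (by simp), ha, ha']
  · have := pair_perm hab (l := u.filter (fun z => z = a ∨ z = b))
      (by rw [List.count_filter (by simp), ha]) (by rw [List.count_filter (by simp), hb])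
      (by intro z hz; simpa using (List.mem_filter.1 hz).2)
    rcases this with e | e
    · rw [e] at h1 ⊢; exact (iso a b hab _ h1).symm
    · rw [e] at h1 ⊢; exact (iso b a (Ne.symm hab) _ h1).symm

theorem count_eq_of_filter {u v : List ℕ} {z : ℕ} {T : Finset ℕ}
    (h : u.filter (fun a => a = z ∨ a ∈ T) = v.filter (fun a => a = z ∨ a ∈ T)) :
    u.count z = v.count z := by
  have := congrArg (List.count z) h
  rwa [List.count_filter (by simp), List.count_filter (by simp)] at this

theorem filter_or_eq {T : Finset ℕ} {x : ℕ} {u : List ℕ} (h : x ∈ T ∨ x ∉ u) :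
    u.filter (fun z => z = x ∨ z ∈ T) = u.filter (· ∈ T) := by
  apply List.filter_congr
  intro z hz
  rw [decide_eq_decide]
  refine ⟨?_, .inr⟩
  rintro (rfl | h')
  · exact h.resolve_right (fun h => h hz)
  · exact h'

/-- Every identity of `S` can be turned into a block-balanced one. -/
theorem exists_blockBalanced (H : Setup S M) {u v : List ℕ} (h : SatL S u v) :
    ∃ u', SatL M u u' ∧ BBL u' v := by
  set T := linF u with hTdef
  -- Adjusting one letter keeps the projections of all others, so letters already treated remain
  -- correct.
  have key : ∀ F : Finset ℕ, (∀ y ∈ F, 1 < u.count y) → ∃ u', SatL M u u' ∧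
      (∀ x ∈ F, u'.filter (fun z => z = x ∨ z ∈ T) = v.filter (fun z => z = x ∨ z ∈ T)) ∧
      ∀ x ∉ F, u'.filter (fun z => z = x ∨ z ∈ T) = u.filter (fun z => z = x ∨ z ∈ T) := by
    intro F
    induction F using Finset.induction_on with
    | empty => exact fun _ => ⟨u, SatL.refl _, by simp, fun _ _ => rfl⟩
    | insert y F hyF ih =>
      intro hF
      obtain ⟨w, hw, hw1, hw2⟩ := ih (fun z hz => hF z (by simp [hz]))
      have hSw := H.sat _ _ hw
      have hlin := linF_eq_of_satL H.iso hSw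
      have hyc := hF y (by simp)
      have hyT : y ∉ T := by rw [hTdef, mem_linF]; omega
      have hSwv : SatL S w v := hSw.symm.trans h
      obtain ⟨u', h1, h2, h3⟩ := exists_adjust H hyT (u := w) (v := v)
        (by rw [count_eq_of_filter (hw2 y hyF)]; exact hyc)
        (fun z hz hzT => by
          have h1 := List.count_pos_iff.2 hz
          have h2 : w.count z ≠ 1 := fun e => hzT (by rw [hTdef, hlin, mem_linF]; exact e)
          omega)
        (by have := filter_linF_eq H.iso hSwv; rwa [← hlin] at this)
        (by have := nodup_filter_linF w; rwa [← hlin] at this) hSwv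
      refine ⟨u', hw.trans h1, ?_, ?_⟩
      · intro x hx
        by_cases hxy : x = y
        · rw [hxy]; exact h2
        · rw [h3 x hxy]; exact hw1 x (by simpa [hxy] using hx)
      · intro x hx
        simp only [Finset.mem_insert, not_or] at hx
        rw [h3 x hx.1, hw2 x hx.2]
  obtain ⟨u', h1, h2, h3⟩ := key (u.toFinset.filter (fun z => 1 < u.count z)) (by simp)
  refine ⟨u', h1, fun x => ?_⟩
  rw [← linF_eq_of_satL H.iso (H.sat _ _ h1)]
  by_cases hx : x ∈ u.toFinset.filter (fun z => 1 < u.count z)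
  · exact h2 x hx
  · rw [h3 x hx]
    have hx' : x ∈ T ∨ x ∉ u := by
      rw [hTdef, mem_linF, ← List.count_pos_iff]
      simp at hx
      by_cases hxu : x ∈ u
      · have := hx hxu
        have := List.count_pos_iff.2 hxu
        omega
      · right; rw [List.count_eq_zero.2 hxu]; omega
    have hx'' : x ∈ T ∨ x ∉ v := hx'.imp_right fun hxu => by
      rw [← List.count_eq_zero] at hxu ⊢
      exact count_eq_zero_of_satL H.iso h hxu
    rw [filter_or_eq hx', filter_or_eq hx'']
    exact filter_linF_eq H.iso h

/-! ### Extracting interchanges from identities. -/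

theorem prod_map_eq_weave' {y : ℕ} {T : Finset ℕ} (hy : y ∉ T) (φ : ℕ → M)
    (hφ : ∀ z, z ∉ T → z ≠ y → φ z = 1) (Q : List ℕ) :
    (Q.map φ).prod
      = weave' (φ y) (exps y T Q.reverse) ((Q.reverse.filter (· ∈ T)).map φ ++ [1]) := by
  have h1 := prod_map_eq_weave hy (fun z => MulOpposite.op (φ z))
    (fun z h1 h2 => by simp [hφ z h1 h2]) Q.reverse
  rw [map_op_prod, List.reverse_reverse] at h1
  rw [weave'_eq, List.map_append, List.map_map]
  exact congrArg MulOpposite.unop h1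

theorem weave'_append_one (m : M) {E : List ℕ} {s : List M} (h : E.length = s.length + 1) (c : M) :
    weave' m E (s ++ [c]) = c * weave' m E (s ++ [1]) := by
  rw [weave'_eq, weave'_eq, List.map_append, List.map_append]
  have := weave_append_one (MulOpposite.op m) (E := E) (s := s.map MulOpposite.op) (by simpa using h)
    (MulOpposite.op c)
  simpa using congrArg MulOpposite.unop this

theorem prod_map_congr {φ ψ : ℕ → M} {l : List ℕ} (h : ∀ z ∈ l, φ z = ψ z) :
    (l.map φ).prod = (l.map ψ).prod := by
  rw [List.map_congr_left h]

/-- The letters of `T` are distinct, so they take arbitrary values; the outermost separators of `Sw`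
are free factors at the two ends. -/
theorem sw_of_satL {T : Finset ℕ} {x y : ℕ} (hxy : x ≠ y) (hx : x ∉ T) (hy : y ∉ T)
    {A B : List ℕ} (hA : ∀ z ∈ A, z = x ∨ z ∈ T) (hB : ∀ z ∈ B, z = y ∨ z ∈ T)
    (hn : (A.filter (· ∈ T) ++ B.filter (· ∈ T)).Nodup)
    (h : SatL M (A ++ x :: y :: B) (A ++ y :: x :: B)) :
    Sw M (exps x T A.reverse) (exps y T B) := by
  intro m m' s s' hs hs'
  rw [length_exps hx] at hs
  rw [length_exps hy] at hs'
  have hs0 : s ≠ [] := by intro e; rw [e] at hs; simp at hs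
  have hs0' : s' ≠ [] := by intro e; rw [e] at hs'; simp at hs'
  obtain ⟨s, c, rfl⟩ : ∃ r c, s = r ++ [c] :=
    ⟨s.dropLast, s.getLast hs0, (List.dropLast_append_getLast hs0).symm⟩
  obtain ⟨s', c', rfl⟩ : ∃ r c, s' = r ++ [c] :=
    ⟨s'.dropLast, s'.getLast hs0', (List.dropLast_append_getLast hs0').symm⟩
  simp only [List.length_append, List.length_singleton, Nat.add_right_cancel_iff] at hs hs'
  have hn' : (A.reverse.filter (· ∈ T) ++ B.filter (· ∈ T)).Nodup := by
    refine (List.Perm.nodup_iff ?_).1 hn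
    exact (List.Perm.filter _ (List.reverse_perm A).symm).append_right _
  obtain ⟨f, hf⟩ := exists_map_eq hn' (s := s ++ s') (by simp [hs, hs'])
  rw [List.map_append] at hf
  obtain ⟨hf1, hf2⟩ := List.append_inj hf (by simp [hs])
  let φ : ℕ → M := fun z => if z = x then m else if z = y then m' else f z
  have hT : ∀ (w : List ℕ), (w.filter (· ∈ T)).map φ = (w.filter (· ∈ T)).map f := by
    intro w
    apply List.map_congr_left
    intro z hz
    have hz : z ∈ T := by simpa using (List.mem_filter.1 hz).2
    have h1 : z ≠ x := fun e => hx (e ▸ hz)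
    have h2 : z ≠ y := fun e => hy (e ▸ hz)
    simp [φ, h1, h2]
  -- Each of `A` and `B` contains only one of `x`, `y` besides `T`, so on each of them `φ` agrees
  -- with an assignment that kills all other letters.
  let ψ : ℕ → ℕ → M := fun a z => if z = a ∨ z ∈ T then φ z else 1
  have hψ : ∀ (a : ℕ) (w : List ℕ), (w.filter (· ∈ T)).map (ψ a) = (w.filter (· ∈ T)).map φ := by
    intro a w
    apply List.map_congr_left
    intro z hz
    have hz : z ∈ T := by simpa using (List.mem_filter.1 hz).2
    simp [ψ, hz]
  have hψ1 : ∀ a z, z ∉ T → z ≠ a → ψ a z = 1 := fun a z h1 h2 => by simp [ψ, h1, h2]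
  have hAe : (A.map φ).prod = weave' m (exps x T A.reverse) (s ++ [1]) := by
    rw [prod_map_congr (ψ := ψ x) (fun z hz => by simp [ψ, hA z hz]),
      prod_map_eq_weave' hx _ (hψ1 x), hψ, hT, hf1]
    simp [ψ, φ]
  have hBe : (B.map φ).prod = weave m' (exps y T B) (s' ++ [1]) := by
    rw [prod_map_congr (ψ := ψ y) (fun z hz => by simp [ψ, hB z hz]),
      prod_map_eq_weave hy _ (hψ1 y), hψ, hT, hf2]
    simp [ψ, φ, Ne.symm hxy]
  have h1 := h φ
  have hφx : φ x = m := by simp [φ]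
  have hφy : φ y = m' := by simp [φ, Ne.symm hxy]
  simp only [List.map_append, List.map_cons, List.prod_append, List.prod_cons, hAe, hBe, hφx,
    hφy] at h1
  rw [weave'_append_one m (by rw [length_exps hx, hs]),
    weave_append_one m' (E := exps y T B) (by rw [length_exps hy, hs'])]
  have h2 := congrArg (fun z => c * z * c') h1
  simpa [mul_assoc] using h2

theorem Sig.perm_of_mem_right (h : Sig M) {q l l' : List ℕ} (hl : l.Perm l') :
    (∀ z ∈ l, z ∈ q) → ∀ p, SatL M (p ++ l ++ q) (p ++ l' ++ q) := by
  induction hl with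
  | nil => exact fun _ p => SatL.refl _
  | cons z _ ih =>
    intro hq p
    simpa using ih (fun w hw => hq w (by simp [hw])) (p ++ [z])
  | swap a b l =>
    intro hq p
    have := h.swap_of_mem_right p (q := l ++ q) (a := b) (b := a)
      (List.mem_append_right _ (hq b (by simp))) (List.mem_append_right _ (hq a (by simp)))
    simpa using this
  | trans h1 _ ih1 ih2 =>
    intro hq p
    exact (ih1 hq p).trans (ih2 (fun z hz => hq z (h1.mem_iff.2 hz)) p)

theorem Sig.perm_of_mem_left (h : Sig M) {p l l' : List ℕ} (hl : l.Perm l')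
    (hp : ∀ z ∈ l, z ∈ p) (q : List ℕ) : SatL M (p ++ l ++ q) (p ++ l' ++ q) := by
  apply SatL.of_reverse_op
  have := h.op.perm_of_mem_right (q := p.reverse) (l := l.reverse) (l' := l'.reverse)
    (((List.reverse_perm l).trans hl).trans (List.reverse_perm l').symm)
    (by simpa using hp) q.reverse
  simpa using this

theorem append_cons_inj_of_not_mem_left {x : ℕ} {l₁ l₂ r₁ r₂ : List ℕ} (h₁ : x ∉ l₁) (h₂ : x ∉ l₂)
    (h : l₁ ++ x :: r₁ = l₂ ++ x :: r₂) : l₁ = l₂ ∧ r₁ = r₂ := by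
  induction l₁ generalizing l₂ with
  | nil =>
    cases l₂ with
    | nil => simpa using h
    | cons a l => simp at h h₂; exact absurd h.1 h₂.1
  | cons a l ih =>
    cases l₂ with
    | nil => simp at h h₁; exact absurd h.1.symm h₁.1
    | cons b l' =>
      simp at h h₁ h₂
      obtain ⟨e1, e2⟩ := ih h₁.2 h₂.2 h.2
      exact ⟨by rw [h.1, e1], e2⟩

theorem append_cons_inj_of_not_mem_right {x : ℕ} {l₁ l₂ r₁ r₂ : List ℕ} (h₁ : x ∉ r₁) (h₂ : x ∉ r₂)
    (h : l₁ ++ x :: r₁ = l₂ ++ x :: r₂) : l₁ = l₂ ∧ r₁ = r₂ := by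
  have := append_cons_inj_of_not_mem_left (x := x) (l₁ := r₁.reverse) (l₂ := r₂.reverse)
    (r₁ := l₁.reverse) (r₂ := l₂.reverse) (by simpa using h₁) (by simpa using h₂)
    (by simpa using congrArg List.reverse h)
  simpa [and_comm] using this

theorem mem_of_sum_tail_exps_pos {T : Finset ℕ} {y : ℕ} (hy : y ∉ T) {l w : List ℕ}
    (hl : ∀ z ∈ l, z ∉ T) (h : 0 < (exps y T (l ++ w)).tail.sum) : y ∈ w := by
  induction l with
  | nil =>
    rw [← List.count_pos_iff, ← sum_exps hy]
    cases hE : exps y T w with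
    | nil => simp [hE] at h
    | cons a r => simp [hE] at h ⊢; omega
  | cons z l ih =>
    apply ih (fun a ha => hl a (by simp [ha]))
    have hz := hl z (by simp)
    by_cases hzy : z = y
    · subst hzy
      cases hE : exps z T (l ++ w) with
      | nil => exact absurd hE (exps_ne_nil _ _ _)
      | cons a r => simpa [exps, hz, hE, bump] using h
    · simpa [exps, hz, hzy] using h

theorem filter_or_self {T : Finset ℕ} {x : ℕ} {l : List ℕ} (h : ∀ z ∈ l, z = x ∨ z ∈ T) :
    l.filter (fun z => z = x ∨ z ∈ T) = l := by
  rw [List.filter_eq_self]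
  intro z hz
  simpa using h z hz

theorem replicate_of_filter_pair {x y : ℕ} {l r : List ℕ} (hl : y ∉ l) (hr : x ∉ r) :
    (l ++ r).filter (fun z => z = x ∨ z = y)
      = List.replicate (l.count x) x ++ List.replicate (r.count y) y := by
  rw [List.filter_append, filter_eq_replicate (y := x), filter_eq_replicate (y := y)]
  · intro z hz
    have : z ≠ x := by rintro rfl; exact hr hz
    simp [this]
  · intro z hz
    have : z ≠ y := by rintro rfl; exact hl hz
    simp [this]

/-- Modulo `σ₁` and `σ₂` every block-balanced identity that moves the first `y` to the left of the
last `x` in `A x y B` gives the interchange of these two occurrences. -/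
theorem satL_swap_of_unstable (hS : Sig S) {T : Finset ℕ} {x y : ℕ} (hxy : x ≠ y) (hx : x ∉ T)
    (hy : y ∉ T) {A B V : List ℕ} (hA : ∀ z ∈ A, z = x ∨ z ∈ T) (hB : ∀ z ∈ B, z = y ∨ z ∈ T)
    (hlin : linF (A ++ x :: y :: B) = T) (hAm : 0 < (exps x T A.reverse).tail.sum)
    (hBm : 0 < (exps y T B).tail.sum) (hbb : BBL (A ++ x :: y :: B) V)
    (hne : (A ++ x :: y :: B).filter (fun z => z = x ∨ z = y) ≠ V.filter (fun z => z = x ∨ z = y)) :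
    SatL S V (A ++ y :: x :: B) := by
  have hyA : y ∉ A := fun h => (hA y h).elim (fun e => hxy e.symm) hy
  have hxB : x ∉ B := fun h => (hB x h).elim hxy hx
  have hbbx := hbb x
  have hbby := hbb y
  have hcount : ∀ z, V.count z = (A ++ x :: y :: B).count z := fun z =>
    (count_eq_of_filter (hbb z)).symm
  have hV : ∀ z ∈ V, z = x ∨ z = y ∨ z ∈ T := by
    intro z hz
    have := List.count_pos_iff.2 hz
    rw [hcount, List.count_pos_iff] at this
    simp only [List.mem_append, List.mem_cons] at this
    rcases this with h | h | h | h
    · exact (hA z h).imp_right .inr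
    · exact .inl h
    · exact .inr (.inl h)
    · exact .inr (hB z h)
  rw [hlin] at hbbx hbby
  rw [List.filter_append, List.filter_cons_of_pos (by simp),
    List.filter_cons_of_neg (by simpa using ⟨Ne.symm hxy, hy⟩), filter_or_self hA,
    filter_or_eq (.inr hxB)] at hbbx
  rw [List.filter_append, List.filter_cons_of_neg (by simpa using ⟨hxy, hx⟩),
    List.filter_cons_of_pos (by simp), filter_or_self hB,
    filter_or_eq (.inr hyA)] at hbby
  have hyV : y ∈ V := by
    rw [← List.count_pos_iff, hcount, List.count_pos_iff]; simp
  obtain ⟨v₁, v₂, rfl, hyv₁⟩ := List.eq_append_cons_of_mem hyV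
  -- If no `x` followed the first `y`, then `V` would project to the same `x^m y^n` as the left
  -- side.
  by_cases hxv₂ : x ∈ v₂
  swap
  · refine absurd ?_ hne
    have e : A ++ x :: y :: B = (A ++ [x]) ++ (y :: B) := by simp
    have h1 := hcount x
    have h2 := hcount y
    rw [e] at h1 h2 ⊢
    have hyA' : y ∉ A ++ [x] := by simpa using ⟨hyA, Ne.symm hxy⟩
    have hxB' : x ∉ y :: B := by simpa using ⟨hxy, hxB⟩
    have hxv : x ∉ y :: v₂ := by simpa using ⟨hxy, hxv₂⟩
    rw [replicate_of_filter_pair hyA' hxB', replicate_of_filter_pair hyv₁ hxv]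
    rw [List.count_append, List.count_append, List.count_eq_zero.2 hxB',
      List.count_eq_zero.2 hxv] at h1
    rw [List.count_append, List.count_append, List.count_eq_zero.2 hyA',
      List.count_eq_zero.2 hyv₁] at h2
    congr 2 <;> omega
  obtain ⟨w₃, w₂, e, hxv₃⟩ := List.eq_append_cons_of_mem (List.mem_reverse.2 hxv₂)
  obtain ⟨v₃, rfl⟩ : ∃ v, w₃ = v.reverse := ⟨w₃.reverse, by simp⟩
  obtain ⟨v, rfl⟩ : ∃ v, w₂ = v.reverse := ⟨w₂.reverse, by simp⟩
  have e : v₂ = v ++ x :: v₃ := by simpa using congrArg List.reverse e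
  subst e
  rw [List.mem_reverse] at hxv₃
  have hv₁ : ∀ z ∈ v₁, z = x ∨ z ∈ T := fun z hz => by
    have hzy : z ≠ y := by rintro rfl; exact hyv₁ hz
    simpa [hzy] using hV z (by simp [hz])
  have hv₃ : ∀ z ∈ v₃, z = y ∨ z ∈ T := fun z hz => by
    have hzx : z ≠ x := by rintro rfl; exact hxv₃ hz
    simpa [hzx] using hV z (by simp [hz])
  rw [List.filter_append, List.filter_cons_of_neg (by simpa using ⟨Ne.symm hxy, hy⟩),
    List.filter_append, List.filter_cons_of_pos (by simp), filter_or_self hv₁,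
    ← List.append_assoc] at hbbx
  obtain ⟨hA', -⟩ := append_cons_inj_of_not_mem_right
    (fun h => hxB (List.mem_filter.1 h).1) (fun h => hxv₃ (List.mem_filter.1 h).1) hbbx
  rw [List.filter_append, List.filter_cons_of_pos (by simp),
    List.filter_append, List.filter_cons_of_neg (by simpa using ⟨hxy, hx⟩), filter_or_self hv₃,
    filter_or_eq (.inr hyv₁)] at hbby
  obtain ⟨hAT, hB'⟩ := append_cons_inj_of_not_mem_left
    (fun h => hyA (List.mem_filter.1 h).1) (fun h => hyv₁ (List.mem_filter.1 h).1) hbby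
  -- Comparing what precedes the last `x` gives `A` as `v₁` followed by the `{x} ∪ T` part of `v`.
  -- Comparing what precedes the first `y` gives `A` and `v₁` the same separators. So `v` has none.
  have hvT : ∀ z ∈ v, z ∉ T := by
    rw [hA', List.filter_append] at hAT
    replace hAT := List.append_right_eq_self.1 hAT
    intro z hz hzT
    have : z ∈ (v.filter (fun z => z = x ∨ z ∈ T)).filter (· ∈ T) := by simp [hz, hzT]
    rw [hAT] at this
    simp at this
  have hvx : v.filter (fun z => z = x ∨ z ∈ T) = List.replicate (v.count x) x :=
    filter_eq_replicate _ (fun z hz => by simp [hvT z hz])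
  have hvy : v.filter (fun z => z = y ∨ z ∈ T) = List.replicate (v.count y) y :=
    filter_eq_replicate _ (fun z hz => by simp [hvT z hz])
  rw [hvx] at hA'
  rw [hvy] at hB'
  have hvmem : ∀ z ∈ v, z = x ∨ z = y := fun z hz => by
    simpa [hvT z hz] using hV z (by simp [hz])
  have hxv₁ : x ∈ v₁ := by
    rw [hA', List.reverse_append] at hAm
    have := mem_of_sum_tail_exps_pos hx (by
      intro z hz
      simp at hz
      rw [hz.2]; exact hx) hAm
    simpa using this
  have hyv₃ : y ∈ v₃ := by
    rw [hB'] at hBm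
    exact mem_of_sum_tail_exps_pos hy (by
      intro z hz
      simp at hz
      rw [hz.2]; exact hy) hBm
  have hperm : (y :: v).Perm (List.replicate (v.count x) x ++ y :: List.replicate (v.count y) y) := by
    rw [List.perm_iff_count]
    intro z
    simp only [List.count_append, List.count_cons, List.count_replicate, beq_iff_eq]
    by_cases h1 : z = x
    · subst h1; simp [Ne.symm hxy]
    by_cases h2 : z = y
    · subst h2; simp [hxy]
    rw [List.count_eq_zero.2 (fun h => (hvmem z h).elim h1 h2)]
    simp [Ne.symm h1, Ne.symm h2]
  -- Now `A = v₁ x^i` and `B = y^j v₃`. Both letters recur to the right, so σ₁ sorts `y v` into `x^i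
  -- y^(j+1)`. Then σ₂ moves the last `x` left over `y^j`, as both letters have occurred before.
  have s1 := hS.perm_of_mem_right hperm (q := x :: v₃) (by
    intro z hz
    simp only [List.mem_cons] at hz ⊢
    rcases hz with rfl | hz
    · exact .inr hyv₃
    · rcases hvmem z hz with rfl | rfl
      · exact .inl rfl
      · exact .inr hyv₃) v₁
  have s2 := hS.perm_of_mem_left (p := v₁ ++ List.replicate (v.count x) x ++ [y])
    (l := List.replicate (v.count y) y ++ [x]) (l' := [x] ++ List.replicate (v.count y) y)
    List.perm_append_comm (by
      intro z hz
      simp at hz ⊢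
      rcases hz with hz | rfl
      · simp [hz.2]
      · simp [hxv₁]) v₃
  rw [hA', hB']
  have s1' : SatL S (v₁ ++ y :: (v ++ x :: v₃)) (v₁ ++ List.replicate (v.count x) x ++ [y] ++
      (List.replicate (v.count y) y ++ [x]) ++ v₃) := by simpa using s1
  refine s1'.trans ?_
  simpa using s2

theorem BBL.filter {u v : List ℕ} (h : BBL u v) (f : ℕ → Bool) :
    BBL (u.filter f) (v.filter f) := by
  intro x
  have key : ∀ w : List ℕ, (w.filter f).filter (fun z => z = x ∨ z ∈ linF (u.filter f))
      = (w.filter (fun z => z = x ∨ z ∈ linF u)).filter f := by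
    intro w
    rw [List.filter_filter, List.filter_filter]
    apply List.filter_congr
    intro z _
    by_cases hz : f z
    · simp [hz, mem_linF, List.count_filter]
    · simp [hz]
  rw [key, key, h x]

theorem linF_congr {u v : List ℕ} (h : ∀ z, u.count z = v.count z) : linF u = linF v := by
  ext z; rw [mem_linF, mem_linF, h]

theorem filter_swap (f : ℕ → Bool) (p q : List ℕ) {a b : ℕ} (h : ¬ (f a = true ∧ f b = true)) :
    (p ++ a :: b :: q).filter f = (p ++ b :: a :: q).filter f := by
  by_cases ha : f a <;> by_cases hb : f b <;> simp_all

/-! ### Critical swaps and sorting. -/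

/-- The tail sums of the exponents tell whether `x` reaches an earlier block and `y` a later one. A
letter confined to its block does not need the separators on its side, and deleting them yields the
words of (i), (ii) or (iii). If neither letter is confined, the given identity is itself the
interchange modulo σ₁ and σ₂. -/
theorem swap_critical (H : Setup S M) {x y : ℕ} (hxy : x ≠ y) {P Q : List ℕ} {T : Finset ℕ}
    (hTdef : linF (P ++ x :: y :: Q) = T)
    (hxP : x ∈ P) (hxQ : x ∉ Q) (hyQ : y ∈ Q) (hyP : y ∉ P)
    {A B V : List ℕ} (hAdef : A = P.filter (fun z => z = x ∨ z ∈ T))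
    (hBdef : B = Q.filter (fun z => z = y ∨ z ∈ T))
    (hV : SatL S (A ++ x :: y :: B) V) (hbb : BBL (A ++ x :: y :: B) V)
    (hne : (A ++ x :: y :: B).filter (fun z => z = x ∨ z = y) ≠ V.filter (fun z => z = x ∨ z = y)) :
    SatL M (P ++ x :: y :: Q) (P ++ y :: x :: Q) := by
  have hPx := List.count_pos_iff.2 hxP
  have hQy := List.count_pos_iff.2 hyQ
  have hx : x ∉ T := by
    rw [← hTdef, mem_linF, List.count_append, List.count_cons_self]; omega
  have hy : y ∉ T := by
    rw [← hTdef, mem_linF, List.count_append, List.count_cons, List.count_cons_self]; omega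
  have hc : ∀ z ∈ P ++ Q, z ∉ T → 1 < (P ++ x :: y :: Q).count z := by
    intro z hz hzT
    rw [← hTdef, mem_linF] at hzT
    have : 0 < (P ++ x :: y :: Q).count z := List.count_pos_iff.2 (by simp at hz ⊢; tauto)
    omega
  have hA : ∀ z ∈ A, z = x ∨ z ∈ T := by
    intro z hz; rw [hAdef] at hz; simpa using (List.mem_filter.1 hz).2
  have hB : ∀ z ∈ B, z = y ∨ z ∈ T := by
    intro z hz; rw [hBdef] at hz; simpa using (List.mem_filter.1 hz).2
  have hyA : y ∉ A := fun h => (hA y h).elim (fun e => hxy e.symm) hy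
  have hxB : x ∉ B := fun h => (hB x h).elim hxy hx
  have hAe : exps x T A.reverse = exps x T P.reverse := by
    rw [hAdef, ← List.filter_reverse, exps_filter _ (by simp)]
  have hBe : exps y T B = exps y T Q := by rw [hBdef, exps_filter _ (by simp)]
  have hAx : A.count x = P.count x := by rw [hAdef, List.count_filter (by simp)]
  have hBy : B.count y = Q.count y := by rw [hBdef, List.count_filter (by simp)]
  have hABT : ∀ z, z ∈ T → (A.count z = P.count z ∧ B.count z = Q.count z) := fun z hz => by
    rw [hAdef, hBdef, List.count_filter (by simp [hz]), List.count_filter (by simp [hz])]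
    exact ⟨rfl, rfl⟩
  have hT1 : ∀ z, z ∈ T → P.count z + Q.count z = 1 := by
    intro z hz
    have h1 : z ≠ x := fun e => hx (e ▸ hz)
    have h2 : z ≠ y := fun e => hy (e ▸ hz)
    rw [← hTdef, mem_linF] at hz
    simpa [Ne.symm h1, Ne.symm h2] using hz
  have hnd : (A.filter (· ∈ T) ++ B.filter (· ∈ T)).Nodup := by
    rw [List.nodup_iff_count_le_one]
    intro z
    by_cases hz : z ∈ T
    · rw [List.count_append, List.count_filter (by simpa using hz),
        List.count_filter (by simpa using hz), (hABT z hz).1, (hABT z hz).2, hT1 z hz]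
    · rw [List.count_eq_zero.2 (by simp [hz])]; omega
  have hlin : linF (A ++ x :: y :: B) = T := by
    ext z
    rw [mem_linF]
    by_cases hzx : z = x
    · subst hzx
      simp only [hx, iff_false]
      rw [List.count_append, List.count_cons_self]; omega
    by_cases hzy : z = y
    · subst hzy
      simp only [hy, iff_false]
      rw [List.count_append, List.count_cons, List.count_cons_self]; omega
    rw [List.count_append, List.count_cons_of_ne (Ne.symm hzx), List.count_cons_of_ne (Ne.symm hzy)]
    constructor
    · intro h
      have : z ∈ A ++ B := by rw [← List.count_pos_iff, List.count_append]; omega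
      rcases List.mem_append.1 this with h | h
      · exact (hA z h).resolve_left hzx
      · exact (hB z h).resolve_left hzy
    · intro hz
      rw [(hABT z hz).1, (hABT z hz).2, hT1 z hz]
  have hff : ∀ (f : ℕ → Bool), f x = true → f y = true → ∀ w : List ℕ,
      (w.filter f).filter (fun z => z = x ∨ z = y) = w.filter (fun z => z = x ∨ z = y) := by
    intro f hfx hfy w
    rw [List.filter_filter]
    apply List.filter_congr
    intro z _
    by_cases h1 : z = x
    · simp [h1, hfx]
    by_cases h2 : z = y
    · simp [h2, hfy]
    simp [h1, h2]
  suffices hs : ∃ α β, Sw S α β ∧ 0 < α.sum ∧ 0 < β.sum ∧ FitR Mᵐᵒᵖ T x α P.reverse ∧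
      FitR M T y β Q by
    obtain ⟨α, β, h1, h2, h3, h4, h5⟩ := hs
    exact swap_of_fit (H.sw _ _ h2 h3 h1) h4 h5 hyP hc
  have hPsum : 0 < (exps x T P.reverse).sum := by
    rw [sum_exps hx, List.count_reverse]; exact hPx
  have hQsum : 0 < (exps y T Q).sum := by rw [sum_exps hy]; exact hQy
  have hBx : B.filter (fun z => z = x ∨ z = y) = List.replicate (Q.count y) y := by
    rw [filter_eq_replicate (y := y), hBy]
    intro z hz
    have : z ≠ x := by rintro rfl; exact hxB hz
    simp [this]
  have hAy : A.filter (fun z => z = x ∨ z = y) = List.replicate (P.count x) x := by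
    rw [filter_eq_replicate (y := x), hAx]
    intro z hz
    have : z ≠ y := by rintro rfl; exact hyA hz
    simp [this]
  rcases Nat.eq_zero_or_pos (exps x T P.reverse).tail.sum with hP | hP <;>
    rcases Nat.eq_zero_or_pos (exps y T Q).tail.sum with hQ | hQ
  · obtain ⟨d, c, hd, hd2, hc, hc2, hsw⟩ := H.one (P.count x + 1) (Q.count y + 1) (by omega)
      (by omega) x y hxy (by
        intro hiso
        have h1 := hV.filter (fun z => z = x ∨ z = y)
        have e : (A ++ x :: y :: B).filter (fun z => z = x ∨ z = y)
            = List.replicate (P.count x + 1) x ++ List.replicate (Q.count y + 1) y := by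
          rw [List.filter_append, List.filter_cons_of_pos (by simp),
            List.filter_cons_of_pos (by simp), hAy, hBx, List.replicate_succ', List.replicate_succ]
          simp
        rw [e] at h1 hne
        exact hne (hiso _ h1).symm)
    refine ⟨_, _, hsw, by simp; omega, by simp; omega, ?_, ?_⟩
    · have := fitR_single H.sigM.op hx hP hd (by rw [List.count_reverse]; omega)
      rw [List.count_reverse] at this
      convert this using 2
      omega
    · have := fitR_single H.sigM hy hQ hc (by omega)
      convert this using 2
      omega
  · have hX : (A ++ x :: y :: B).filter (fun z => z = x ∨ z = y ∨ z ∈ B)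
        = List.replicate (P.count x + 1) x ++ y :: B := by
      rw [List.filter_append, List.filter_cons_of_pos (by simp),
        List.filter_cons_of_pos (by simp), (List.filter_eq_self (l := B)).2 (by simp +contextual),
        filter_eq_replicate (y := x) (l := A), hAx, List.replicate_succ']
      · simp
      · intro z hz
        have h1 : z ≠ y := by rintro rfl; exact hyA hz
        simp only [h1, false_or, decide_eq_true_eq, or_iff_left_iff_imp]
        intro hzB
        by_contra hzx
        have hzT := (hA z hz).resolve_left hzx
        have := hT1 z hzT
        rw [← (hABT z hzT).1, ← (hABT z hzT).2] at this
        have h1 := List.count_pos_iff.2 hz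
        have h2 := List.count_pos_iff.2 hzB
        omega
    obtain ⟨p, hp, hp2, hsw⟩ := H.three x y T B (P.count x + 1) hxy hy hB
      (List.nodup_append.1 hnd).2.1 (List.count_pos_iff.1 (by omega)) hxB
      ⟨V.filter (fun z => z = x ∨ z = y ∨ z ∈ B), by rw [← hX]; exact hV.filter _,
        by rw [← hX]; exact hbb.filter _, by
          rw [← hX, hff _ (by simp) (by simp), hff _ (by simp) (by simp)]; exact hne⟩
    rw [hBe] at hsw
    refine ⟨_, _, hsw, by simp; omega, hQsum, ?_, fitR_multi H.sigM hy hQ⟩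
    -- With `k = P.count x + 1`, the choice `c = k - p` leaves `p - 1` letters beside the pair,
    -- matching the exponents `[p - 1, k - p]` of (iii).
    have := fitR_single H.sigM.op hx hP (c := P.count x + 1 - p) (by omega)
      (by rw [List.count_reverse]; omega)
    rw [List.count_reverse] at this
    convert this using 2
    omega
  · have hX : (A ++ x :: y :: B).filter (fun z => z = x ∨ z = y ∨ z ∈ A)
        = A ++ x :: List.replicate (Q.count y + 1) y := by
      rw [List.filter_append, List.filter_cons_of_pos (by simp),
        List.filter_cons_of_pos (by simp), (List.filter_eq_self (l := A)).2 (by simp +contextual),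
        filter_eq_replicate (y := y) (l := B), hBy, List.replicate_succ]
      · intro z hz
        have h1 : z ≠ x := by rintro rfl; exact hxB hz
        simp only [h1, false_or, decide_eq_true_eq, or_iff_left_iff_imp]
        intro hzA
        by_contra hzy
        have hzT := (hB z hz).resolve_left hzy
        have := hT1 z hzT
        rw [← (hABT z hzT).1, ← (hABT z hzT).2] at this
        have h1 := List.count_pos_iff.2 hz
        have h2 := List.count_pos_iff.2 hzA
        omega
    obtain ⟨c, hc, hc2, hsw⟩ := H.two x y T A (Q.count y + 1) hxy hx hA
      (List.nodup_append.1 hnd).1 (List.count_pos_iff.1 (by omega)) hyA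
      ⟨V.filter (fun z => z = x ∨ z = y ∨ z ∈ A), by rw [← hX]; exact hV.filter _,
        by rw [← hX]; exact hbb.filter _, by
          rw [← hX, hff _ (by simp) (by simp), hff _ (by simp) (by simp)]; exact hne⟩
    rw [hAe] at hsw
    refine ⟨_, _, hsw, hPsum, by simp; omega, fitR_multi H.sigM.op hx hP, ?_⟩
    have := fitR_single H.sigM hy hQ (c := Q.count y + 1 - c) (by omega) (by omega)
    convert this using 2
    omega
  · have h1 := satL_swap_of_unstable H.sigS hxy hx hy hA hB hlin (by rwa [hAe]) (by rwa [hBe])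
      hbb hne
    have h2 := sw_of_satL hxy hx hy hA hB hnd (hV.trans h1)
    rw [hAe, hBe] at h2
    exact ⟨_, _, h2, hPsum, hQsum, fitR_multi H.sigM.op hx hP, fitR_multi H.sigM hy hQ⟩

/-- The sides order `z` and `b` differently at this place. A linear letter among them would be seen
in a block-balanced projection, so both are non-linear and block-balance survives the swap. -/
theorem swap_step (H : Setup S M) {p w q r : List ℕ} {z b : ℕ} (hbw : b ∉ w) (hzb : z ≠ b)
    (h : SatL S (p ++ w ++ z :: b :: q) (p ++ b :: r))
    (hbb : BBL (p ++ w ++ z :: b :: q) (p ++ b :: r)) :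
    SatL M (p ++ w ++ z :: b :: q) (p ++ w ++ b :: z :: q) ∧
      BBL (p ++ w ++ b :: z :: q) (p ++ b :: r) := by
  set T := linF (p ++ w ++ z :: b :: q) with hT
  have hhead : ∀ f : ℕ → Bool, f z = true → f b = true →
      (p ++ w ++ z :: b :: q).filter f ≠ (p ++ b :: r).filter f := by
    intro f hz hb e
    rw [List.append_assoc, List.filter_append, List.filter_append (l₁ := p),
      List.append_cancel_left_eq, List.filter_append, List.filter_cons_of_pos hz,
      List.filter_cons_of_pos hb, List.filter_cons_of_pos hb] at e
    cases hw : w.filter f with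
    | nil => rw [hw] at e; simp at e; exact hzb e.1
    | cons a l =>
      rw [hw] at e
      simp at e
      have : a ∈ w.filter f := by rw [hw]; simp
      exact hbw (e.1 ▸ (List.mem_filter.1 this).1)
  have hbT : b ∉ T := fun hb => hhead _ (by simp) (decide_eq_true (.inr hb)) (hbb z)
  have hzT : z ∉ T := fun hz => hhead _ (decide_eq_true (.inr hz)) (by simp) (hbb b)
  have hcount : ∀ a, (p ++ w ++ z :: b :: q).count a = (p ++ w ++ b :: z :: q).count a := by
    intro a
    simp only [List.count_append, List.count_cons]; omega
  have hswap : ∀ x, ¬ (decide (z = x ∨ z ∈ T) = true ∧ decide (b = x ∨ b ∈ T) = true) := by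
    intro x
    simp only [hzT, hbT, or_false, decide_eq_true_eq]
    rintro ⟨rfl, rfl⟩
    exact hzb rfl
  have hbbs : BBL (p ++ w ++ b :: z :: q) (p ++ b :: r) := by
    intro x
    rw [← linF_congr hcount, ← hbb x]
    exact (filter_swap _ _ _ (hswap x)).symm
  refine ⟨?_, hbbs⟩
  have hz2 : z ∈ p ++ w ∨ z ∈ q := by
    by_contra hn
    push Not at hn
    apply hzT
    rw [hT, mem_linF, List.count_append, List.count_eq_zero.2 hn.1, List.count_cons_self,
      List.count_cons_of_ne (Ne.symm hzb), List.count_eq_zero.2 hn.2]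
  have hb2 : b ∈ p ++ w ∨ b ∈ q := by
    by_contra hn
    push Not at hn
    apply hbT
    rw [hT, mem_linF, List.count_append, List.count_eq_zero.2 hn.1, List.count_cons_of_ne hzb,
      List.count_cons_self, List.count_eq_zero.2 hn.2]
  by_cases hq : z ∈ q ∧ b ∈ q
  · exact H.sigM.swap_of_mem_right _ hq.1 hq.2
  by_cases hp : z ∈ p ++ w ∧ b ∈ p ++ w
  · exact H.sigM.swap_of_mem_left _ hp.1 hp.2
  have hcv : ∀ a, (p ++ b :: r).count a = (p ++ w ++ z :: b :: q).count a := fun a =>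
    (count_eq_of_filter (hbb a)).symm
  have filters : ∀ x y : ℕ, x ∉ T → y ∉ T → ∀ l : List ℕ, y ∉ l →
      l.filter (fun a => a = x ∨ a = y ∨ a ∈ T) = l.filter (fun a => a = x ∨ a ∈ T) := by
    intro x y _ _ l hl
    apply List.filter_congr
    intro a ha
    have : a ≠ y := by rintro rfl; exact hl ha
    simp [this]
  by_cases hbq : b ∈ q
  · have hzq : z ∉ q := fun h => hq ⟨h, hbq⟩
    have hzP := hz2.resolve_right hzq
    have hbP : b ∉ p ++ w := fun h => hp ⟨hzP, h⟩
    set f : ℕ → Bool := fun a => a = z ∨ a = b ∨ a ∈ T with hf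
    have e : (p ++ w ++ z :: b :: q).filter f = (p ++ w).filter (fun a => a = z ∨ a ∈ T) ++
        z :: b :: q.filter (fun a => a = b ∨ a ∈ T) := by
      rw [List.filter_append, List.filter_cons_of_pos (by simp [f]),
        List.filter_cons_of_pos (by simp [f]), filters z b hzT hbT _ hbP]
      have := filters b z hbT hzT q hzq
      congr 3
      rw [← this]
      apply List.filter_congr
      intro a _
      rw [hf, decide_eq_decide]; tauto
    have ff : ∀ l : List ℕ, (l.filter f).filter (fun a => a = z ∨ a = b)
        = l.filter (fun a => a = z ∨ a = b) := by
      intro l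
      rw [List.filter_filter]
      apply List.filter_congr
      intro a _
      rw [hf, ← Bool.decide_and, decide_eq_decide]; tauto
    refine swap_critical H hzb rfl hzP hzq hbq hbP rfl rfl (V := (p ++ b :: r).filter f) ?_ ?_ ?_
    · rw [← hT, ← e]; exact h.filter f
    · rw [← hT, ← e]; exact hbb.filter f
    · rw [← hT, ← e, ff, ff]
      exact hhead _ (by simp) (by simp)
  · have hbP := hb2.resolve_right hbq
    have hbp : b ∈ p := (List.mem_append.1 hbP).resolve_right hbw
    have hzP : z ∉ p ++ w := fun h => hp ⟨h, hbP⟩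
    have hzq := hz2.resolve_left hzP
    have hbr : b ∉ r := by
      have h1 := hcv b
      have h2 := List.count_eq_zero.2 hbq
      have h3 := List.count_eq_zero.2 hbw
      rw [← List.count_eq_zero]
      simp only [List.count_append, List.count_cons, beq_self_eq_true, if_true] at h1
      rw [if_neg (by simpa using hzb)] at h1
      omega
    set f : ℕ → Bool := fun a => a = b ∨ a = z ∨ a ∈ T with hf
    have e : ∀ c d : ℕ, (p ++ w ++ c :: d :: q).filter f = (p ++ w).filter (fun a => a = b ∨ a ∈ T)
        ++ [c, d].filter f ++ q.filter (fun a => a = z ∨ a ∈ T) := by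
      intro c d
      have e' : p ++ w ++ c :: d :: q = p ++ w ++ [c, d] ++ q := by simp
      rw [e', List.filter_append, List.filter_append, filters b z hbT hzT _ hzP]
      have := filters z b hzT hbT q hbq
      congr 1
      rw [← this]
      apply List.filter_congr
      intro a _
      rw [hf, decide_eq_decide]; tauto
    have fbz : [b, z].filter f = [b, z] := by simp [f]
    have fzb : [z, b].filter f = [z, b] := by simp [f]
    -- Here the pair is a first `z` followed by a last `b`, so the critical lemma is applied to the
    -- swapped word. In `v` as well every `b` precedes every `z`; hence `v` and the swapped word
    -- agree on `b`, `z` and `T`.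
    have hveq : (p ++ b :: r).filter f = (p ++ w ++ b :: z :: q).filter f := by
      have hfT : ∀ l : List ℕ, ∀ c ∈ l.filter f, c = b ∨ c = z ∨ c ∈ T := fun l c hc => by
        simpa [f] using (List.mem_filter.1 hc).2
      have hff : ∀ c d, (c = b ∨ c = z ∨ c ∈ T) → (d = b ∨ d = z ∨ d ∈ T) → ∀ l : List ℕ,
          (l.filter f).filter (fun a => a = c ∨ a = d) = l.filter (fun a => a = c ∨ a = d) := by
        intro c d hc hd l
        rw [List.filter_filter]
        apply List.filter_congr
        intro a _
        rw [hf, ← Bool.decide_and, decide_eq_decide]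
        constructor
        · exact And.left
        · rintro (rfl | rfl)
          · exact ⟨.inl rfl, hc⟩
          · exact ⟨.inr rfl, hd⟩
      have hbal : ∀ x c d : ℕ, (c = x ∨ c ∈ T) → (d = x ∨ d ∈ T) →
          (p ++ b :: r).filter (fun a => a = c ∨ a = d)
            = (p ++ w ++ b :: z :: q).filter (fun a => a = c ∨ a = d) := by
        intro x c d hc hd
        have h1 := hbbs x
        rw [← linF_congr hcount, ← hT] at h1
        have gg : ∀ l : List ℕ, (l.filter (fun a => a = x ∨ a ∈ T)).filter
            (fun a => a = c ∨ a = d) = l.filter (fun a => a = c ∨ a = d) := by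
          intro l
          rw [List.filter_filter]
          apply List.filter_congr
          intro a _
          rw [← Bool.decide_and, decide_eq_decide]
          constructor
          · exact And.left
          · rintro (rfl | rfl)
            · exact ⟨.inl rfl, hc⟩
            · exact ⟨.inr rfl, hd⟩
        rw [← gg, ← h1, gg]
      have hpair : (p ++ b :: r).filter (fun a => a = b ∨ a = z)
            = (p ++ w ++ b :: z :: q).filter (fun a => a = b ∨ a = z) := by
        have e1 : p ++ b :: r = (p ++ [b]) ++ r := by simp
        have e2 : p ++ w ++ b :: z :: q = (p ++ w ++ [b]) ++ (z :: q) := by simp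
        have n1 : z ∉ p ++ [b] := by simp at hzP ⊢; exact ⟨hzP.1, hzb⟩
        have n2 : z ∉ p ++ w ++ [b] := by simp at hzP ⊢; exact ⟨hzP.1, hzP.2, hzb⟩
        have n3 : b ∉ z :: q := by simp; exact ⟨Ne.symm hzb, hbq⟩
        have c1 := (hcv b).trans (hcount b)
        have c2 := (hcv z).trans (hcount z)
        rw [e1, e2] at c1 c2 ⊢
        rw [replicate_of_filter_pair n1 hbr, replicate_of_filter_pair n2 n3]
        rw [List.count_append (l₂ := r), List.count_append (l₂ := z :: q),
          List.count_eq_zero.2 hbr, List.count_eq_zero.2 n3] at c1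
        rw [List.count_append (l₂ := r), List.count_append (l₂ := z :: q),
          List.count_eq_zero.2 n1, List.count_eq_zero.2 n2] at c2
        congr 2 <;> omega
      apply eq_of_filter_pair
      intro c hc d hd
      have hc : c = b ∨ c = z ∨ c ∈ T := (List.mem_append.1 hc).elim (hfT _ c) (hfT _ c)
      have hd : d = b ∨ d = z ∨ d ∈ T := (List.mem_append.1 hd).elim (hfT _ d) (hfT _ d)
      rw [hff c d hc hd, hff c d hc hd]
      by_cases hcT : c ∈ T
      · exact hbal d c d (.inr hcT) (.inl rfl)
      by_cases hdT : d ∈ T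
      · exact hbal c c d (.inl rfl) (.inr hdT)
      by_cases hcd : c = d
      · exact hbal c c d (.inl rfl) (.inl hcd.symm)
      simp only [hcT, hdT, or_false] at hc hd
      rcases hc with rfl | rfl <;> rcases hd with rfl | rfl
      · exact absurd rfl hcd
      · exact hpair
      · simpa only [or_comm] using hpair
      · exact absurd rfl hcd
    have hsat := h.filter f
    rw [hveq, e, e, fbz, fzb] at hsat
    have hTs : linF (p ++ w ++ b :: z :: q) = T := (linF_congr hcount).symm
    refine (swap_critical H (Ne.symm hzb) hTs hbP hbq hzq hzP rfl rfl
      (V := (p ++ w ++ z :: b :: q).filter f) ?_ ?_ ?_).symm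
    · rw [e, fzb]; simpa using hsat.symm
    · have e1 := e b z
      rw [fbz] at e1
      have e2 : (p ++ w).filter (fun a => a = b ∨ a ∈ T) ++ b :: z :: q.filter
        (fun a => a = z ∨ a ∈ T) = (p ++ w ++ b :: z :: q).filter f := by rw [e1]; simp
      rw [e2]
      refine BBL.filter ?_ f
      intro x
      rw [hTs]
      exact (filter_swap _ _ _ (hswap x)).symm
    · rw [e, fzb]
      intro heq
      simp at heq
      exact hzb heq.1.symm

/-- Block-balanced identities of `S` hold in `M`. -/
theorem satL_of_bbl (H : Setup S M) (v : List ℕ) : ∀ p u : List ℕ, SatL S (p ++ u) (p ++ v) →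
    BBL (p ++ u) (p ++ v) → SatL M (p ++ u) (p ++ v) := by
  induction v with
  | nil =>
    intro p u _ hbb
    have : u = [] := by
      rw [List.eq_nil_iff_forall_not_mem]
      intro z hz
      have h1 := count_eq_of_filter (hbb z)
      have h2 := List.count_pos_iff.2 hz
      simp only [List.count_append, List.count_nil] at h1
      omega
    rw [this]; exact SatL.refl _
  | cons b r ih =>
    intro p u h hbb
    have hbu : b ∈ u := by
      have h1 := count_eq_of_filter (hbb b)
      simp only [List.count_append, List.count_cons_self] at h1
      exact List.count_pos_iff.1 (by omega)
    obtain ⟨w, q, rfl, hbw⟩ := List.eq_append_cons_of_mem hbu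
    -- The first remaining `b` is carried left, letter by letter, to the place it has in `v`.
    have bubble : ∀ (w q : List ℕ), b ∉ w → SatL S (p ++ (w ++ b :: q)) (p ++ b :: r) →
        BBL (p ++ (w ++ b :: q)) (p ++ b :: r) →
        SatL M (p ++ (w ++ b :: q)) (p ++ b :: (w ++ q)) ∧ BBL (p ++ b :: (w ++ q)) (p ++ b :: r) := by
      intro w
      induction w using List.reverseRecOn with
      | nil => intro q _ _ hbb; exact ⟨SatL.refl _, hbb⟩
      | append_singleton w z ihw =>
        intro q hbw h hbb
        simp only [List.mem_append, List.mem_singleton, not_or] at hbw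
        obtain ⟨s1, s2⟩ := swap_step H (p := p) (w := w) (z := z) (b := b) (q := q) (r := r)
          hbw.1 (Ne.symm hbw.2) (by simpa using h) (by simpa using hbb)
        obtain ⟨t1, t2⟩ := ihw (z :: q) hbw.1
          (by simpa using (H.sat _ _ s1).symm.trans (by simpa using h)) (by simpa using s2)
        refine ⟨?_, by simpa using t2⟩
        have s1' : SatL M (p ++ (w ++ [z] ++ b :: q)) (p ++ (w ++ b :: z :: q)) := by
          simpa using s1
        simpa using s1'.trans t1
    obtain ⟨h1, h2⟩ := bubble w q hbw h hbb
    refine h1.trans ?_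
    have := ih (p ++ [b]) (w ++ q) (by simpa using (H.sat _ _ h1).symm.trans h) (by simpa using h2)
    simpa using this

/-- Every identity of `S` holds in `M`. -/
theorem Setup.satL (H : Setup S M) {u v : List ℕ} (h : SatL S u v) : SatL M u v := by
  obtain ⟨u', h1, h2⟩ := exists_blockBalanced H h
  exact h1.trans (by simpa using satL_of_bbl H v [] u' ((H.sat _ _ h1).symm.trans h) h2)

/-! ### Translating the hypotheses into exponent sequences. -/

theorem toList_ltr_pow (x k : ℕ) : FreeMonoid.toList (ltr x ^ k) = List.replicate k x := by
  induction k with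
  | zero => rfl
  | succ k ih => rw [pow_succ', FreeMonoid.toList_mul, ih]; rfl

theorem toList_ne_nil {u : Word} : FreeMonoid.toList u ≠ [] ↔ u ≠ 1 :=
  (FreeMonoid.toList.injective.ne_iff (x := u) (y := 1))

theorem mem_eqTheory {u v : Word} : (u, v) ∈ EqTheory S ↔ FreeMonoid.toList u ≠ [] ∧
    FreeMonoid.toList v ≠ [] ∧ SatL S (FreeMonoid.toList u) (FreeMonoid.toList v) := by
  rw [toList_ne_nil, toList_ne_nil, ← sat_iff_satL]
  rfl

theorem isoL_pair (h : ∀ x y : ℕ, x ≠ y → IsIsoterm S (ltr x * ltr y)) (x y : ℕ) (hxy : x ≠ y) :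
    IsoL S [x, y] := by
  have key : ∀ v : List ℕ, v ≠ [] → SatL S [x, y] v → v = [x, y] := by
    intro v hv hs
    have := (h x y hxy).2 (FreeMonoid.ofList v) (mem_eqTheory.2 ⟨by simp, hv, hs⟩)
    exact (congrArg FreeMonoid.toList this).symm
  intro v hs
  by_cases hv : v = []
  · subst hv
    -- Renaming in `xy ≈ 1` gives `yx ≈ 1`, hence `xy ≈ yx`, against the isoterm.
    have h1 := hs.subst (fun z => if z = x then [y] else [x])
    have h2 : SatL S [y, x] [] := by simpa [Ne.symm hxy] using h1
    have := key [y, x] (by simp) (hs.trans h2.symm)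
    simp at this
    exact absurd this.2 hxy
  · exact key v hv hs

theorem isoL_of_isIsoterm (iso : ∀ x y : ℕ, x ≠ y → IsoL S [x, y]) {u : Word}
    (h : IsIsoterm S u) : IsoL S (FreeMonoid.toList u) := by
  intro v hs
  have hu := toList_ne_nil.2 h.1
  have hv : v ≠ [] := by
    rintro rfl
    exact hu (nil_of_satL iso hs)
  have := h.2 (FreeMonoid.ofList v) (mem_eqTheory.2 ⟨hu, hv, hs⟩)
  exact (congrArg FreeMonoid.toList this).symm

theorem toList_restr (u : Word) (X : Set ℕ) (f : ℕ → Bool) (hf : ∀ z, f z = true ↔ z ∈ X) :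
    FreeMonoid.toList (restr u X) = (FreeMonoid.toList u).filter f := by
  classical
  unfold restr
  rw [FreeMonoid.toList_ofList]
  apply List.filter_congr
  intro z _
  rw [Bool.eq_iff_iff, hf, decide_eq_true_eq]

theorem toList_restr_lin (x : ℕ) (u w : Word) : FreeMonoid.toList (restr w ({x} ∪ lin u))
    = (FreeMonoid.toList w).filter (fun z => z = x ∨ z ∈ linF (FreeMonoid.toList u)) :=
  toList_restr _ _ _ (fun z => by simp [mem_linF, lin, occ])

theorem toList_restr_pair (x y : ℕ) (w : Word) : FreeMonoid.toList (restr w {x, y})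
    = (FreeMonoid.toList w).filter (fun z => z = x ∨ z = y) :=
  toList_restr _ _ _ (fun z => by simp)

theorem blockBalanced_iff {u v : Word} :
    BlockBalanced (u, v) ↔ BBL (FreeMonoid.toList u) (FreeMonoid.toList v) := by
  refine forall_congr' fun x => ?_
  rw [← FreeMonoid.toList.injective.eq_iff, toList_restr_lin, toList_restr_lin]

theorem bUnstable_of (iso : ∀ x y : ℕ, x ≠ y → IsoL S [x, y]) {x y : ℕ} {u : Word} (hu : u ≠ 1)
    (h : ∃ v, SatL S (FreeMonoid.toList u) v ∧ BBL (FreeMonoid.toList u) v ∧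
      (FreeMonoid.toList u).filter (fun z => z = x ∨ z = y) ≠ v.filter (fun z => z = x ∨ z = y)) :
    BUnstable S x y u := by
  obtain ⟨v, h1, h2, h3⟩ := h
  rw [← toList_ne_nil] at hu
  refine ⟨FreeMonoid.ofList v, mem_eqTheory.2 ⟨hu, ?_, h1⟩, blockBalanced_iff.2 h2, ?_⟩
  · rintro rfl
    exact hu (nil_of_satL iso h1)
  · rw [← FreeMonoid.toList.injective.ne_iff, toList_restr_pair, toList_restr_pair]
    exact h3

theorem exps_replicate {y : ℕ} {T : Finset ℕ} (hy : y ∉ T) (b : ℕ) :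
    exps y T (List.replicate b y) = [b] := by
  induction b with
  | zero => rfl
  | succ b ih => simp [List.replicate_succ, exps, hy, ih, bump]

theorem exps_two_blocks {y t : ℕ} {T : Finset ℕ} (hy : y ∉ T) (ht : t ∈ T) (a b : ℕ) :
    exps y T (List.replicate a y ++ t :: List.replicate b y) = [a, b] := by
  induction a with
  | zero => simp [exps, ht, exps_replicate hy]
  | succ a ih => simp [List.replicate_succ, exps, hy, ih, bump]

theorem exps_congr {y : ℕ} {T T' : Finset ℕ} {Q : List ℕ} (h : ∀ z ∈ Q, z ∈ T ↔ z ∈ T') :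
    exps y T Q = exps y T' Q := by
  induction Q with
  | nil => rfl
  | cons z Q ih =>
    simp only [exps, h z (by simp), ih (fun a ha => h a (by simp [ha]))]

/-- Hypothesis (i) exchanges two whole powers. All swaps involved except that of the last `x` with
the first `y` are instances of σ₁ and σ₂. -/
theorem sw_of_two_blocks (hS : Sig S) {x y t₁ t₂ m n d c : ℕ} (hn : [x, y, t₁, t₂].Nodup)
    (hd : 0 < d) (hdm : d < m) (hc : 0 < c) (hcn : c < n)
    (h : SatL S (List.replicate d x ++ t₁ :: List.replicate (m - d) x ++
        List.replicate (n - c) y ++ t₂ :: List.replicate c y)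
      (List.replicate d x ++ t₁ :: List.replicate (n - c) y ++
        List.replicate (m - d) x ++ t₂ :: List.replicate c y)) :
    Sw S [m - d - 1, d] [n - c - 1, c] := by
  obtain ⟨a, ha⟩ : ∃ a, m - d = a + 1 := ⟨m - d - 1, by omega⟩
  obtain ⟨b, hb⟩ : ∃ b, n - c = b + 1 := ⟨n - c - 1, by omega⟩
  simp only [List.nodup_cons, List.mem_cons, List.not_mem_nil, or_false, not_or] at hn
  obtain ⟨⟨hxy, hx1, hx2⟩, ⟨hy1, hy2⟩, h12, -⟩ := hn
  rw [ha, hb] at h ⊢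
  simp only [Nat.add_sub_cancel]
  have hx : x ∉ ({t₁, t₂} : Finset ℕ) := by simp [hx1, hx2]
  have hy : y ∉ ({t₁, t₂} : Finset ℕ) := by simp [hy1, hy2]
  have eA : exps x {t₁, t₂} (List.replicate d x ++ t₁ :: List.replicate a x).reverse = [a, d] := by
    rw [← exps_two_blocks hx (t := t₁) (by simp) a d]
    simp
  have eB : exps y {t₁, t₂} (List.replicate b y ++ t₂ :: List.replicate c y) = [b, c] :=
    exps_two_blocks hy (by simp) b c
  rw [← eA, ← eB]
  refine sw_of_satL hxy hx hy (by intro z hz; simp at hz ⊢; tauto)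
    (by intro z hz; simp at hz ⊢; tauto) ?_ ?_
  · simp [hx1, hx2, hy1, hy2, h12]
  · have s1 := hS.perm_of_mem_right (q := x :: t₂ :: List.replicate c y)
      (l := List.replicate (b + 1) y ++ List.replicate a x)
      (l' := List.replicate a x ++ List.replicate (b + 1) y) List.perm_append_comm
      (by
        intro z hz
        simp at hz ⊢
        rcases hz with rfl | hz
        · right; right; omega
        · exact .inl hz.2) (List.replicate d x ++ [t₁])
    have s2 := hS.perm_of_mem_left (p := List.replicate d x ++ t₁ :: List.replicate a x ++ [y])
      (l := List.replicate b y ++ [x]) (l' := [x] ++ List.replicate b y) List.perm_append_comm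
      (by
        intro z hz
        simp at hz ⊢
        rcases hz with hz | rfl
        · simp [hz.2]
        · left; omega) (t₂ :: List.replicate c y)
    have h1 : SatL S (List.replicate d x ++ t₁ :: List.replicate a x ++
        x :: y :: (List.replicate b y ++ t₂ :: List.replicate c y))
        (List.replicate d x ++ [t₁] ++ (List.replicate (b + 1) y ++ List.replicate a x) ++
          x :: t₂ :: List.replicate c y) := by
      have e1 : List.replicate (a + 1) x = List.replicate a x ++ [x] := List.replicate_succ'
      rw [e1, List.replicate_succ (n := b)] at h
      rw [List.replicate_succ (n := b)]
      simpa using h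
    have h2 : SatL S (List.replicate d x ++ [t₁] ++ (List.replicate a x ++
        List.replicate (b + 1) y) ++ x :: t₂ :: List.replicate c y)
        (List.replicate d x ++ t₁ :: List.replicate a x ++
        y :: x :: (List.replicate b y ++ t₂ :: List.replicate c y)) := by
      rw [List.replicate_succ (n := b)]
      simpa using s2
    exact (h1.trans s1).trans h2

theorem exists_fresh (A : List ℕ) : ∃ t, t ∉ A := by
  obtain ⟨t, ht⟩ := Infinite.exists_notMem_finset A.toFinset
  exact ⟨t, by simpa using ht⟩

theorem almostLinear_of {x : ℕ} {T : Finset ℕ} {A : List ℕ} (hA : ∀ z ∈ A, z = x ∨ z ∈ T)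
    (hn : (A.filter (· ∈ T)).Nodup) : AlmostLinear (FreeMonoid.ofList A) := by
  have : ∀ z ∈ non (FreeMonoid.ofList A), z = x := by
    intro z hz
    by_contra hzx
    have hz : 1 < A.count z := hz
    have hzA : z ∈ A := List.count_pos_iff.1 (by omega)
    have hzT := (hA z hzA).resolve_left hzx
    have := List.nodup_iff_count_le_one.1 hn z
    rw [List.count_filter (by simpa using hzT)] at this
    omega
  intro z hz w hw
  rw [this z hz, this w hw]

theorem sw_of_hyp_one (hS : Sig S) (iso : ∀ x y : ℕ, x ≠ y → IsoL S [x, y])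
    (hi : ∀ x y t₁ t₂ : ℕ, [x, y, t₁, t₂].Nodup → ∀ m n : ℕ, 1 < m → 1 < n →
      ¬ IsIsoterm S (ltr x ^ m * ltr y ^ n) →
      ∃ d c : ℕ, 0 < d ∧ d < m ∧ 0 < c ∧ c < n ∧
        Sat S (ltr x ^ d * ltr t₁ * ltr x ^ (m - d) * ltr y ^ (n - c) * ltr t₂ * ltr y ^ c)
          (ltr x ^ d * ltr t₁ * ltr y ^ (n - c) * ltr x ^ (m - d) * ltr t₂ * ltr y ^ c))
    (m n : ℕ) (hm : 1 < m) (hn : 1 < n) (x y : ℕ) (hxy : x ≠ y)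
    (h : ¬ IsoL S (List.replicate m x ++ List.replicate n y)) :
    ∃ d c, 0 < d ∧ d < m ∧ 0 < c ∧ c < n ∧ Sw S [m - d - 1, d] [n - c - 1, c] := by
  obtain ⟨t₁, h1⟩ := exists_fresh [x, y]
  obtain ⟨t₂, h2⟩ := exists_fresh [x, y, t₁]
  have hnd : [x, y, t₁, t₂].Nodup := by
    simp at h1 h2 ⊢
    exact ⟨⟨hxy, Ne.symm h1.1, Ne.symm h2.1⟩, ⟨Ne.symm h1.2, Ne.symm h2.2.1⟩, Ne.symm h2.2.2⟩
  obtain ⟨d, c, hd, hd2, hc, hc2, hs⟩ := hi x y t₁ t₂ hnd m n hm hn (fun hiso => h (by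
    have := isoL_of_isIsoterm iso hiso
    rwa [FreeMonoid.toList_mul, toList_ltr_pow, toList_ltr_pow] at this))
  refine ⟨d, c, hd, hd2, hc, hc2, sw_of_two_blocks hS hnd hd hd2 hc hc2 ?_⟩
  rw [sat_iff_satL] at hs
  simpa [FreeMonoid.toList_mul, toList_ltr_pow] using hs

theorem sw_of_hyp_two (iso : ∀ x y : ℕ, x ≠ y → IsoL S [x, y])
    (hii : ∀ (x y t : ℕ) (A : Word) (k : ℕ), [x, y, t].Nodup →
      AlmostLinear (A * ltr x) → 0 < occ A x → occ A y = 0 → occ A t = 0 →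
      BUnstable S x y (A * ltr x * ltr y ^ k) →
      ∃ c : ℕ, 0 < c ∧ c < k ∧
        Sat S (A * ltr x * ltr y ^ c * ltr t * ltr y ^ (k - c))
          (A * ltr y * ltr x * ltr y ^ (c - 1) * ltr t * ltr y ^ (k - c)))
    (x y : ℕ) (T : Finset ℕ) (A : List ℕ) (k : ℕ) (hxy : x ≠ y) (hx : x ∉ T)
    (hA : ∀ z ∈ A, z = x ∨ z ∈ T) (hn : (A.filter (· ∈ T)).Nodup) (hxA : x ∈ A) (hyA : y ∉ A)
    (hV : ∃ v, SatL S (A ++ x :: List.replicate k y) v ∧ BBL (A ++ x :: List.replicate k y) v ∧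
      (A ++ x :: List.replicate k y).filter (fun z => z = x ∨ z = y)
        ≠ v.filter (fun z => z = x ∨ z = y)) :
    ∃ c, 0 < c ∧ c < k ∧ Sw S (exps x T A.reverse) [c - 1, k - c] := by
  obtain ⟨t, ht⟩ := exists_fresh (x :: y :: A)
  simp only [List.mem_cons, not_or] at ht
  obtain ⟨htx, hty, htA⟩ := ht
  have hAx : ∀ z ∈ A ++ [x], z = x ∨ z ∈ T := by
    intro z hz
    rcases List.mem_append.1 hz with hz | hz
    · exact hA z hz
    · exact .inl (by simpa using hz)
  obtain ⟨c, hc, hck, hs⟩ := hii x y t (FreeMonoid.ofList A) k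
    (by simp; exact ⟨⟨hxy, Ne.symm htx⟩, Ne.symm hty⟩)
    (almostLinear_of (A := A ++ [x]) hAx (by simpa [List.filter_append, hx] using hn))
    (List.count_pos_iff.2 hxA) (List.count_eq_zero.2 hyA) (List.count_eq_zero.2 htA)
    (bUnstable_of iso (by
        rw [← toList_ne_nil]; simp [FreeMonoid.toList_mul])
      (by simpa [FreeMonoid.toList_mul, toList_ltr_pow] using hV))
  refine ⟨c, hc, hck, ?_⟩
  rw [sat_iff_satL] at hs
  obtain ⟨c, rfl⟩ : ∃ b, c = b + 1 := ⟨c - 1, by omega⟩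
  simp only [Nat.add_sub_cancel] at hs ⊢
  -- `T` may contain `y`, so only its letters occurring in `A` are kept; the fresh `t` separates the
  -- powers of `y`.
  set T' : Finset ℕ := insert t (T.filter (· ∈ A)) with hT'
  have hx' : x ∉ T' := by simp [T', hx, Ne.symm htx]
  have hy' : y ∉ T' := by simp [T', hyA, Ne.symm hty]
  have hAT : ∀ z ∈ A, z ∈ T ↔ z ∈ T' := by
    intro z hz
    have : z ≠ t := by rintro rfl; exact htA hz
    simp [T', hz, this]
  have e1 : exps x T A.reverse = exps x T' A.reverse :=
    exps_congr (fun z hz => hAT z (by simpa using hz))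
  have e2 := exps_two_blocks hy' (t := t) (by simp [T']) c (k - (c + 1))
  rw [e1, ← e2]
  refine sw_of_satL hxy hx' hy' (fun z hz => ?_) (fun z hz => ?_) ?_ ?_
  · rw [← hAT z hz]; exact hA z hz
  · simp at hz
    rcases hz with hz | rfl | hz
    · exact .inl hz.2
    · right; simp [T']
    · exact .inl hz.2
  · have f1 : A.filter (· ∈ T') = A.filter (· ∈ T) :=
      List.filter_congr (fun z hz => by rw [decide_eq_decide]; exact (hAT z hz).symm)
    have f2 : (List.replicate c y ++ t :: List.replicate (k - (c + 1)) y).filter (· ∈ T') = [t] := by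
      rw [List.filter_append, List.filter_cons_of_pos (by simp [T'])]
      simp [hy']
    rw [f1, f2, List.nodup_append]
    refine ⟨hn, by simp, ?_⟩
    intro a ha b hb
    simp at hb
    rw [hb]
    rintro rfl
    exact htA (List.mem_filter.1 ha).1
  · simpa [FreeMonoid.toList_mul, toList_ltr_pow, List.replicate_succ] using hs

theorem sw_of_hyp_three (iso : ∀ x y : ℕ, x ≠ y → IsoL S [x, y])
    (hiii : ∀ (x y t : ℕ) (B : Word) (k : ℕ), [x, y, t].Nodup →
      AlmostLinear (ltr y * B) → 0 < occ B y → occ B x = 0 → occ B t = 0 →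
      BUnstable S x y (ltr x ^ k * ltr y * B) →
      ∃ p : ℕ, 0 < p ∧ p < k ∧
        Sat S (ltr x ^ (k - p) * ltr t * ltr x ^ p * ltr y * B)
          (ltr x ^ (k - p) * ltr t * ltr x ^ (p - 1) * ltr y * ltr x * B))
    (x y : ℕ) (T : Finset ℕ) (B : List ℕ) (k : ℕ) (hxy : x ≠ y) (hy : y ∉ T)
    (hB : ∀ z ∈ B, z = y ∨ z ∈ T) (hn : (B.filter (· ∈ T)).Nodup) (hyB : y ∈ B) (hxB : x ∉ B)
    (hV : ∃ v, SatL S (List.replicate k x ++ y :: B) v ∧ BBL (List.replicate k x ++ y :: B) v ∧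
      (List.replicate k x ++ y :: B).filter (fun z => z = x ∨ z = y)
        ≠ v.filter (fun z => z = x ∨ z = y)) :
    ∃ p, 0 < p ∧ p < k ∧ Sw S [p - 1, k - p] (exps y T B) := by
  obtain ⟨t, ht⟩ := exists_fresh (x :: y :: B)
  simp only [List.mem_cons, not_or] at ht
  obtain ⟨htx, hty, htB⟩ := ht
  have hBy : ∀ z ∈ y :: B, z = y ∨ z ∈ T := by
    intro z hz
    rcases List.mem_cons.1 hz with hz | hz
    · exact .inl hz
    · exact hB z hz
  obtain ⟨c, hc, hck, hs⟩ := hiii x y t (FreeMonoid.ofList B) k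
    (by simp; exact ⟨⟨hxy, Ne.symm htx⟩, Ne.symm hty⟩)
    (almostLinear_of (A := y :: B) hBy (by simpa [hy] using hn))
    (List.count_pos_iff.2 hyB) (List.count_eq_zero.2 hxB) (List.count_eq_zero.2 htB)
    (bUnstable_of iso (by
        rw [← toList_ne_nil]; simp [FreeMonoid.toList_mul])
      (by simpa [FreeMonoid.toList_mul, toList_ltr_pow] using hV))
  refine ⟨c, hc, hck, ?_⟩
  rw [sat_iff_satL] at hs
  obtain ⟨c, rfl⟩ : ∃ b, c = b + 1 := ⟨c - 1, by omega⟩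
  simp only [Nat.add_sub_cancel] at hs ⊢
  set T' : Finset ℕ := insert t (T.filter (· ∈ B)) with hT'
  have hx' : x ∉ T' := by simp [T', hxB, Ne.symm htx]
  have hy' : y ∉ T' := by simp [T', hy, Ne.symm hty]
  have hBT : ∀ z ∈ B, z ∈ T ↔ z ∈ T' := by
    intro z hz
    have : z ≠ t := by rintro rfl; exact htB hz
    simp [T', hz, this]
  have e1 : exps y T B = exps y T' B := exps_congr hBT
  have e2 := exps_two_blocks hx' (t := t) (by simp [T']) c (k - (c + 1))
  have e3 : List.replicate c x ++ t :: List.replicate (k - (c + 1)) x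
      = (List.replicate (k - (c + 1)) x ++ t :: List.replicate c x).reverse := by simp
  rw [e1, ← e2, e3]
  refine sw_of_satL hxy hx' hy' (fun z hz => ?_) (fun z hz => ?_) ?_ ?_
  · simp at hz
    rcases hz with hz | rfl | hz
    · exact .inl hz.2
    · right; simp [T']
    · exact .inl hz.2
  · rw [← hBT z hz]; exact hB z hz
  · have f1 : B.filter (· ∈ T') = B.filter (· ∈ T) :=
      List.filter_congr (fun z hz => by rw [decide_eq_decide]; exact (hBT z hz).symm)
    have f2 : (List.replicate (k - (c + 1)) x ++ t :: List.replicate c x).filter (· ∈ T') = [t] := by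
      rw [List.filter_append, List.filter_cons_of_pos (by simp [T'])]
      simp [hx']
    rw [f1, f2]
    refine List.nodup_cons.2 ⟨fun h => htB (List.mem_filter.1 h).1, hn⟩
  · simpa [FreeMonoid.toList_mul, toList_ltr_pow, List.replicate_succ'] using hs

/-! ### Well-quasi-orders and finite bases of exponent sequences. -/

/-- Otherwise one could keep choosing elements of `s` above none of those chosen before, which is a
bad sequence. -/
theorem exists_finite_basis {α : Type*} {r : α → α → Prop} (h : WellQuasiOrdered r) (s : Set α) :
    ∃ F ⊆ s, F.Finite ∧ ∀ a ∈ s, ∃ f ∈ F, r f a := by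
  by_contra hn
  push Not at hn
  obtain ⟨f, hf, hr⟩ := exists_seq_of_forall_finset_exists (· ∈ s) (fun x y => ¬ r x y)
    (fun F hF => by
      obtain ⟨a, ha, h⟩ := hn F hF F.finite_toSet
      exact ⟨a, ha, h⟩)
  obtain ⟨m, n, hmn, h⟩ := h f
  exact hr m n hmn h

/-- Higman's lemma over the well-ordered set of natural numbers. -/
theorem wellQuasiOrdered_sublistForall₂ :
    WellQuasiOrdered (List.SublistForall₂ (fun a b : ℕ => a ≤ b)) := by
  rw [← Set.partiallyWellOrderedOn_univ_iff]
  have h : (Set.univ : Set ℕ).PartiallyWellOrderedOn (fun a b => a ≤ b) := by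
    rw [Set.partiallyWellOrderedOn_univ_iff]
    exact wellQuasiOrdered_le
  refine (Set.PartiallyWellOrderedOn.partiallyWellOrderedOn_sublistForall₂ _ h).mono ?_
  intro l _ x _
  exact Set.mem_univ x

/-- `Ext a b a' b'` says that the pair `(a', b')` arises from `(a, b)` by adding the same numbers
to corresponding entries and by inserting the same entries at corresponding places. -/
inductive Ext : List ℕ → List ℕ → List ℕ → List ℕ → Prop
  | nil (l : List ℕ) : Ext [] [] l l
  | cons {a b a' b' : List ℕ} (i j e : ℕ) : Ext a b a' b' →
      Ext (i :: a) (j :: b) ((i + e) :: a') ((j + e) :: b')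
  | skip {a b a' b' : List ℕ} (e : ℕ) : Ext a b a' b' → Ext a b (e :: a') (e :: b')

/-- The insertions and additions leading from `a` to `a'` are replayed on `b`. -/
theorem exists_ext {a a' : List ℕ} (h : List.SublistForall₂ (fun a b : ℕ => a ≤ b) a a') :
    ∀ b : List ℕ, b.length = a.length → ∃ b', Ext a b a' b' := by
  induction h with
  | nil => intro b hb; rw [List.length_eq_zero_iff.1 hb]; exact ⟨_, .nil _⟩
  | @cons i i' a a' hi _ ih =>
    intro b hb
    cases b with
    | nil => simp at hb
    | cons j b =>
      obtain ⟨b', hb'⟩ := ih b (by simpa using hb)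
      refine ⟨(j + (i' - i)) :: b', ?_⟩
      have := Ext.cons i j (i' - i) hb'
      rwa [Nat.add_sub_cancel' hi] at this
  | cons_right _ ih =>
    intro b hb
    obtain ⟨b', hb'⟩ := ih b hb
    exact ⟨_, .skip _ hb'⟩

theorem Ext.length_eq {a b a' b' : List ℕ} (h : Ext a b a' b') : b'.length = a'.length := by
  induction h with
  | nil => rfl
  | cons i j e _ ih => simp [ih]
  | skip e _ ih => simp [ih]

theorem Ext.lex {a b a' b' : List ℕ} (h : Ext a b a' b') (hl : List.Lex (· < ·) b a) :
    List.Lex (· < ·) b' a' := by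
  induction h with
  | nil => simp at hl
  | cons i j e _ ih =>
    cases hl with
    | cons h => exact .cons (ih h)
    | rel h => exact .rel (by omega)
  | skip e _ ih => exact .cons (ih hl)

/-- Everything added is common to both sides, so it is absorbed into the separators or, in front of
the first matched entry, into a common left factor. -/
theorem Ext.weave {a b a' b' : List ℕ} (h : Ext a b a' b') (m : M) :
    ∀ s' : List M, s'.length = a'.length → ∃ (p : M) (s : List M), s.length = a.length ∧
      weave m a' s' = p * weave m a s ∧ weave m b' s' = p * weave m b s := by
  induction h with
  | nil l => intro s' _; exact ⟨WordId.weave m l s', [], rfl, by simp [WordId.weave],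
      by simp [WordId.weave]⟩
  | cons i j e _ ih =>
    intro s' hs'
    cases s' with
    | nil => simp at hs'
    | cons t s' =>
      obtain ⟨p, s, hs, h1, h2⟩ := ih s' (by simpa using hs')
      refine ⟨m ^ e, (t * p) :: s, by simp [hs], ?_, ?_⟩
      · simp only [WordId.weave, h1, add_comm i e, pow_add, mul_assoc]
      · simp only [WordId.weave, h2, add_comm j e, pow_add, mul_assoc]
  | skip e _ ih =>
    intro s' hs'
    cases s' with
    | nil => simp at hs'
    | cons t s' =>
      obtain ⟨p, s, hs, h1, h2⟩ := ih s' (by simpa using hs')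
      refine ⟨m ^ e * t * p, s, hs, ?_, ?_⟩
      · simp only [WordId.weave, h1, mul_assoc]
      · simp only [WordId.weave, h2, mul_assoc]

theorem Ext.rel {a b a' b' : List ℕ} (h : Ext a b a' b') (hr : Rel M a b) : Rel M a' b' := by
  intro m s' hs'
  obtain ⟨p, s, hs, h1, h2⟩ := h.weave m s' hs'
  rw [h1, h2, hr m s hs]

/-- Finitely many pairs of exponent sequences imply all that hold in `S`. -/
theorem exists_rel_basis (S : Type*) [Monoid S] : ∃ E : Set (List ℕ × List ℕ), E.Finite ∧
    (∀ e ∈ E, e.1 ≠ [] ∧ e.1.length = e.2.length ∧ Rel S e.1 e.2) ∧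
    ∀ (M : Type) [Monoid M], (∀ e ∈ E, Rel M e.1 e.2) →
      ∀ a b : List ℕ, a.length = b.length → Rel S a b → Rel M a b := by
  -- The sequences that `S` can reduce lexicographically; the finitely many rules rewrite a basis of
  -- them.
  let N : Set (List ℕ) := {a | ∃ b, b.length = a.length ∧ Rel S a b ∧ List.Lex (· < ·) b a}
  obtain ⟨F, hFN, hF, hbasis⟩ := exists_finite_basis wellQuasiOrdered_sublistForall₂ N
  choose! g hg using fun a (ha : a ∈ N) => (show ∃ b, b.length = a.length ∧ Rel S a b ∧
    List.Lex (· < ·) b a from ha)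
  refine ⟨(fun f => (f, g f)) '' F, hF.image _, ?_, ?_⟩
  · rintro _ ⟨f, hf, rfl⟩
    obtain ⟨h1, h2, h3⟩ := hg f (hFN hf)
    refine ⟨?_, h1.symm, h2⟩
    rintro rfl
    simp at h3
  · intro M _ hM
    -- A rule for `f` extends along the embedding of `f` into `a` and still decreases `a`, so
    -- well-foundedness of the shortlex order gives a normal form outside `N`.
    have nf : ∀ a : List ℕ, ∃ c, c.length = a.length ∧ Rel S a c ∧ Rel M a c ∧ c ∉ N := by
      intro a
      induction a using (List.Shortlex.wf (r := fun a b : ℕ => a < b) wellFounded_lt).induction with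
      | _ a ih =>
      by_cases ha : a ∈ N
      · obtain ⟨f, hf, hfa⟩ := hbasis a ha
        obtain ⟨h1, h2, h3⟩ := hg f (hFN hf)
        obtain ⟨b, hb⟩ := exists_ext hfa (g f) h1
        obtain ⟨c, hc1, hc2, hc3, hc4⟩ := ih b (.of_lex hb.length_eq (hb.lex h3))
        have e1 : Rel S a b := hb.rel h2
        have e2 : Rel M a b := hb.rel (hM _ ⟨f, hf, rfl⟩)
        refine ⟨c, hc1.trans hb.length_eq, fun m s hs => ?_, fun m s hs => ?_, hc4⟩
        · rw [e1 m s hs, hc2 m s (hs.trans hb.length_eq.symm)]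
        · rw [e2 m s hs, hc3 m s (hs.trans hb.length_eq.symm)]
      · exact ⟨a, rfl, fun _ _ _ => rfl, fun _ _ _ => rfl, ha⟩
    intro a b hab h
    obtain ⟨c, hc1, hc2, hc3, hc4⟩ := nf a
    obtain ⟨d, hd1, hd2, hd3, hd4⟩ := nf b
    -- Of two distinct normal forms related in `S`, the larger would lie in `N`.
    have hcd : c = d := by
      by_contra hne
      have hlen : c.length = d.length := by rw [hc1, hd1, hab]
      have hr : Rel S c d := fun m s hs => by
        rw [← hc2 m s (hs.trans hc1), h m s (hs.trans hc1), hd2 m s (by rw [hs, hlen, hd1])]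
      have hr' : Rel S d c := fun m s hs => (hr m s (hs.trans hlen.symm)).symm
      have htri : List.Shortlex (· < ·) c d ∨ List.Shortlex (· < ·) d c := by
        by_contra hn
        push Not at hn
        exact hne ((List.Shortlex.trichotomous (r := fun a b : ℕ => a < b)).trichotomous
          c d hn.1 hn.2)
      rcases htri with ht | ht
      · exact hd4 ⟨c, hlen, hr', (List.shortlex_iff_lex hlen).1 ht⟩
      · exact hc4 ⟨d, hlen.symm, hr, (List.shortlex_iff_lex hlen.symm).1 ht⟩
    subst hcd
    intro m s hs
    rw [hc3 m s hs, hd3 m s (hs.trans hab)]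

/-- The head exponent stands next to the interchanged pair, so heads must be matched with heads; the
surplus `i' - i` goes into the first separator. -/
theorem exists_weave_cons {a a' : List ℕ} {i i' : ℕ}
    (h : List.SublistForall₂ (fun a b : ℕ => a ≤ b) a a') (hi : i ≤ i') (m : M) {s' : List M}
    (hs' : s'.length = (i' :: a').length) : ∃ s : List M, s.length = (i :: a).length ∧
      weave m (i' :: a') s' = weave m (i :: a) s := by
  obtain ⟨b', hb'⟩ := exists_ext h a rfl
  cases s' with
  | nil => simp at hs'
  | cons t s' =>
    obtain ⟨p, s, hs, h1, -⟩ := hb'.weave m s' (by simpa using hs')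
    refine ⟨(m ^ (i' - i) * t * p) :: s, by simp [hs], ?_⟩
    have : i' = i + (i' - i) := by omega
    simp only [weave, h1, ← mul_assoc, ← pow_add]
    rw [← this]

theorem exists_weave'_cons {a a' : List ℕ} {i i' : ℕ}
    (h : List.SublistForall₂ (fun a b : ℕ => a ≤ b) a a') (hi : i ≤ i') (m : M) {s' : List M}
    (hs' : s'.length = (i' :: a').length) : ∃ s : List M, s.length = (i :: a).length ∧
      weave' m (i' :: a') s' = weave' m (i :: a) s := by
  obtain ⟨s, hs, e⟩ := exists_weave_cons h hi (MulOpposite.op m) (s' := s'.map MulOpposite.op)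
    (by simpa using hs')
  refine ⟨s.map MulOpposite.unop, by simpa using hs, ?_⟩
  rw [weave'_eq, weave'_eq, e, List.map_map]
  congr 2
  exact (List.map_id s).symm

/-- Larger exponents give a substitution instance, so the interchanges form an upward closed set. -/
theorem Sw.mono {a a' b b' : List ℕ} {i i' j j' : ℕ} (h : Sw M (i :: a) (j :: b))
    (ha : List.SublistForall₂ (fun a b : ℕ => a ≤ b) a a') (hi : i ≤ i')
    (hb : List.SublistForall₂ (fun a b : ℕ => a ≤ b) b b') (hj : j ≤ j') :
    Sw M (i' :: a') (j' :: b') := by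
  intro x y s s' hs hs'
  obtain ⟨r, hr, e⟩ := exists_weave'_cons ha hi x hs
  obtain ⟨r', hr', e'⟩ := exists_weave_cons hb hj y hs'
  rw [e, e', h x y r r' hr hr']

/-- Finitely many interchange identities imply all that hold in `S`. -/
theorem exists_sw_basis (S : Type*) [Monoid S] : ∃ E : Set (List ℕ × List ℕ), E.Finite ∧
    (∀ e ∈ E, 0 < e.1.sum ∧ 0 < e.2.sum ∧ Sw S e.1 e.2) ∧
    ∀ (M : Type) [Monoid M], (∀ e ∈ E, Sw M e.1 e.2) →
      ∀ α β : List ℕ, 0 < α.sum → 0 < β.sum → Sw S α β → Sw M α β := by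
  have w1 := wellQuasiOrdered_le (α := ℕ)
  have w2 := wellQuasiOrdered_sublistForall₂
  have : IsPreorder (ℕ × List ℕ)
      (fun a b => a.1 ≤ b.1 ∧ List.SublistForall₂ (fun a b : ℕ => a ≤ b) a.2 b.2) :=
    { refl := fun a => ⟨le_rfl, refl_of (List.SublistForall₂ (fun a b : ℕ => a ≤ b)) a.2⟩
      trans := fun _ _ _ h1 h2 => ⟨h1.1.trans h2.1, _root_.trans h1.2 h2.2⟩ }
  have w := (w1.prod w2).prod (w1.prod w2)
  let N : Set ((ℕ × List ℕ) × (ℕ × List ℕ)) := {c | 0 < (c.1.1 :: c.1.2).sum ∧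
    0 < (c.2.1 :: c.2.2).sum ∧ Sw S (c.1.1 :: c.1.2) (c.2.1 :: c.2.2)}
  obtain ⟨F, hFN, hF, hbasis⟩ := exists_finite_basis w N
  refine ⟨(fun c => (c.1.1 :: c.1.2, c.2.1 :: c.2.2)) '' F, hF.image _, ?_, ?_⟩
  · rintro _ ⟨c, hc, rfl⟩
    exact hFN hc
  · intro M _ hM α β hα hβ h
    cases α with
    | nil => simp at hα
    | cons i a =>
      cases β with
      | nil => simp at hβ
      | cons j b =>
        obtain ⟨c, hc, h1, h2⟩ := hbasis ((i, a), (j, b)) ⟨hα, hβ, h⟩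
        exact (hM _ ⟨c, hc, rfl⟩).mono h1.2 h1.1 h2.2 h2.1

/-! ### Concrete words for the basis. -/

/-- The list of singletons of the letters of `l`. -/
abbrev sing (l : List ℕ) : List (List ℕ) := l.map (fun t => [t])

theorem flatten_sing (l : List ℕ) : (sing l).flatten = l := by
  induction l with
  | nil => rfl
  | cons a l ih => simpa [sing] using ih

/-- Letters `2, 4, 6, …`. -/
def evens (n : ℕ) : List ℕ := (List.range n).map (fun i => 2 * i + 2)

/-- Letters `3, 5, 7, …`. -/
def odds (n : ℕ) : List ℕ := (List.range n).map (fun i => 2 * i + 3)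

theorem nodup_evens_odds (m n : ℕ) : (evens m ++ odds n).Nodup := by
  refine List.nodup_append.2 ⟨?_, ?_, ?_⟩
  · exact List.Nodup.map (fun a b h => by simp at h; omega) List.nodup_range
  · exact List.Nodup.map (fun a b h => by simp at h; omega) List.nodup_range
  · intro a ha b hb
    simp only [evens, odds, List.mem_map] at ha hb
    obtain ⟨i, _, rfl⟩ := ha
    obtain ⟨j, _, rfl⟩ := hb
    omega

theorem two_le_of_mem {m n a : ℕ} (h : a ∈ evens m ++ odds n) : 2 ≤ a := by
  simp only [evens, odds, List.mem_append, List.mem_map] at h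
  rcases h with ⟨i, _, rfl⟩ | ⟨i, _, rfl⟩ <;> omega

/-- The word `x ^ a₀ t₀ x ^ a₁ t₁ ⋯`. -/
def alWord (a : List ℕ) : List ℕ := weaveL 0 a (sing (evens a.length))

/-- The words `A x` and `y B` around which the interchange takes place. -/
def swWord (α β c : List ℕ) : List ℕ :=
  (weaveL 0 α (sing (evens α.length))).reverse ++ c ++ weaveL 1 β (sing (odds β.length))

theorem length_evens (n : ℕ) : (evens n).length = n := by simp [evens]

theorem length_odds (n : ℕ) : (odds n).length = n := by simp [odds]

theorem rel_iff_satL {a b : List ℕ} (hab : a.length = b.length) :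
    Rel M a b ↔ SatL M (alWord a) (alWord b) := by
  constructor
  · intro h φ
    rw [alWord, alWord, prod_map_weaveL, prod_map_weaveL, ← hab]
    exact h _ _ (by simp [length_evens])
  · intro h m s hs
    obtain ⟨f, hf⟩ := exists_map_eq (M := M) (List.nodup_append.1 (nodup_evens_odds a.length 0)).1
      (s := s) (by rw [hs, length_evens])
    have := h (fun z => if z = 0 then m else f z)
    rw [alWord, alWord, prod_map_weaveL, prod_map_weaveL, ← hab] at this
    have e : (sing (evens a.length)).map
        (fun w => (w.map (fun z => if z = 0 then m else f z)).prod) = s := by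
      rw [← hf, List.map_map]
      apply List.map_congr_left
      intro z hz
      have := two_le_of_mem (n := 0) (List.mem_append_left _ hz)
      have : z ≠ 0 := by omega
      simp [this]
    rwa [e] at this

theorem sw_iff_satL {α β : List ℕ} :
    Sw M α β ↔ SatL M (swWord α β [0, 1]) (swWord α β [1, 0]) := by
  constructor
  · intro h φ
    have := h (φ 0) (φ 1) ((sing (evens α.length)).map fun w => (w.reverse.map φ).prod)
      ((sing (odds β.length)).map fun w => (w.map φ).prod) (by simp [length_evens])
      (by simp [length_odds])
    rw [← prod_map_weaveL, ← prod_map_reverse_weaveL] at this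
    simpa [swWord, mul_assoc] using this
  · intro h m m' s s' hs hs'
    obtain ⟨f, hf⟩ := exists_map_eq (M := M) (nodup_evens_odds α.length β.length)
      (s := s ++ s') (by simp [hs, hs', length_evens, length_odds])
    rw [List.map_append] at hf
    obtain ⟨hf1, hf2⟩ := List.append_inj hf (by simp [hs, length_evens])
    let φ : ℕ → M := fun z => if z = 0 then m else if z = 1 then m' else f z
    have hφ : ∀ z, 2 ≤ z → φ z = f z := by
      intro z hz
      have h0 : z ≠ 0 := by omega
      have h1 : z ≠ 1 := by omega
      simp [φ, h0, h1]
    have e1 : (sing (evens α.length)).map (fun w => (w.reverse.map φ).prod) = s := by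
      rw [← hf1, List.map_map]
      apply List.map_congr_left
      intro z hz
      simp [hφ z (two_le_of_mem (n := 0) (List.mem_append_left _ hz))]
    have e2 : (sing (odds β.length)).map (fun w => (w.map φ).prod) = s' := by
      rw [← hf2, List.map_map]
      apply List.map_congr_left
      intro z hz
      simp [hφ z (two_le_of_mem (m := 0) (List.mem_append_right _ hz))]
    have := h φ
    simp only [swWord, List.map_append, List.prod_append, prod_map_weaveL,
      prod_map_reverse_weaveL, e1, e2] at this
    have h0 : φ 0 = m := by simp [φ]
    have h1 : φ 1 = m' := by simp [φ]
    simpa [h0, h1, mul_assoc] using this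

theorem count_alWord_le {a : List ℕ} {z : ℕ} (hz : z ≠ 0) : (alWord a).count z ≤ 1 := by
  have hm : 0 ∉ (sing (evens a.length)).flatten := by
    rw [flatten_sing]
    intro h
    have := two_le_of_mem (n := 0) (List.mem_append_left _ h)
    omega
  rw [alWord, count_weaveL_of_ne hz hm (by simp [length_evens]), flatten_sing]
  exact List.nodup_iff_count_le_one.1 (List.nodup_append.1 (nodup_evens_odds a.length 0)).1 z

theorem almostLinear_alWord (a : List ℕ) : AlmostLinear (FreeMonoid.ofList (alWord a)) := by
  have : ∀ z ∈ non (FreeMonoid.ofList (alWord a)), z = 0 := by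
    intro z hz
    by_contra h
    have h1 : 1 < (alWord a).count z := hz
    have := count_alWord_le (a := a) h
    omega
  intro z hz w hw
  rw [this z hz, this w hw]

theorem count_weaveL_self {y : ℕ} {E : List ℕ} {s : List (List ℕ)} (hs : y ∉ s.flatten)
    (hl : s.length = E.length) : (weaveL y E s).count y = E.sum := by
  induction E generalizing s with
  | nil => simp [weaveL]
  | cons a E ih =>
    cases s with
    | nil => simp at hl
    | cons t s =>
      simp only [List.flatten_cons, List.mem_append, not_or] at hs
      simp only [List.length_cons, Nat.add_right_cancel_iff] at hl
      simp [weaveL, ih hs.2 hl, List.count_eq_zero.2 hs.1]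

theorem count_swWord (α β c : List ℕ) (z : ℕ) : (swWord α β c).count z
    = c.count z + ((if z = 0 then α.sum else 0) + (if z = 1 then β.sum else 0))
      + (evens α.length ++ odds β.length).count z := by
  have hA : ∀ z, (weaveL 0 α (sing (evens α.length))).count z
      = (if z = 0 then α.sum else 0) + (evens α.length).count z := by
    intro z
    have hm : 0 ∉ evens α.length := fun h => by
      have := two_le_of_mem (n := 0) (List.mem_append_left _ h)
      omega
    by_cases hz : z = 0
    · subst hz
      rw [count_weaveL_self (by rwa [flatten_sing]) (by simp [length_evens]),
        List.count_eq_zero.2 hm]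
      simp
    · rw [count_weaveL_of_ne hz (by rwa [flatten_sing]) (by simp [length_evens]), flatten_sing]
      simp [hz]
  have hB : ∀ z, (weaveL 1 β (sing (odds β.length))).count z
      = (if z = 1 then β.sum else 0) + (odds β.length).count z := by
    intro z
    have hm : 1 ∉ odds β.length := fun h => by
      have := two_le_of_mem (m := 0) (List.mem_append_right _ h)
      omega
    by_cases hz : z = 1
    · subst hz
      rw [count_weaveL_self (by rwa [flatten_sing]) (by simp [length_odds]),
        List.count_eq_zero.2 hm]
      simp
    · rw [count_weaveL_of_ne hz (by rwa [flatten_sing]) (by simp [length_odds]), flatten_sing]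
      simp [hz]
  simp only [swWord, List.count_append, List.count_reverse, hA, hB]
  omega

/-- A projection onto one letter and the linear letters never keeps two distinct non-linear ones. -/
theorem bbl_swap {p q : List ℕ} {a b : ℕ} (hab : a ≠ b) (ha : 1 < (p ++ a :: b :: q).count a)
    (hb : 1 < (p ++ a :: b :: q).count b) : BBL (p ++ a :: b :: q) (p ++ b :: a :: q) := by
  intro x
  apply filter_swap
  simp only [decide_eq_true_eq, mem_linF]
  rintro ⟨h1 | h1, h2 | h2⟩ <;> omega

theorem twoNonlinear_of {u v : List ℕ} {x y : ℕ} (hxy : x ≠ y)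
    (hu : ∀ z, 1 < u.count z ↔ z = x ∨ z = y) (hv : ∀ z, v.count z = u.count z) :
    TwoNonlinear (FreeMonoid.ofList u, FreeMonoid.ofList v) := by
  have e : non (FreeMonoid.ofList u) ∪ non (FreeMonoid.ofList v) = {x, y} := by
    ext z
    have h1 : z ∈ non (FreeMonoid.ofList u) ↔ 1 < u.count z := Iff.rfl
    have h2 : z ∈ non (FreeMonoid.ofList v) ↔ 1 < v.count z := Iff.rfl
    rw [Set.mem_union, h1, h2, hv, or_self, hu]
    rfl
  unfold TwoNonlinear
  rw [e, Set.ncard_pair hxy]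

theorem blockBalanced_swWord {α β : List ℕ} (hα : 0 < α.sum) (hβ : 0 < β.sum) :
    BlockBalanced (FreeMonoid.ofList (swWord α β [0, 1]), FreeMonoid.ofList (swWord α β [1, 0])) ∧
      TwoNonlinear (FreeMonoid.ofList (swWord α β [0, 1]), FreeMonoid.ofList (swWord α β [1, 0])) := by
  have h0 : 1 < (swWord α β [0, 1]).count 0 := by rw [count_swWord]; simp; omega
  have h1 : 1 < (swWord α β [0, 1]).count 1 := by rw [count_swWord]; simp; omega
  constructor
  · rw [blockBalanced_iff]
    have := bbl_swap (p := (weaveL 0 α (sing (evens α.length))).reverse)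
      (q := weaveL 1 β (sing (odds β.length))) (a := 0) (b := 1) (by omega)
      (by simpa [swWord] using h0) (by simpa [swWord] using h1)
    simpa [swWord] using this
  · apply twoNonlinear_of (x := 0) (y := 1) (by omega)
    · intro z
      by_cases hz0 : z = 0
      · subst hz0; simpa using h0
      by_cases hz1 : z = 1
      · subst hz1; simpa using h1
      rw [count_swWord]
      have := List.nodup_iff_count_le_one.1 (nodup_evens_odds α.length β.length) z
      have e : ([0, 1] : List ℕ).count z = 0 := List.count_eq_zero.2 (by simp [hz0, hz1])
      rw [e]
      simp only [hz0, hz1, if_false, or_self, iff_false]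
      omega
    · intro z
      rw [count_swWord, count_swWord]
      have : ([1, 0] : List ℕ).count z = ([0, 1] : List ℕ).count z := by
        simp only [List.count_cons, List.count_nil]; omega
      rw [this]

/-! ### Deletion closure and equational logic. -/

/-- All identities with nonempty sides that arise from `B` by deleting variables. -/
def delClosure (B : Set Identity) : Set Identity :=
  {e | e.1 ≠ 1 ∧ e.2 ≠ 1 ∧ ∃ a ∈ B, ∃ X : Set ℕ, e = (restr a.1 X, restr a.2 X)}

theorem finite_delClosure {B : Set Identity} (hB : B.Finite) : (delClosure B).Finite := by
  have key : ∀ u : Word, {w : Word | ∃ X : Set ℕ, w = restr u X}.Finite := by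
    intro u
    refine ((FreeMonoid.toList u).sublists.finite_toSet.image FreeMonoid.ofList).subset ?_
    rintro _ ⟨X, rfl⟩
    classical
    exact ⟨_, List.mem_sublists.2 List.filter_sublist, rfl⟩
  refine (hB.biUnion (fun a _ => (key a.1).prod (key a.2))).subset ?_
  rintro e ⟨_, _, a, ha, X, rfl⟩
  exact Set.mem_biUnion ha ⟨⟨X, rfl⟩, ⟨X, rfl⟩⟩

theorem delClosure_subset {B : Set Identity} (hB : B ⊆ EqTheory S) : delClosure B ⊆ EqTheory S := by
  classical
  rintro e ⟨h1, h2, a, ha, X, rfl⟩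
  refine ⟨h1, h2, ?_⟩
  have := sat_iff_satL.1 (hB ha).2.2
  rw [sat_iff_satL, toList_restr _ X (fun z => decide (z ∈ X)) (by simp),
    toList_restr _ X (fun z => decide (z ∈ X)) (by simp)]
  exact this.filter _

theorem occ_restr (u : Word) (X : Set ℕ) (z : ℕ) [Decidable (z ∈ X)] :
    occ (restr u X) z = if z ∈ X then occ u z else 0 := by
  classical
  unfold occ
  rw [toList_restr _ X (fun z => decide (z ∈ X)) (by simp)]
  split_ifs with h
  · exact List.count_filter (by simpa using h)
  · exact List.count_eq_zero.2 (by simp [h])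

theorem non_restr (u : Word) (X : Set ℕ) : non (restr u X) = non u ∩ X := by
  classical
  ext z
  simp only [non, Set.mem_ofPred_eq, Set.mem_inter_iff, occ_restr]
  split_ifs with h <;> simp [h]

theorem AlmostLinear.restr {u : Word} (h : AlmostLinear u) (X : Set ℕ) :
    AlmostLinear (restr u X) := by
  unfold AlmostLinear
  rw [non_restr]
  exact h.anti Set.inter_subset_left

/-- If both non-linear letters survive the deletion, block-balance passes to the result; otherwise
at most one is left and the result is almost-linear. -/
theorem delClosure_property {B : Set Identity}
    (hB : ∀ e ∈ B, AlmostLinearId e ∨ (BlockBalanced e ∧ TwoNonlinear e)) :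
    ∀ e ∈ delClosure B, AlmostLinearId e ∨ (BlockBalanced e ∧ TwoNonlinear e) := by
  classical
  rintro e ⟨_, _, a, ha, X, rfl⟩
  rcases hB a ha with ⟨h1, h2⟩ | ⟨h1, h2⟩
  · exact .inl ⟨h1.restr X, h2.restr X⟩
  have hbb := blockBalanced_iff.1 h1
  have hnon : non a.1 = non a.2 := by
    ext z
    have : occ a.1 z = occ a.2 z := count_eq_of_filter (hbb z)
    simp only [non, Set.mem_ofPred_eq, this]
  unfold TwoNonlinear at h2
  rw [← hnon, Set.union_self] at h2
  by_cases hX : non a.1 ⊆ X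
  · right
    constructor
    · rw [blockBalanced_iff, toList_restr _ X (fun z => decide (z ∈ X)) (by simp),
        toList_restr _ X (fun z => decide (z ∈ X)) (by simp)]
      exact hbb.filter _
    · unfold TwoNonlinear
      rw [non_restr, non_restr, ← hnon, Set.union_self, Set.inter_eq_left.2 hX, h2]
  · left
    have hs : (non a.1 ∩ X).Subsingleton := by
      have hfin : (non a.1).Finite := Set.finite_of_ncard_ne_zero (by omega)
      have hlt := Set.ncard_lt_ncard (s := non a.1 ∩ X) (t := non a.1)
        (Set.inter_subset_left.ssubset_of_ne (fun h => hX (Set.inter_eq_left.1 h))) hfin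
      have : Finite ↑(non a.1 ∩ X) := hfin.subset Set.inter_subset_left
      exact Set.ncard_le_one_iff_subsingleton.1 (by omega)
    unfold AlmostLinearId AlmostLinear
    rw [non_restr, non_restr, ← hnon]
    exact ⟨hs, hs⟩

theorem Derives.mul_mul {B : Set Identity} {u v : Word} (h : Derives B u v) (p q : Word) :
    Derives B (p * u * q) (p * v * q) := by
  induction h with
  | refl => exact .refl _
  | symm _ ih => exact .symm ih
  | trans _ _ ih1 ih2 => exact .trans ih1 ih2
  | step h θ hθ p' q' =>
    have := Derives.step h θ hθ (p * p') (q' * q)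
    simpa only [mul_assoc] using this

/-- Derivability as a congruence on the free monoid. -/
def derivesCon (B : Set Identity) : Con Word where
  r := Derives B
  iseqv := ⟨.refl, .symm, .trans⟩
  mul' {u v u' v'} h h' := by
    have h1 := h.mul_mul 1 u'
    have h2 := h'.mul_mul v 1
    simp only [one_mul, mul_one] at h1 h2
    exact h1.trans h2

theorem lift_restr (θ : ℕ → Word) (X : Set ℕ) (hX : ∀ z, z ∉ X → θ z = 1) (θ' : ℕ → Word)
    (hθ' : ∀ z ∈ X, θ' z = θ z) (u : Word) :
    FreeMonoid.lift θ' (restr u X) = FreeMonoid.lift θ u := by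
  classical
  rw [FreeMonoid.lift_apply, FreeMonoid.lift_apply,
    toList_restr _ X (fun z => decide (z ∈ X)) (by simp)]
  induction FreeMonoid.toList u with
  | nil => rfl
  | cons z l ih =>
    by_cases hz : z ∈ X
    · simp [hz, ih, hθ' z hz]
    · simp [hz, ih, hX z hz]

/-- Letters sent to the empty word are deleted beforehand; what remains is a legitimate substitution
into a member of the closure. By `nil_of_satL`, one side vanishes only together with the other. -/
theorem derives_lift (iso : ∀ x y : ℕ, x ≠ y → IsoL S [x, y]) {B : Set Identity}
    (hB : B ⊆ EqTheory S) {a b : Word} (h : (a, b) ∈ B) (θ : ℕ → Word) :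
    Derives (delClosure B) (FreeMonoid.lift θ a) (FreeMonoid.lift θ b) := by
  classical
  set X : Set ℕ := {z | θ z ≠ 1} with hX
  let θ' : ℕ → Word := fun z => if z ∈ X then θ z else ltr z
  have hθ' : ∀ z ∈ X, θ' z = θ z := fun z hz => by simp [θ', hz]
  have h1 : ∀ z, z ∉ X → θ z = 1 := fun z hz => by simpa [X] using hz
  rw [← lift_restr θ X h1 θ' hθ' a, ← lift_restr θ X h1 θ' hθ' b]
  have hsat : SatL S (FreeMonoid.toList (restr a X)) (FreeMonoid.toList (restr b X)) := by
    rw [toList_restr _ X (fun z => decide (z ∈ X)) (by simp),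
      toList_restr _ X (fun z => decide (z ∈ X)) (by simp)]
    exact (sat_iff_satL.1 (hB h).2.2).filter _
  by_cases ha : restr a X = 1
  · rw [ha] at hsat
    have hb : restr b X = 1 := nil_of_satL iso hsat.symm
    rw [ha, hb]
    exact .refl _
  by_cases hb : restr b X = 1
  · rw [hb] at hsat
    exact absurd (nil_of_satL iso hsat) ha
  have hmem : (restr a X, restr b X) ∈ delClosure B := ⟨ha, hb, _, h, X, rfl⟩
  have hne : ∀ z, θ' z ≠ 1 := by
    intro z
    by_cases hz : z ∈ X
    · rw [hθ' z hz]; exact hz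
    · simp only [θ', hz, if_false]
      exact FreeMonoid.of_ne_one z
  simpa using Derives.step hmem θ' hne 1 1

/-- Every assignment into the quotient lifts to a substitution of words, possibly empty ones. -/
theorem satL_quotient (iso : ∀ x y : ℕ, x ≠ y → IsoL S [x, y]) {B : Set Identity}
    (hB : B ⊆ EqTheory S) {a b : Word} (h : (a, b) ∈ B) :
    SatL (derivesCon (delClosure B)).Quotient (FreeMonoid.toList a) (FreeMonoid.toList b) := by
  rw [← sat_iff_satL]
  intro φ
  choose θ hθ using fun z => (derivesCon (delClosure B)).mk'_surjective (φ z)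
  have key : ∀ u : Word, FreeMonoid.lift φ u
      = (derivesCon (delClosure B)).mk' (FreeMonoid.lift θ u) := by
    intro u
    have : FreeMonoid.lift φ = ((derivesCon (delClosure B)).mk').comp (FreeMonoid.lift θ) := by
      ext z
      simp [← hθ]
    rw [this]; rfl
  rw [key, key]
  exact (Con.eq _).2 (derives_lift iso hB h θ)

theorem derives_of_satL {B : Set Identity} {u v : Word}
    (h : SatL (derivesCon B).Quotient (FreeMonoid.toList u) (FreeMonoid.toList v)) :
    Derives B u v := by
  rw [← sat_iff_satL] at h
  have key : ∀ w : Word, FreeMonoid.lift (fun z => (derivesCon B).mk' (ltr z)) w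
      = (derivesCon B).mk' w := by
    intro w
    have : FreeMonoid.lift (fun z => (derivesCon B).mk' (ltr z)) = (derivesCon B).mk' := by
      ext z; simp
    rw [this]
  have := h (fun z => (derivesCon B).mk' (ltr z))
  rw [key, key] at this
  exact (Con.eq (derivesCon B)).1 this

theorem Derives.sat {B : Set Identity} (hB : B ⊆ EqTheory S) {u v : Word} (h : Derives B u v) :
    Sat S u v := by
  induction h with
  | refl => exact fun _ => rfl
  | symm _ ih => exact fun φ => (ih φ).symm
  | trans _ _ ih1 ih2 => exact fun φ => (ih1 φ).trans (ih2 φ)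
  | step h θ _ p q =>
    intro φ
    have key : ∀ w : Word, FreeMonoid.lift φ (FreeMonoid.lift θ w)
        = FreeMonoid.lift (fun z => FreeMonoid.lift φ (θ z)) w := by
      intro w
      have : (FreeMonoid.lift φ).comp (FreeMonoid.lift θ)
          = FreeMonoid.lift (fun z => FreeMonoid.lift φ (θ z)) := by
        ext z; simp
      rw [← this]; rfl
    simp only [map_mul, key, (hB h).2.2 _]

/-- The words of `σ₁`. -/
abbrev sigWord₁ (a b : ℕ) : List ℕ := [a, b, 2, 0, 3, 1]

/-- The words of `σ₂`. -/
abbrev sigWord₂ (a b : ℕ) : List ℕ := [0, 2, 1, 3, a, b]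

theorem sig_iff : Sig M ↔ SatL M (sigWord₁ 0 1) (sigWord₁ 1 0) ∧
    SatL M (sigWord₂ 0 1) (sigWord₂ 1 0) := by
  constructor
  · rintro ⟨h1, h2⟩
    refine ⟨fun φ => ?_, fun φ => ?_⟩
    · simpa [mul_assoc] using h1 (φ 0) (φ 1) (φ 2) (φ 3)
    · simpa [mul_assoc] using h2 (φ 0) (φ 1) (φ 2) (φ 3)
  · rintro ⟨h1, h2⟩
    refine ⟨fun x y s t => ?_, fun x y s t => ?_⟩
    · simpa [mul_assoc] using h1 (fun z => if z = 0 then x else if z = 1 then y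
        else if z = 2 then s else t)
    · simpa [mul_assoc] using h2 (fun z => if z = 0 then x else if z = 1 then y
        else if z = 2 then s else t)

theorem blockBalanced_sigWord :
    (BlockBalanced (FreeMonoid.ofList (sigWord₁ 0 1), FreeMonoid.ofList (sigWord₁ 1 0)) ∧
      TwoNonlinear (FreeMonoid.ofList (sigWord₁ 0 1), FreeMonoid.ofList (sigWord₁ 1 0))) ∧
    (BlockBalanced (FreeMonoid.ofList (sigWord₂ 0 1), FreeMonoid.ofList (sigWord₂ 1 0)) ∧
      TwoNonlinear (FreeMonoid.ofList (sigWord₂ 0 1), FreeMonoid.ofList (sigWord₂ 1 0))) := by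
  have two : ∀ z : ℕ, 1 < ([0, 1, 2, 0, 3, 1] : List ℕ).count z ↔ z = 0 ∨ z = 1 := by
    intro z
    simp only [List.count_cons, List.count_nil, beq_iff_eq]
    split_ifs <;> omega
  have e₁ : ∀ z, (sigWord₁ 1 0).count z = (sigWord₁ 0 1).count z := by
    intro z; simp only [List.count_cons, List.count_nil]; omega
  have e₂ : ∀ z, (sigWord₂ 1 0).count z = (sigWord₂ 0 1).count z := by
    intro z; simp only [List.count_cons, List.count_nil]; omega
  have two' : ∀ z : ℕ, 1 < (sigWord₂ 0 1).count z ↔ z = 0 ∨ z = 1 := by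
    intro z
    simp only [List.count_cons, List.count_nil, beq_iff_eq]
    split_ifs <;> omega
  refine ⟨⟨?_, twoNonlinear_of (by omega) two e₁⟩, ⟨?_, twoNonlinear_of (by omega) two' e₂⟩⟩
  · rw [blockBalanced_iff]
    exact bbl_swap (p := []) (q := [2, 0, 3, 1]) (a := 0) (b := 1) (by omega) (by decide)
      (by decide)
  · rw [blockBalanced_iff]
    exact bbl_swap (p := [0, 2, 1, 3]) (q := []) (a := 0) (b := 1) (by omega) (by decide)
      (by decide)

end WordId

theorem mainTheorem6 {S : Type*} [Monoid S]
    (hσ₁ : WordId.SatSigma1 S) (hσ₂ : WordId.SatSigma2 S)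
    (hxy : ∀ x y : ℕ, x ≠ y → WordId.IsIsoterm S (WordId.ltr x * WordId.ltr y))
    (hi : ∀ x y t₁ t₂ : ℕ, [x, y, t₁, t₂].Nodup → ∀ m n : ℕ, 1 < m → 1 < n →
      ¬ WordId.IsIsoterm S (WordId.ltr x ^ m * WordId.ltr y ^ n) →
      ∃ d c : ℕ, 0 < d ∧ d < m ∧ 0 < c ∧ c < n ∧
        WordId.Sat S
          (WordId.ltr x ^ d * WordId.ltr t₁ * WordId.ltr x ^ (m - d) * WordId.ltr y ^ (n - c) *
            WordId.ltr t₂ * WordId.ltr y ^ c)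
          (WordId.ltr x ^ d * WordId.ltr t₁ * WordId.ltr y ^ (n - c) * WordId.ltr x ^ (m - d) *
            WordId.ltr t₂ * WordId.ltr y ^ c))
    (hii : ∀ (x y t : ℕ) (A : WordId.Word) (k : ℕ), [x, y, t].Nodup →
      WordId.AlmostLinear (A * WordId.ltr x) → 0 < WordId.occ A x →
      WordId.occ A y = 0 → WordId.occ A t = 0 →
      WordId.BUnstable S x y (A * WordId.ltr x * WordId.ltr y ^ k) →
      ∃ c : ℕ, 0 < c ∧ c < k ∧
        WordId.Sat S
          (A * WordId.ltr x * WordId.ltr y ^ c * WordId.ltr t * WordId.ltr y ^ (k - c))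
          (A * WordId.ltr y * WordId.ltr x * WordId.ltr y ^ (c - 1) * WordId.ltr t *
            WordId.ltr y ^ (k - c)))
    (hiii : ∀ (x y t : ℕ) (B : WordId.Word) (k : ℕ), [x, y, t].Nodup →
      WordId.AlmostLinear (WordId.ltr y * B) → 0 < WordId.occ B y →
      WordId.occ B x = 0 → WordId.occ B t = 0 →
      WordId.BUnstable S x y (WordId.ltr x ^ k * WordId.ltr y * B) →
      ∃ p : ℕ, 0 < p ∧ p < k ∧
        WordId.Sat S
          (WordId.ltr x ^ (k - p) * WordId.ltr t * WordId.ltr x ^ p * WordId.ltr y * B)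
          (WordId.ltr x ^ (k - p) * WordId.ltr t * WordId.ltr x ^ (p - 1) * WordId.ltr y *
            WordId.ltr x * B)) :
    WordId.FinitelyBasedBy S
      (fun e => WordId.AlmostLinearId e ∨
        (WordId.BlockBalanced e ∧ WordId.TwoNonlinear e)) := by
  open WordId in
  have iso := isoL_pair hxy
  have sigS : Sig S := by
    rw [sig_iff]
    exact ⟨sat_iff_satL.1 (hσ₁ 0 1 2 3 (by decide)), sat_iff_satL.1 (hσ₂ 0 1 2 3 (by decide))⟩
  obtain ⟨E₁, hE₁, hE₁', hE₁M⟩ := exists_rel_basis S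
  obtain ⟨E₂, hE₂, hE₂', hE₂M⟩ := exists_sw_basis S
  let w : List ℕ → List ℕ → Identity := fun u v => (FreeMonoid.ofList u, FreeMonoid.ofList v)
  let B : Set Identity := {w (sigWord₁ 0 1) (sigWord₁ 1 0), w (sigWord₂ 0 1) (sigWord₂ 1 0)} ∪
    ((fun e => w (alWord e.1) (alWord e.2)) '' E₁ ∪
      (fun e => w (swWord e.1 e.2 [0, 1]) (swWord e.1 e.2 [1, 0])) '' E₂)
  have hBfin : B.Finite := (Set.toFinite _).union ((hE₁.image _).union (hE₂.image _))
  have hBS : B ⊆ EqTheory S := by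
    rintro e ((rfl | rfl) | ⟨e, he, rfl⟩ | ⟨e, he, rfl⟩)
    · exact mem_eqTheory.2 ⟨by simp, by simp, (sig_iff.1 sigS).1⟩
    · exact mem_eqTheory.2 ⟨by simp, by simp, (sig_iff.1 sigS).2⟩
    · obtain ⟨h1, h2, h3⟩ := hE₁' e he
      have hne : ∀ a : List ℕ, a ≠ [] → alWord a ≠ [] := by
        intro a ha h
        cases a with
        | nil => exact ha rfl
        | cons i a => simp [alWord, evens, List.range_succ_eq_map, weaveL] at h
      exact mem_eqTheory.2 ⟨hne _ h1, hne _ (by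
        rw [← List.length_pos_iff, ← h2, List.length_pos_iff]; exact h1), (rel_iff_satL h2).1 h3⟩
    · exact mem_eqTheory.2 ⟨by simp [swWord], by simp [swWord],
        sw_iff_satL.1 (hE₂' e he).2.2⟩
  have hBP : ∀ e ∈ B, AlmostLinearId e ∨ (BlockBalanced e ∧ TwoNonlinear e) := by
    rintro e ((rfl | rfl) | ⟨e, he, rfl⟩ | ⟨e, he, rfl⟩)
    · exact .inr blockBalanced_sigWord.1
    · exact .inr blockBalanced_sigWord.2
    · exact .inl ⟨almostLinear_alWord _, almostLinear_alWord _⟩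
    · exact .inr (blockBalanced_swWord (hE₂' e he).1 (hE₂' e he).2.1)
  have hQ : ∀ u v, w u v ∈ B → SatL (derivesCon (delClosure B)).Quotient u v :=
    fun u v h => satL_quotient iso hBS h
  -- The quotient plays the role of `M`: evaluating at the classes of the letters turns satisfaction
  -- in it into derivability. The field `sat` is soundness of derivations.
  have H : Setup S (derivesCon (delClosure B)).Quotient :=
    { sigS := sigS
      sigM := sig_iff.2 ⟨hQ _ _ (.inl (.inl rfl)), hQ _ _ (.inl (.inr rfl))⟩
      sat := fun u v h => sat_iff_satL.1 ((derives_of_satL (u := FreeMonoid.ofList u)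
        (v := FreeMonoid.ofList v) h).sat (delClosure_subset hBS))
      rel := hE₁M _ (fun e he => (rel_iff_satL (hE₁' e he).2.1).2
        (hQ _ _ (.inr (.inl ⟨e, he, rfl⟩))))
      sw := hE₂M _ (fun e he => sw_iff_satL.2 (hQ _ _ (.inr (.inr ⟨e, he, rfl⟩))))
      iso := iso
      one := sw_of_hyp_one sigS iso hi
      two := sw_of_hyp_two iso hii
      three := sw_of_hyp_three iso hiii }
  refine ⟨delClosure B, finite_delClosure hBfin, delClosure_subset hBS, delClosure_property hBP,
    fun e he => ?_⟩
  exact derives_of_satL (H.satL (sat_iff_satL.1 he.2.2))
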